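/- Let $k$ be an algebraically closed field of characteristic $p>0$, and let $\mathfrak{sl}_2$ be the Lie algebra of traceless $2\times2$ matrices over $k$ with basis $e=\begin{pmatrix}0&1\\0&0\end{pmatrix}$, $f=\begin{pmatrix}0&0\\1&0\end{pmatrix}$, $h=\begin{pmatrix}1&0\\0&-1\end{pmatrix}$ and dual coordinates $x,y,z$. Let $\mathcal N=\{X\in\mathfrak{sl}_2 : X^p=0\}$ be its restricted nullcone (the zero locus of $xy+z^2$), $A=k[\mathcal N]$ its graded coordinate ring and $\mathbb P(\mathcal N)=\operatorname{Proj}A$. The morphism $\iota:\mathbb P^1=\operatorname{Proj}k[s,t]\to\mathbb P(\mathcal N)$, $[s:t]\mapsto[s^2:-t^2:st]$, is given by $x\mapsto s^2$, $y\mapsto-t^2$, $z\mapsto st$. For an $\mathfrak{sl}_2$-module $M$ put $\widetilde M=\mathcal O_{\mathbb P(\mathcal N)}\otimes_kM$, and let $\Theta_M:\widetilde M\to\widetilde M(1)$ be the global operator, i.e. the sheaf map induced by the action of $x\otimes e+y\otimes f+z\otimes h$ on $A\otimes_kM$. Let $\mathcal K(M)=\iota^*(\ker\Theta_M)$. Consider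 the following modules, where for $\lambda\ge0$ we write $\lambda=rp+a$ with $0\le a<p$. * $V(\lambda)$ has basis $v_0,\dots,v_\lambda$ with $ev_i=(\lambda-i+1)v_{i-1}$, $fv_i=(i+1)v_{i+1}$, $hv_i=(\lambda-2i)v_i$ (where $v_{-1}=v_{\lambda+1}=0$), and $V(\lambda)^*$ is its dual module. * Let $SL_2$ act on $V(\lambda)$ so that the coefficient of $v_j$ in $\begin{pmatrix}\alpha&\beta\\\gamma&\delta\end{pmatrix}v_i$ is the coefficient of $X^{\lambda-i}Y^i$ in $(\alpha X+\beta Y)^{\lambda-j}(\gamma X+\delta Y)^j$. Put $\phi([1:\varepsilon])=\begin{pmatrix}0&1\\-1&-\varepsilon\end{pmatrix}$ and $\phi([0:1])=\begin{pmatrix}1&0\\0&1\end{pmatrix}$. For $\xi\in\mathbb P^1(k)$, $\Phi_\xi(\lambda)=\phi(\xi)\cdot\operatorname{span}(v_{a+1},\dots,v_\lambda)$, an $\mathfrak{sl}_2$-submodule of $V(\lambda)$. * For $0\le a<p-1$, $Q(a)$ has basis $v_0,\dots,v_{2p-a-2},w_{p-a-1},\dots,w_{p-1}$ with $ev_i=-(a+i+1)v_{i-1}$,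 $fv_i=(i+1)v_{i+1}$, $hv_i=-(a+2i+2)v_i$, $ew_i=-(a+i+1)w_{i-1}+\frac1iv_{i-1}$, $hw_i=-(a+2i+2)w_i$, $fw_i=(i+1)w_{i+1}$ for $i<p-1$, and $fw_{p-1}=-\frac1{a+1}v_p$ (vectors with index out of range being zero). Then $\iota$ is an isomorphism $\mathbb P^1\simeq\mathbb P(\mathcal N)$, and for $\lambda=rp+a$ with $0\le a<p$ the kernel bundles of these modules are as follows. 1. If $\lambda\ge p$ and $p\nmid\lambda+1$, then for every $\xi\in\mathbb P^1(k)$, $\mathcal K(\Phi_\xi(\lambda))\simeq\mathcal O_{\mathbb P^1}(a+2-p)^{\oplus r}$. 2. If $\lambda<p$ or $p\nmid\lambda+1$, then $\mathcal K(V(\lambda))\simeq\mathcal O_{\mathbb P^1}(-\lambda)\oplus\mathcal O_{\mathbb P^1}(a+2-p)^{\oplus r}$. 3. If $\lambda<p$ or $p\nmid\lambda+1$, then $\mathcal K(V(\lambda)^*)\simeq\mathcal O_{\mathbb P^1}(-a)^{\oplus r+1}$. 4. If $0\le a<p-1$, then $\mathcal K(Q(a))\simeq\mathcal O_{\mathbb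 P^1}(-a)\oplus\mathcal O_{\mathbb P^1}(a+2-2p)$. (The remaining indecomposable projective module $Q(p-1)=V(p-1)$ is covered by 2.) -/

import Mathlib

open CategoryTheory AlgebraicGeometry TopologicalSpace Opposite

universe u

set_option linter.unusedVariables false
set_option linter.unusedSectionVars false

namespace ProjTwist

section

variable {A σ : Type u} [CommRing A] [SetLike σ A] [AddSubgroupClass σ A]
variable (𝒜 : ℕ → σ) [GradedRing 𝒜]
variable {N τ : Type u} [AddCommGroup N] [Module A N] [SetLike τ N] [AddSubgroupClass τ N]
variable (𝒩 : ℕ → τ)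

/-- The complement in `A` of the homogeneous prime ideal `x`. -/
abbrev compl (x : ProjectiveSpectrum 𝒜) : Submonoid A :=
  x.asHomogeneousIdeal.toIdeal.primeCompl

/-- The localization `N_x` of the `A`-module `N` at the homogeneous prime `x`. -/
abbrev StalkAt (N : Type u) [AddCommGroup N] [Module A N] (x : ProjectiveSpectrum 𝒜) : Type u :=
  LocalizedModule (compl 𝒜 x) N

/-- `r` lies in the degree `m` part of the graded module, which is zero when `m < 0`. -/
def InDegree (m : ℤ) (r : N) : Prop :=
  r = 0 ∨ ∃ i : ℕ, (i : ℤ) = m ∧ r ∈ 𝒩 i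

lemma InDegree.add {m : ℤ} {r r' : N} (h : InDegree 𝒩 m r) (h' : InDegree 𝒩 m r') :
    InDegree 𝒩 m (r + r') := by
  rcases h with rfl | ⟨i, hi, hr⟩
  · simpa using h'
  rcases h' with rfl | ⟨i', hi', hr'⟩
  · rw [add_zero]; exact Or.inr ⟨i, hi, hr⟩
  obtain rfl : i = i' := by omega
  exact Or.inr ⟨i, hi, add_mem hr hr'⟩

lemma InDegree.smul (hgr : SetLike.GradedSMul 𝒜 𝒩) {m m' : ℤ} {j : ℕ} {s : A} {r : N}
    (hs : s ∈ 𝒜 j) (h : InDegree 𝒩 m r) (hm : m' = j + m) : InDegree 𝒩 m' (s • r) := by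
  rcases h with rfl | ⟨i, hi, hr⟩
  · exact Or.inl (smul_zero _)
  exact Or.inr ⟨j + i, by push_cast; omega, hgr.smul_mem hs hr⟩

/-- A function `U → ∐ N_x` which is a fixed fraction `r / s`, with `r ∈ N` and `s ∈ A` homogeneous
and `deg r = deg s + n`. -/
def IsFraction (n : ℤ) {U : Opens (ProjectiveSpectrum.top 𝒜)}
    (f : ∀ x : U, StalkAt 𝒜 N x.1) : Prop :=
  ∃ (j : ℕ) (r : N) (s : A), s ∈ 𝒜 j ∧ InDegree 𝒩 (j + n) r ∧
    ∀ x : U, ∃ hs : s ∈ compl 𝒜 x.1, f x = LocalizedModule.mk r ⟨s, hs⟩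

/-- The functions which are locally homogeneous fractions of degree `n`. -/
def isLocallyFraction (n : ℤ) :
    TopCat.LocalPredicate (X := ProjectiveSpectrum.top 𝒜) (fun x ↦ StalkAt 𝒜 N x) :=
  TopCat.PrelocalPredicate.sheafify
    { pred := fun f ↦ IsFraction 𝒜 𝒩 n f
      res := by
        rintro V U i f ⟨l, r, s, hs, hr, w⟩
        exact ⟨l, r, s, hs, hr, fun x ↦ w (i x)⟩ }

variable [SetLike.GradedSMul 𝒜 𝒩]

/-- The sections over `U`, as an additive group. -/
def sectionsAddSubgroup (n : ℤ) (U : (Opens (ProjectiveSpectrum.top 𝒜))ᵒᵖ) :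
    AddSubgroup (∀ x : U.unop, StalkAt 𝒜 N x.1) where
  carrier := {f | (isLocallyFraction 𝒜 𝒩 n).pred f}
  zero_mem' x := ⟨U.unop, x.2, 𝟙 _, 0, 0, 1, SetLike.one_mem_graded 𝒜, Or.inl rfl,
    fun y ↦ ⟨one_mem _, (LocalizedModule.zero_mk _).symm⟩⟩
  add_mem' {f g} hf hg x := by
    obtain ⟨V, mV, iV, j, r, s, hs, hr, w⟩ := hf x
    obtain ⟨V', mV', iV', j', r', s', hs', hr', w'⟩ := hg x
    refine ⟨V ⊓ V', ⟨mV, mV'⟩, Opens.infLELeft _ _ ≫ iV, j + j', s' • r + s • r', s * s',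
      SetLike.mul_mem_graded hs hs', ?_, fun y ↦ ?_⟩
    · exact (InDegree.smul 𝒜 𝒩 inferInstance hs' hr (by push_cast; ring)).add 𝒩
        (InDegree.smul 𝒜 𝒩 inferInstance hs hr' (by push_cast; ring))
    · obtain ⟨h1, e1⟩ := w ⟨y.1, y.2.1⟩
      obtain ⟨h2, e2⟩ := w' ⟨y.1, y.2.2⟩
      exact ⟨mul_mem h1 h2, congr($e1 + $e2).trans (LocalizedModule.mk_add_mk ..)⟩
  neg_mem' {f} hf x := by
    obtain ⟨V, mV, iV, j, r, s, hs, hr, w⟩ := hf x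
    refine ⟨V, mV, iV, j, -r, s, hs, ?_, fun y ↦ ?_⟩
    · rcases hr with rfl | ⟨i, hi, hr⟩
      · exact Or.inl neg_zero
      · exact Or.inr ⟨i, hi, neg_mem hr⟩
    · obtain ⟨h1, e1⟩ := w y
      exact ⟨h1, congr(-$e1).trans LocalizedModule.mk_neg.symm⟩

/-- The sections over `U`, as a module over `𝒪(U)`. -/
instance sectionsSMul (n : ℤ) (U : (Opens (ProjectiveSpectrum.top 𝒜))ᵒᵖ) :
    SMul ((ProjectiveSpectrum.Proj.structureSheaf 𝒜).1.obj U)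
      (sectionsAddSubgroup 𝒜 𝒩 n U) where
  smul c f := ⟨fun x ↦ (c.1 x).val • f.1 x, fun x ↦ by
    obtain ⟨V, mV, iV, i, ⟨a, ha⟩, ⟨b, hb⟩, nb, wc⟩ := c.2 x
    obtain ⟨V', mV', iV', j, r, s, hs, hr, w⟩ := f.2 x
    refine ⟨V ⊓ V', ⟨mV, mV'⟩, Opens.infLELeft _ _ ≫ iV, i + j, a • r, b * s,
      SetLike.mul_mem_graded hb hs, InDegree.smul 𝒜 𝒩 inferInstance ha hr (by push_cast; ring),
      fun y ↦ ?_⟩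
    obtain ⟨h1, e1⟩ := w ⟨y.1, y.2.2⟩
    have e0 := congr(HomogeneousLocalization.val $(wc ⟨y.1, y.2.1⟩))
    rw [HomogeneousLocalization.val_mk] at e0
    exact ⟨mul_mem (nb ⟨y.1, y.2.1⟩) h1,
      congr($e0 • $e1).trans (LocalizedModule.mk_smul_mk ..)⟩⟩

instance sectionsModule (n : ℤ) (U : (Opens (ProjectiveSpectrum.top 𝒜))ᵒᵖ) :
    Module ((ProjectiveSpectrum.Proj.structureSheaf 𝒜).1.obj U)
      (sectionsAddSubgroup 𝒜 𝒩 n U) where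
  one_smul f := Subtype.ext <| funext fun x ↦
    (congrArg (· • f.1 x) HomogeneousLocalization.val_one).trans (one_smul _ _)
  mul_smul c d f := Subtype.ext <| funext fun x ↦
    (congrArg (· • f.1 x) (HomogeneousLocalization.val_mul _ _)).trans (mul_smul _ _ _)
  smul_zero c := Subtype.ext <| funext fun x ↦ smul_zero _
  smul_add c f g := Subtype.ext <| funext fun x ↦ smul_add _ _ _
  add_smul c d f := Subtype.ext <| funext fun x ↦
    (congrArg (· • f.1 x) (HomogeneousLocalization.val_add _ _)).trans (add_smul _ _ _)
  zero_smul f := Subtype.ext <| funext fun x ↦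
    (congrArg (· • f.1 x) HomogeneousLocalization.val_zero).trans (zero_smul _ _)

/-- The presheaf of abelian groups underlying `N~(n)`. -/
def abPresheaf (n : ℤ) : TopCat.Presheaf AddCommGrpCat.{u} (ProjectiveSpectrum.top 𝒜) where
  obj U := AddCommGrpCat.of (sectionsAddSubgroup 𝒜 𝒩 n U)
  map i := AddCommGrpCat.ofHom
    { toFun f := ⟨fun x ↦ f.1 (i.unop x), (isLocallyFraction 𝒜 𝒩 n).res i.unop f.1 f.2⟩
      map_zero' := rfl
      map_add' _ _ := rfl }

/-- The quasi-coherent sheaf `N~(n)` on `Proj 𝒜` associated with the graded module `N` twisted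
by `n`: its sections are the functions which are locally of the form `r / s` with `r ∈ N`,
`s ∈ A` homogeneous, `deg r = deg s + n`. -/
noncomputable def twist (n : ℤ) : (Proj 𝒜).Modules where
  val :=
    letI (U : (Opens (Proj 𝒜))ᵒᵖ) :
        Module ((Proj 𝒜).ringCatSheaf.obj.obj U) ((abPresheaf 𝒜 𝒩 n).obj U) :=
      sectionsModule 𝒜 𝒩 n U
    PresheafOfModules.ofPresheaf (R := (Proj 𝒜).ringCatSheaf.obj) (abPresheaf 𝒜 𝒩 n) fun _ _ _ _ _ ↦ rfl
  isSheaf := (TopCat.Presheaf.isSheaf_iff_isSheaf_comp (forget AddCommGrpCat) _).2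
    (TopCat.subsheafToTypes (isLocallyFraction 𝒜 𝒩 n)).2

variable {𝒜 𝒩} {N' τ' : Type u} [AddCommGroup N'] [Module A N'] [SetLike τ' N']
  [AddSubgroupClass τ' N'] {𝒩' : ℕ → τ'} [SetLike.GradedSMul 𝒜 𝒩']

lemma InDegree.map (φ : N →ₗ[A] N') {d : ℕ} (hφ : ∀ i, ∀ r ∈ 𝒩 i, φ r ∈ 𝒩' (i + d))
    {m m' : ℤ} {r : N} (h : InDegree 𝒩 m r) (hm : m' = m + d) : InDegree 𝒩' m' (φ r) := by
  rcases h with rfl | ⟨i, hi, hr⟩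
  · exact Or.inl (map_zero _)
  · exact Or.inr ⟨i + d, by push_cast; omega, hφ i r hr⟩

variable (𝒜) in
/-- The map of stalks induced by an `A`-linear map. -/
noncomputable abbrev stalkMap (φ : N →ₗ[A] N') (x : ProjectiveSpectrum 𝒜) :
    StalkAt 𝒜 N x →ₗ[Localization (compl 𝒜 x)] StalkAt 𝒜 N' x :=
  LocalizedModule.map (compl 𝒜 x) φ

/-- The action of `φ` on sections: `r / s ↦ φ r / s`. -/
noncomputable def sectionsMap (φ : N →ₗ[A] N') {d : ℕ}
    (hφ : ∀ i, ∀ r ∈ 𝒩 i, φ r ∈ 𝒩' (i + d)) {n m : ℤ} (hm : m = n + d)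
    (U : (Opens (ProjectiveSpectrum.top 𝒜))ᵒᵖ) :
    sectionsAddSubgroup 𝒜 𝒩 n U →+ sectionsAddSubgroup 𝒜 𝒩' m U where
  toFun f := ⟨fun x ↦ stalkMap 𝒜 φ x.1 (f.1 x), fun x ↦ by
    obtain ⟨V, mV, iV, j, r, s, hs, hr, w⟩ := f.2 x
    refine ⟨V, mV, iV, j, φ r, s, hs, hr.map φ hφ (by rw [hm]; ring), fun y ↦ ?_⟩
    obtain ⟨h1, e1⟩ := w y
    exact ⟨h1, congr(stalkMap 𝒜 φ y.1 $e1).trans (LocalizedModule.map_mk ..)⟩⟩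
  map_zero' := Subtype.ext <| funext fun x ↦ map_zero (stalkMap 𝒜 φ x.1)
  map_add' f g := Subtype.ext <| funext fun x ↦ map_add (stalkMap 𝒜 φ x.1) _ _

/-- The morphism of sheaves `N~(n) ⟶ N'~(m)` induced by an `A`-linear map `N → N'` which is
homogeneous of degree `d`, where `m = n + d`. -/
noncomputable def twistMap (φ : N →ₗ[A] N') {d : ℕ} (hφ : ∀ i, ∀ r ∈ 𝒩 i, φ r ∈ 𝒩' (i + d))
    {n m : ℤ} (hm : m = n + d) : twist 𝒜 𝒩 n ⟶ twist 𝒜 𝒩' m where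
  val := PresheafOfModules.homMk
    { app := fun U ↦ AddCommGrpCat.ofHom (sectionsMap φ hφ hm U)
      naturality := fun _ _ _ ↦ rfl }
    fun U c f ↦ Subtype.ext <| funext fun x ↦ map_smul (stalkMap 𝒜 φ x.1) _ _

end
end ProjTwist

namespace ProjDeg

section

variable {A B σ τ : Type u} [CommRing A] [SetLike σ A] [AddSubgroupClass σ A]
  [CommRing B] [SetLike τ B] [AddSubgroupClass τ B]
  {𝒜 : ℕ → σ} {ℬ : ℕ → τ} [GradedRing 𝒜] [GradedRing ℬ]

/-- A ring homomorphism which multiplies degrees by `d > 0` and whose image of the irrelevant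
ideal has no zeros on `Proj ℬ`. -/
structure DegHom (𝒜 : ℕ → σ) (ℬ : ℕ → τ) [GradedRing 𝒜] [GradedRing ℬ] (d : ℕ) where
  toRingHom : A →+* B
  map_mem : ∀ {i : ℕ} {a : A}, a ∈ 𝒜 i → toRingHom a ∈ ℬ (d * i)
  pos : 0 < d
  irrelevant_le : (HomogeneousIdeal.irrelevant ℬ).toIdeal ≤
    ((HomogeneousIdeal.irrelevant 𝒜).toIdeal.map toRingHom).radical

variable {d : ℕ} (f : DegHom 𝒜 ℬ d)

lemma decompose_map (a : A) (i : ℕ) :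
    (DirectSum.decompose ℬ (f.toRingHom a) (d * i) : B) =
      f.toRingHom (DirectSum.decompose 𝒜 a i) := by
  classical
  induction a using DirectSum.Decomposition.inductionOn 𝒜 with
  | zero => simp
  | @homogeneous j m =>
    by_cases h : i = j
    · subst h
      rw [DirectSum.decompose_of_mem_same _ (f.map_mem m.2),
        DirectSum.decompose_of_mem_same _ m.2]
    · rw [DirectSum.decompose_of_mem_ne _ (f.map_mem m.2), DirectSum.decompose_of_mem_ne _ m.2,
        map_zero]
      · exact fun e ↦ h e.symm
      · exact fun e ↦ h (Nat.eq_of_mul_eq_mul_left f.pos e).symm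
  | add a b ha hb => simp [ha, hb]

/-- The map on points, `x ↦ f⁻¹(x)`. -/
def comapFun (x : ProjectiveSpectrum ℬ) : ProjectiveSpectrum 𝒜 where
  asHomogeneousIdeal :=
    { toSubmodule := x.asHomogeneousIdeal.toIdeal.comap f.toRingHom
      is_homogeneous' := fun i a ha ↦ by
        have := x.asHomogeneousIdeal.2 (d * i) ha
        rw [decompose_map] at this
        exact this }
  isPrime := x.isPrime.comap f.toRingHom
  not_irrelevant_le h := x.not_irrelevant_le <| f.irrelevant_le.trans <|
    x.isPrime.radical_le_iff.2 <| Ideal.map_le_iff_le_comap.2 h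

/-- The continuous map on points, `x ↦ f⁻¹(x)`. -/
def comap : C(ProjectiveSpectrum ℬ, ProjectiveSpectrum 𝒜) where
  toFun := comapFun f
  continuous_toFun := by
    simp_rw [continuous_iff_isClosed, ProjectiveSpectrum.isClosed_iff_zeroLocus, exists_imp,
      forall_eq_apply_imp_iff]
    intro s
    refine ⟨f.toRingHom '' s, ?_⟩
    ext x
    exact (Set.image_subset_iff (f := f.toRingHom)).symm

/-- The map on localizations, `a / b ↦ f a / f b`. -/
noncomputable abbrev locHom (x : ProjectiveSpectrum ℬ) :
    Localization.AtPrime (comapFun f x).asHomogeneousIdeal.toIdeal →+*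
      Localization.AtPrime x.asHomogeneousIdeal.toIdeal :=
  Localization.localRingHom (comapFun f x).asHomogeneousIdeal.toIdeal
    x.asHomogeneousIdeal.toIdeal f.toRingHom rfl

/-- The map on homogeneous fractions, `a / b ↦ f a / f b`. -/
def numDenMap (x : ProjectiveSpectrum ℬ)
    (c : HomogeneousLocalization.NumDenSameDeg 𝒜
      (comapFun f x).asHomogeneousIdeal.toIdeal.primeCompl) :
    HomogeneousLocalization.NumDenSameDeg ℬ x.asHomogeneousIdeal.toIdeal.primeCompl :=
  ⟨d * c.deg, ⟨f.toRingHom c.num, f.map_mem c.num.2⟩,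
    ⟨f.toRingHom c.den, f.map_mem c.den.2⟩, c.den_mem⟩

lemma embedding_numDenMap (x : ProjectiveSpectrum ℬ)
    (c : HomogeneousLocalization.NumDenSameDeg 𝒜
      (comapFun f x).asHomogeneousIdeal.toIdeal.primeCompl) :
    (numDenMap f x c).embedding = locHom f x c.embedding :=
  (Localization.localRingHom_mk (comapFun f x).asHomogeneousIdeal.toIdeal
    x.asHomogeneousIdeal.toIdeal f.toRingHom rfl c.num.1 ⟨c.den.1, c.den_mem⟩).symm

/-- The map on stalks, `a / b ↦ f a / f b`. -/
noncomputable def stalkFun (x : ProjectiveSpectrum ℬ) :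
    HomogeneousLocalization.AtPrime 𝒜 (comapFun f x).asHomogeneousIdeal.toIdeal →
      HomogeneousLocalization.AtPrime ℬ x.asHomogeneousIdeal.toIdeal :=
  Quotient.map' (numDenMap f x) fun c c' h ↦
    (embedding_numDenMap f x c).trans <|
      (congrArg (locHom f x) h).trans (embedding_numDenMap f x c').symm

lemma val_stalkFun (x : ProjectiveSpectrum ℬ)
    (z : HomogeneousLocalization.AtPrime 𝒜 (comapFun f x).asHomogeneousIdeal.toIdeal) :
    (stalkFun f x z).val = locHom f x z.val := by
  obtain ⟨c, rfl⟩ := z.mk_surjective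
  exact embedding_numDenMap f x c

/-- The ring homomorphism on stalks, `a / b ↦ f a / f b`. -/
noncomputable def stalkHom (x : ProjectiveSpectrum ℬ) :
    HomogeneousLocalization.AtPrime 𝒜 (comapFun f x).asHomogeneousIdeal.toIdeal →+*
      HomogeneousLocalization.AtPrime ℬ x.asHomogeneousIdeal.toIdeal where
  toFun := stalkFun f x
  map_one' := by ext; simp [val_stalkFun]
  map_zero' := by ext; simp [val_stalkFun]
  map_add' a b := by ext; simp [val_stalkFun]
  map_mul' a b := by ext; simp [val_stalkFun]

lemma isLocalHom_stalkHom (x : ProjectiveSpectrum ℬ) : IsLocalHom (stalkHom f x) where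
  map_nonunit z hz := by
    rw [← HomogeneousLocalization.isUnit_iff_isUnit_val] at hz ⊢
    change IsUnit (stalkFun f x z).val at hz
    rw [val_stalkFun] at hz
    exact (Localization.isLocalHom_localRingHom (comapFun f x).asHomogeneousIdeal.toIdeal
      x.asHomogeneousIdeal.toIdeal f.toRingHom rfl).map_nonunit _ hz

/-- The pullback of sections along `comap f`. -/
noncomputable def sectionsHom (U : Opens (ProjectiveSpectrum.top 𝒜)) :
    (ProjectiveSpectrum.Proj.structureSheaf 𝒜).1.obj (op U) →+*
      (ProjectiveSpectrum.Proj.structureSheaf ℬ).1.obj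
        (op (U.comap (comap f) : Opens (ProjectiveSpectrum.top ℬ))) where
  toFun s := ⟨fun y ↦ stalkHom f y.1 (s.1 ⟨comapFun f y.1, y.2⟩), fun y ↦ by
    obtain ⟨V, mV, iV, i, ⟨a, ha⟩, ⟨b, hb⟩, nb, w⟩ := s.2 ⟨comapFun f y.1, y.2⟩
    exact ⟨V.comap (comap f), mV, homOfLE fun z hz ↦ leOfHom iV hz, d * i,
      ⟨f.toRingHom a, f.map_mem ha⟩, ⟨f.toRingHom b, f.map_mem hb⟩,
      fun z ↦ nb ⟨comapFun f z.1, z.2⟩,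
      fun z ↦ congr(stalkHom f z.1 $(w ⟨comapFun f z.1, z.2⟩))⟩⟩
  map_one' := Subtype.ext <| funext fun y ↦ map_one (stalkHom f y.1)
  map_zero' := Subtype.ext <| funext fun y ↦ map_zero (stalkHom f y.1)
  map_add' s t := Subtype.ext <| funext fun y ↦ map_add (stalkHom f y.1) _ _
  map_mul' s t := Subtype.ext <| funext fun y ↦ map_mul (stalkHom f y.1) _ _

/-- The morphism of sheafed spaces. -/
noncomputable def sheafedSpaceMap : Proj.toSheafedSpace ℬ ⟶ Proj.toSheafedSpace 𝒜 where
  hom :=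
    { base := TopCat.ofHom <| comap f
      c := 
        { app := fun U ↦ CommRingCat.ofHom
            (R := (ProjectiveSpectrum.Proj.structureSheaf 𝒜).1.obj U)
            (S := (ProjectiveSpectrum.Proj.structureSheaf ℬ).1.obj
              (op (U.unop.comap (comap f) : Opens (ProjectiveSpectrum.top ℬ))))
            (sectionsHom f U.unop)
          naturality := fun _ _ _ ↦ rfl } }

lemma isLocalHom_stalkMap (x : Proj.toSheafedSpace ℬ) :
    IsLocalHom ((sheafedSpaceMap f).hom.stalkMap x).hom where
  map_nonunit z hz := by
    obtain ⟨U, hU, s, rfl⟩ := (ProjectiveSpectrum.Proj.structureSheaf 𝒜).presheaf.exists_germ_eq z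
    have h1 := PresheafedSpace.stalkMap_germ_apply (sheafedSpaceMap f).hom U x hU s
    have h2 : IsUnit ((ProjectiveSpectrum.Proj.structureSheaf ℬ).presheaf.germ
        (U.comap (comap f) : Opens (ProjectiveSpectrum.top ℬ)) x hU (sectionsHom f U s)) :=
      Eq.mp (congrArg IsUnit h1) hz
    have h3 : IsUnit (stalkHom f x (s.1 ⟨comapFun f x, hU⟩)) :=
      Eq.mp (congrArg IsUnit (Proj.stalkIso'_germ ℬ (U.comap (comap f)) x hU (sectionsHom f U s)))
        (h2.map (Proj.stalkIso' ℬ x))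
    have h4 : IsUnit (s.1 ⟨comapFun f x, hU⟩) := (isLocalHom_stalkHom f x).map_nonunit _ h3
    exact (MulEquiv.isUnit_map (Proj.stalkIso' 𝒜 (comapFun f x))).1
      (Eq.mpr (congrArg IsUnit (Proj.stalkIso'_germ 𝒜 U (comapFun f x) hU s)) h4)

/-- The morphism `Proj ℬ ⟶ Proj 𝒜`. -/
noncomputable def map : Proj ℬ ⟶ Proj 𝒜 where
  __ := (sheafedSpaceMap f).hom
  prop x := isLocalHom_stalkMap f x

end
end ProjDeg

section QuotientGrading

variable {k S : Type u} [CommRing k] [CommRing S] [Algebra k S] (𝒮 : ℕ → Submodule k S)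
  [GradedAlgebra 𝒮] (I : Ideal S)

/-- The grading of `S ⧸ I` by the images of the graded pieces of `S`. -/
def quotientGrading (i : ℕ) : Submodule k (S ⧸ I) :=
  (𝒮 i).map (Ideal.Quotient.mkₐ k I).toLinearMap

/-- The map of graded pieces `S_i → (S ⧸ I)_i`. -/
def quotientPiece (i : ℕ) : 𝒮 i →ₗ[k] quotientGrading 𝒮 I i :=
  ((Ideal.Quotient.mkₐ k I).toLinearMap.comp (𝒮 i).subtype).codRestrict _
    fun x ↦ Submodule.mem_map_of_mem x.2

/-- The decomposition of `x ∈ S`, reduced modulo `I`. -/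
noncomputable def reducedDecompose : S →ₗ[k] DirectSum ℕ fun i ↦ quotientGrading 𝒮 I i :=
  (DirectSum.lmap (quotientPiece 𝒮 I)).comp (DirectSum.decomposeLinearEquiv 𝒮).toLinearMap

lemma reducedDecompose_eq_zero (hI : I.IsHomogeneous 𝒮) {x : S} (hx : x ∈ I) :
    reducedDecompose 𝒮 I x = 0 :=
  DFinsupp.ext fun i ↦ Subtype.ext (Ideal.Quotient.eq_zero_iff_mem.2 (hI i hx))

/-- For a homogeneous ideal `I`, the decomposition of `S` induces one of `S ⧸ I`. -/
noncomputable def quotientDecompose (hI : I.IsHomogeneous 𝒮) :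
    (S ⧸ I) →ₗ[k] DirectSum ℕ fun i ↦ quotientGrading 𝒮 I i where
  toFun := Quotient.lift (reducedDecompose 𝒮 I) fun x y hxy ↦ by
    have h1 : x - y ∈ I := (Submodule.quotientRel_def I).1 hxy
    have h2 := reducedDecompose_eq_zero 𝒮 I hI h1
    rw [map_sub] at h2
    exact sub_eq_zero.1 h2
  map_add' := by
    rintro ⟨x⟩ ⟨y⟩
    exact map_add (reducedDecompose 𝒮 I) x y
  map_smul' := by
    rintro c ⟨x⟩
    exact map_smul (reducedDecompose 𝒮 I) c x

lemma quotientDecompose_mk (hI : I.IsHomogeneous 𝒮) {i : ℕ} (x : 𝒮 i) :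
    quotientDecompose 𝒮 I hI (Ideal.Quotient.mk I x) =
      DirectSum.of (fun i ↦ quotientGrading 𝒮 I i) i (quotientPiece 𝒮 I i x) := by
  have : quotientDecompose 𝒮 I hI (Ideal.Quotient.mk I x) =
    DirectSum.lmap (quotientPiece 𝒮 I) (DirectSum.decompose 𝒮 (x : S)) := rfl
  rw [this, DirectSum.decompose_coe]
  exact DirectSum.lmap_lof (quotientPiece 𝒮 I) i x

/-- The graded algebra structure on the quotient by a homogeneous ideal. -/
noncomputable abbrev quotientGradedAlgebra (hI : I.IsHomogeneous 𝒮) :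
    GradedAlgebra (quotientGrading 𝒮 I) where
  one_mem := ⟨1, SetLike.one_mem_graded 𝒮, map_one (Ideal.Quotient.mk I)⟩
  mul_mem := by
    rintro i j _ _ ⟨x, hx, rfl⟩ ⟨y, hy, rfl⟩
    exact ⟨x * y, SetLike.mul_mem_graded hx hy, map_mul (Ideal.Quotient.mk I) _ _⟩
  toDecomposition := DirectSum.Decomposition.ofLinearMap _ (quotientDecompose 𝒮 I hI)
    (by
      refine LinearMap.ext fun z ↦ ?_
      obtain ⟨x, rfl⟩ := Ideal.Quotient.mk_surjective z
      induction x using DirectSum.Decomposition.inductionOn 𝒮 with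
      | zero => simp
      | @homogeneous i m =>
        rw [LinearMap.comp_apply, quotientDecompose_mk]
        exact DirectSum.coeAddMonoidHom_of _ _ _
      | add a b ha hb => rw [map_add, map_add, ha, hb, map_add])
    (by
      refine DirectSum.linearMap_ext k fun i ↦ LinearMap.ext ?_
      rintro ⟨_, x, hx, rfl⟩
      have : DirectSum.coeLinearMap (quotientGrading 𝒮 I) (DirectSum.lof k ℕ
          (fun i ↦ quotientGrading 𝒮 I i) i ⟨_, x, hx, rfl⟩) = Ideal.Quotient.mk I x :=
        DirectSum.coeLinearMap_lof _ _ _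
      exact (congrArg (quotientDecompose 𝒮 I hI) this).trans
        (quotientDecompose_mk 𝒮 I hI ⟨x, hx⟩))

end QuotientGrading

attribute [local instance] LieRing.ofAssociativeRing
attribute [local instance] MvPolynomial.gradedAlgebra

namespace SlTwo

open MvPolynomial

section Nullcone

variable (k : Type u) [Field k]

/-- The Lie algebra `sl_2` of traceless `2 × 2` matrices. -/
abbrev sl2 : LieSubalgebra k (Matrix (Fin 2) (Fin 2) k) := LieAlgebra.SpecialLinear.sl (Fin 2) k

/-- The standard basis vector `e`. -/
def e : sl2 k := ⟨!![0, 1; 0, 0], by simp [LieAlgebra.SpecialLinear.sl, Matrix.trace_fin_two]⟩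

/-- The standard basis vector `f`. -/
def f : sl2 k := ⟨!![0, 0; 1, 0], by simp [LieAlgebra.SpecialLinear.sl, Matrix.trace_fin_two]⟩

/-- The standard basis vector `h`. -/
def h : sl2 k := ⟨!![1, 0; 0, -1], by simp [LieAlgebra.SpecialLinear.sl, Matrix.trace_fin_two]⟩

/-- The restricted nullcone: the elements whose `p`-th power vanishes. -/
def nullcone (p : ℕ) : Set (sl2 k) := {X | (X : Matrix (Fin 2) (Fin 2) k) ^ p = 0}

/-- The point of `sl_2` with coordinates `(x, y, z)` in the basis `e, f, h`. -/
def point (v : Fin 3 → k) : sl2 k := v 0 • e k + v 1 • f k + v 2 • h k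

/-- The ideal of polynomials in the coordinates `x, y, z` (dual to `e, f, h`) vanishing on the
restricted nullcone. -/
noncomputable def nullIdeal (p : ℕ) : Ideal (MvPolynomial (Fin 3) k) :=
  vanishingIdeal k {v : Fin 3 → k | point k v ∈ nullcone k p}

/-- The coordinate ring of the restricted nullcone. -/
noncomputable abbrev CoordRing (p : ℕ) : Type u := MvPolynomial (Fin 3) k ⧸ nullIdeal k p

/-- The grading of the coordinate ring, with `x, y, z` in degree one. -/
noncomputable abbrev coordGrading (p : ℕ) : ℕ → Submodule k (CoordRing k p) :=
  quotientGrading (homogeneousSubmodule (Fin 3) k) (nullIdeal k p)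

lemma coeff_line {σ : Type} [DecidableEq σ] (v : σ → k) (i : ℕ) (F : MvPolynomial σ k) :
    (aeval (fun j ↦ Polynomial.C (v j) * Polynomial.X) F : Polynomial k).coeff i =
      aeval v (homogeneousComponent i F) := by
  induction F using MvPolynomial.induction_on' with
  | monomial d c =>
    have h1 : (aeval (fun j ↦ Polynomial.C (v j) * Polynomial.X) (monomial d c) : Polynomial k)
        = Polynomial.C (c * d.prod fun j n ↦ v j ^ n) * Polynomial.X ^ d.degree := by
      rw [aeval_monomial]
      simp only [mul_pow, Finsupp.prod, Finset.prod_mul_distrib, Finset.prod_pow_eq_pow_sum,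
        Finsupp.degree, map_mul, map_prod, map_pow, mul_assoc]
      rfl
    rw [h1, Polynomial.coeff_C_mul_X_pow]
    have h2 : homogeneousComponent i (monomial d c) = if i = d.degree then monomial d c else 0 := by
      ext d'
      rw [coeff_homogeneousComponent, coeff_monomial]
      by_cases a : d = d'
      · subst a
        by_cases b : d.degree = i
        · rw [if_pos b, if_pos b.symm, coeff_monomial]
        · rw [if_neg b, if_neg (Ne.symm b), coeff_zero]
      · rw [if_neg a, ite_self]
        split_ifs
        · rw [coeff_monomial, if_neg a]
        · rw [coeff_zero]
    rw [h2]
    split_ifs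
    · rw [aeval_monomial]; rfl
    · simp
  | add F G hF hG => simp only [map_add, Polynomial.coeff_add, hF, hG]

variable [IsAlgClosed k]

lemma nullIdeal_isHomogeneous (p : ℕ) :
    (nullIdeal k p).IsHomogeneous (homogeneousSubmodule (Fin 3) k) := by
  intro i F hF v hv
  have hd : ((DirectSum.decompose (homogeneousSubmodule (Fin 3) k) F i : _) :
      MvPolynomial (Fin 3) k) = homogeneousComponent i F := decomposition.decompose'_apply F i
  rw [hd, ← coeff_line]
  have : (aeval (fun j ↦ Polynomial.C (v j) * Polynomial.X) F : Polynomial k) = 0 := by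
    refine Polynomial.funext fun c ↦ ?_
    have h1 : Polynomial.eval c (aeval (fun j ↦ Polynomial.C (v j) * Polynomial.X) F) =
        aeval (c • v) F := by
      have h0 : (Polynomial.aeval c).comp
          (aeval fun j ↦ Polynomial.C (v j) * Polynomial.X) = aeval (c • v) := by
        refine MvPolynomial.algHom_ext fun j ↦ ?_
        rw [AlgHom.comp_apply, aeval_X, aeval_X, map_mul, Polynomial.aeval_C, Polynomial.aeval_X]
        exact mul_comm _ _
      exact DFunLike.congr_fun h0 F
    rw [h1, Polynomial.eval_zero]
    refine hF (c • v) ?_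
    have h2 : point k (c • v) = c • point k v := by
      simp [point, smul_smul]
    change ((point k (c • v) : sl2 k) : Matrix (Fin 2) (Fin 2) k) ^ p = 0
    have h3 : ((point k v : sl2 k) : Matrix (Fin 2) (Fin 2) k) ^ p = 0 := hv
    rw [h2]
    change (c • ((point k v : sl2 k) : Matrix (Fin 2) (Fin 2) k)) ^ p = 0
    rw [smul_pow, h3, smul_zero]
  rw [this, Polynomial.coeff_zero]

noncomputable instance (p : ℕ) : GradedAlgebra (coordGrading k p) :=
  quotientGradedAlgebra _ _ (nullIdeal_isHomogeneous k p)

/-- The projectivization of the restricted nullcone. -/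
noncomputable def PNullcone (p : ℕ) : Scheme.{u} := Proj (coordGrading k p)

/-- The projective line `Proj k[s, t]`. -/
noncomputable def P1 : Scheme.{u} := Proj (homogeneousSubmodule (Fin 2) k)

/-- Evaluation of polynomials at `(x, y, z) = (s ^ 2, - t ^ 2, s t)`. -/
noncomputable def iotaPoly : MvPolynomial (Fin 3) k →ₐ[k] MvPolynomial (Fin 2) k :=
  aeval ![X 0 ^ 2, - X 1 ^ 2, X 0 * X 1]

lemma iotaPoly_eq_zero {p : ℕ} (hp : 2 ≤ p) (F : MvPolynomial (Fin 3) k)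
    (hF : F ∈ nullIdeal k p) : iotaPoly k F = 0 := by
  refine MvPolynomial.funext fun w ↦ ?_
  have h1 : eval w (iotaPoly k F) = aeval ![w 0 ^ 2, - w 1 ^ 2, w 0 * w 1] F := by
    have h0 : (aeval w : MvPolynomial (Fin 2) k →ₐ[k] k).comp (iotaPoly k) =
        aeval ![w 0 ^ 2, - w 1 ^ 2, w 0 * w 1] := by
      ext j
      fin_cases j <;> simp [iotaPoly]
    exact DFunLike.congr_fun h0 F
  rw [h1, map_zero]
  refine hF _ ?_
  change ((point k _ : sl2 k) : Matrix (Fin 2) (Fin 2) k) ^ p = 0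
  refine pow_eq_zero_of_le hp ?_
  ext i j
  fin_cases i <;> fin_cases j <;> simp [point, e, f, h, pow_two, Matrix.mul_apply] <;> ring

variable (p : ℕ) [Fact p.Prime]

/-- The homomorphism of coordinate rings `x ↦ s ^ 2`, `y ↦ - t ^ 2`, `z ↦ s t`. -/
noncomputable def iotaRingHom : CoordRing k p →+* MvPolynomial (Fin 2) k :=
  Ideal.Quotient.lift (nullIdeal k p) (iotaPoly k).toRingHom
    fun F hF ↦ iotaPoly_eq_zero k (Fact.out : p.Prime).two_le F hF

lemma X_sq_mem (i : Fin 2) : (X i ^ 2 : MvPolynomial (Fin 2) k) ∈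
    (HomogeneousIdeal.irrelevant (coordGrading k p)).toIdeal.map (iotaRingHom k p) := by
  have key (j : Fin 3) : (iotaPoly k (X j)) ∈
      (HomogeneousIdeal.irrelevant (coordGrading k p)).toIdeal.map (iotaRingHom k p) := by
    refine Ideal.mem_map_of_mem (iotaRingHom k p) (x := Ideal.Quotient.mk _ (X j)) ?_
    refine (HomogeneousIdeal.mem_irrelevant_iff _ _).2 ?_
    have h1 : Ideal.Quotient.mk (nullIdeal k p) (X j) ∈ coordGrading k p 1 :=
      ⟨X j, isHomogeneous_X k j, rfl⟩
    exact DirectSum.decompose_of_mem_ne _ h1 one_ne_zero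
  fin_cases i
  · simpa [iotaPoly] using key 0
  · simpa [iotaPoly] using key 1

/-- The homomorphism of coordinate rings doubles degrees. -/
noncomputable def iotaDegHom :
    ProjDeg.DegHom (coordGrading k p) (homogeneousSubmodule (Fin 2) k) 2 where
  toRingHom := iotaRingHom k p
  map_mem := by
    rintro i _ ⟨F, hF, rfl⟩
    refine IsHomogeneous.aeval hF _ fun j ↦ ?_
    fin_cases j
    · exact isHomogeneous_X_pow 0 2
    · exact (isHomogeneous_X_pow 1 2).neg
    · exact (isHomogeneous_X k 0).mul (isHomogeneous_X k 1)
  pos := two_pos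
  irrelevant_le := by
    refine (HomogeneousIdeal.toIdeal_irrelevant_le _).2 fun i hi F hF ↦ ?_
    have h1 (j : Fin 2) : (X j : MvPolynomial (Fin 2) k) ∈
        ((HomogeneousIdeal.irrelevant (coordGrading k p)).toIdeal.map (iotaRingHom k p)).radical :=
      ⟨2, X_sq_mem k p j⟩
    rw [F.as_sum]
    refine sum_mem fun d hd ↦ ?_
    have h2 : d.degree = i := by
      have := hF (mem_support_iff.1 hd)
      rwa [Finsupp.degree_eq_weight_one]
    obtain ⟨j, hj⟩ : ∃ j, d j ≠ 0 := by
      by_contra! h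
      have : d = 0 := Finsupp.ext h
      subst this
      simp at h2
      omega
    have h3 : X j ∣ monomial d (coeff d F) := (X_dvd_monomial).2 (Or.inr hj)
    exact Ideal.mem_of_dvd _ h3 (h1 j)

/-- The morphism `ℙ¹ → ℙ(N)`, `[s : t] ↦ [s ^ 2 : - t ^ 2 : s t]`. -/
noncomputable def iota : P1 k ⟶ PNullcone k p := ProjDeg.map (iotaDegHom k p)

end Nullcone

open scoped TensorProduct

section Theta

variable (k : Type u) [Field k] [IsAlgClosed k] (p : ℕ)
  (M : Type u) [AddCommGroup M] [Module k M] [LieRingModule (sl2 k) M] [LieModule k (sl2 k) M]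

/-- The grading of `A ⊗ M`, with `A` the coordinate ring of the nullcone and `M` in degree zero. -/
noncomputable def tensorGrading (i : ℕ) : Submodule k (CoordRing k p ⊗[k] M) :=
  LinearMap.range ((coordGrading k p i).subtype.rTensor M)

instance : SetLike.GradedSMul (coordGrading k p) (tensorGrading k p M) where
  smul_mem := by
    rintro i j a _ ha ⟨t, rfl⟩
    induction t using TensorProduct.induction_on with
    | zero => simp
    | tmul b m => exact ⟨⟨a * b.1, SetLike.mul_mem_graded ha b.2⟩ ⊗ₜ m, rfl⟩
    | add t t' ht ht' =>
      rw [map_add, smul_add]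
      exact add_mem ht ht'

/-- The image in the coordinate ring of the `i`-th of the coordinates `x, y, z`. -/
noncomputable def coord (i : Fin 3) : CoordRing k p := Ideal.Quotient.mk (nullIdeal k p) (X i)

lemma coord_mem (i : Fin 3) : coord k p i ∈ coordGrading k p 1 :=
  ⟨X i, isHomogeneous_X k i, rfl⟩

/-- The action of `x ⊗ e + y ⊗ f + z ⊗ h` on `A ⊗ M`. -/
noncomputable def thetaLin : CoordRing k p ⊗[k] M →ₗ[CoordRing k p] CoordRing k p ⊗[k] M :=
  coord k p 0 • (LieModule.toEnd k (sl2 k) M (e k)).baseChange (CoordRing k p) +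
  coord k p 1 • (LieModule.toEnd k (sl2 k) M (f k)).baseChange (CoordRing k p) +
  coord k p 2 • (LieModule.toEnd k (sl2 k) M (h k)).baseChange (CoordRing k p)

lemma thetaLin_mem (i : ℕ) : ∀ t ∈ tensorGrading k p M i,
    thetaLin k p M t ∈ tensorGrading k p M (i + 1) := by
  rintro _ ⟨t, rfl⟩
  induction t using TensorProduct.induction_on with
  | zero => simp
  | tmul b m =>
    have key (j : Fin 3) (m' : M) : (coord k p j * b.1) ⊗ₜ[k] m' ∈ tensorGrading k p M (i + 1) :=
      ⟨⟨coord k p j * b.1, add_comm 1 i ▸ SetLike.mul_mem_graded (coord_mem k p j) b.2⟩ ⊗ₜ m', rfl⟩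
    exact add_mem (add_mem (key 0 _) (key 1 _)) (key 2 _)
  | add t t' ht ht' =>
    rw [map_add, map_add]
    exact add_mem ht ht'

/-- The sheaf `𝒪(n) ⊗ M` on the projectivized nullcone, associated to the graded module `A ⊗ M`
twisted by `n`. -/
noncomputable def Mtilde (n : ℤ) : (PNullcone k p).Modules :=
  ProjTwist.twist (coordGrading k p) (tensorGrading k p M) n

/-- The global operator `Θ_M : 𝒪 ⊗ M ⟶ 𝒪(1) ⊗ M`. -/
noncomputable def Theta : Mtilde k p M 0 ⟶ Mtilde k p M 1 :=
  ProjTwist.twistMap (thetaLin k p M) (thetaLin_mem k p M) (by simp)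

/-- The kernel sheaf of the global operator, pulled back to `ℙ¹`. -/
noncomputable def kerTheta [Fact p.Prime] : (P1 k).Modules :=
  (Scheme.Modules.pullback (iota k p)).obj (Limits.kernel (Theta k p M))

end Theta

/-- The line bundle `𝒪(n)` on `ℙ¹`. -/
noncomputable def O (k : Type u) [Field k] (n : ℤ) : (P1 k).Modules :=
  ProjTwist.twist (homogeneousSubmodule (Fin 2) k) (homogeneousSubmodule (Fin 2) k) n

section Rep

variable {k : Type u} [Field k] {M : Type u} [AddCommGroup M] [Module k M]

/-- The representation of `sl_2` given by three operators satisfying the relations of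
`e, f, h`. -/
def rep (E F H : Module.End k M) (hE : H * E - E * H = (2 : k) • E)
    (hF : H * F - F * H = -((2 : k) • F)) (hH : E * F - F * E = H) :
    sl2 k →ₗ⁅k⁆ Module.End k M where
  toFun X := X.1 0 1 • E + X.1 1 0 • F + X.1 0 0 • H
  map_add' X Y := by
    change (X.1 0 1 + Y.1 0 1) • E + (X.1 1 0 + Y.1 1 0) • F + (X.1 0 0 + Y.1 0 0) • H = _
    module
  map_smul' c X := by
    change (c * X.1 0 1) • E + (c * X.1 1 0) • F + (c * X.1 0 0) • H = _
    simp only [RingHom.id_apply]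
    module
  map_lie' := by
    intro X Y
    have tr (X : sl2 k) : X.1 1 1 = - X.1 0 0 := by
      have : Matrix.trace X.1 = 0 := LinearMap.mem_ker.1 X.2
      rw [Matrix.trace_fin_two] at this
      linear_combination this
    have h1 : H * E = E * H + (2 : k) • E := by rw [← hE]; abel
    have h2 : H * F = F * H - (2 : k) • F := by rw [sub_eq_add_neg, ← hF]; abel
    have h3 : E * F = F * E + H := by rw [← hH]; abel
    change (X.1 * Y.1 - Y.1 * X.1) 0 1 • E + (X.1 * Y.1 - Y.1 * X.1) 1 0 • F +
      (X.1 * Y.1 - Y.1 * X.1) 0 0 • H = _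
    simp only [Matrix.sub_apply, Matrix.mul_apply, Fin.sum_univ_two, tr, Ring.lie_def, add_mul,
      mul_add, smul_mul_smul_comm, h1, h2, h3]
    module

/-- The `sl_2`-module structure of a representation. -/
abbrev repLieRingModule (ρ : sl2 k →ₗ⁅k⁆ Module.End k M) : LieRingModule (sl2 k) M where
  bracket X m := ρ X m
  add_lie X Y m := by rw [map_add]; rfl
  lie_add X m n := map_add (ρ X) m n
  leibniz_lie X Y m := by
    rw [LieHom.map_lie, Ring.lie_def]
    exact (sub_add_cancel _ _).symm

lemma repLieModule (ρ : sl2 k →ₗ⁅k⁆ Module.End k M) :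
    @LieModule k (sl2 k) M _ _ _ _ _ (repLieRingModule ρ) :=
  letI := repLieRingModule ρ
  { smul_lie := fun c X m ↦ by
      change ρ (c • X) m = c • ρ X m
      rw [map_smul]; rfl
    lie_smul := fun c X m ↦ map_smul (ρ X) c m }

end Rep

section Weyl

variable (k : Type u) [Field k] (n : ℕ)

/-- The underlying space of the Weyl module `V(n)`, with basis `v_0, …, v_n`. -/
def Weyl : Type u := Fin (n + 1) → k

noncomputable instance : AddCommGroup (Weyl k n) := inferInstanceAs (AddCommGroup (Fin (n + 1) → k))
noncomputable instance : Module k (Weyl k n) := inferInstanceAs (Module k (Fin (n + 1) → k))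

namespace Weyl

/-- The basis vector `v_j`, with `v_j = 0` for `j` out of range. -/
def v (j : ℤ) : Weyl k n := fun i ↦ if (i : ℤ) = j then 1 else 0

/-- The linear map with given values on the basis vectors. -/
noncomputable def lift {N : Type u} [AddCommGroup N] [Module k N] (b : ℤ → N) : Weyl k n →ₗ[k] N :=
  Fintype.linearCombination k fun i : Fin (n + 1) ↦ b i

lemma lift_v {N : Type u} [AddCommGroup N] [Module k N] (b : ℤ → N) {j : ℤ} (h0 : 0 ≤ j)
    (hn : j ≤ n) : lift k n b (v k n j) = b j := by
  lift j to ℕ using h0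
  have h1 : v k n (j : ℤ) = Pi.single (⟨j, by omega⟩ : Fin (n + 1)) (1 : k) := by
    funext i
    simp [v, Pi.single_apply, Fin.ext_iff]
  rw [h1]
  exact (Fintype.linearCombination_apply_single k _ _ _).trans (one_smul _ _)

lemma v_eq_zero {j : ℤ} (hj : ¬ (0 ≤ j ∧ j ≤ n)) : v k n j = 0 :=
  funext fun i ↦ if_neg (by omega)

variable {k n} in
lemma ext_v {N : Type u} [AddCommGroup N] [Module k N] {A B : Weyl k n →ₗ[k] N}
    (hAB : ∀ j : ℕ, j ≤ n → A (v k n j) = B (v k n j)) : A = B := by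
  refine LinearMap.pi_ext' (φ := fun _ : Fin (n + 1) ↦ k) fun i ↦ LinearMap.ext_ring ?_
  have h1 : v k n (i : ℕ) = Pi.single i (1 : k) := by
    funext i'
    simp [v, Pi.single_apply, Fin.ext_iff]
  have := hAB i (by omega)
  rwa [h1] at this

/-- `e v_j = (n - j + 1) v_{j - 1}` -/
noncomputable def E : Module.End k (Weyl k n) :=
  lift k n fun j ↦ ((n - j + 1 : ℤ) : k) • v k n (j - 1)

/-- `f v_j = (j + 1) v_{j + 1}` -/
noncomputable def F : Module.End k (Weyl k n) :=
  lift k n fun j ↦ ((j + 1 : ℤ) : k) • v k n (j + 1)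

/-- `h v_j = (n - 2 j) v_j` -/
noncomputable def H : Module.End k (Weyl k n) :=
  lift k n fun j ↦ ((n - 2 * j : ℤ) : k) • v k n j

lemma E_v (j : ℤ) : E k n (v k n j) = ((n - j + 1 : ℤ) : k) • v k n (j - 1) := by
  by_cases hj : 0 ≤ j ∧ j ≤ n
  · exact lift_v k n _ hj.1 hj.2
  rw [v_eq_zero k n hj, map_zero]
  by_cases hj' : j = n + 1
  · simp [hj']
  · rw [v_eq_zero k n (j := j - 1) (by omega), smul_zero]

lemma F_v (j : ℤ) : F k n (v k n j) = ((j + 1 : ℤ) : k) • v k n (j + 1) := by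
  by_cases hj : 0 ≤ j ∧ j ≤ n
  · exact lift_v k n _ hj.1 hj.2
  rw [v_eq_zero k n hj, map_zero]
  by_cases hj' : j = -1
  · simp [hj']
  · rw [v_eq_zero k n (j := j + 1) (by omega), smul_zero]

lemma H_v (j : ℤ) : H k n (v k n j) = ((n - 2 * j : ℤ) : k) • v k n j := by
  by_cases hj : 0 ≤ j ∧ j ≤ n
  · exact lift_v k n _ hj.1 hj.2
  rw [v_eq_zero k n hj, map_zero, smul_zero]

/-- The representation of `sl_2` on the Weyl module. -/
noncomputable def rep : sl2 k →ₗ⁅k⁆ Module.End k (Weyl k n) :=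
  SlTwo.rep (E k n) (F k n) (H k n)
    (ext_v fun j _ ↦ by
      simp only [LinearMap.sub_apply, Module.End.mul_apply, E_v, H_v, map_smul,
        LinearMap.smul_apply]
      push_cast; module)
    (ext_v fun j _ ↦ by
      simp only [LinearMap.sub_apply, Module.End.mul_apply, F_v, H_v, map_smul,
        LinearMap.smul_apply, LinearMap.neg_apply]
      push_cast; module)
    (ext_v fun j _ ↦ by
      simp only [LinearMap.sub_apply, Module.End.mul_apply, E_v, F_v, H_v, map_smul,
        add_sub_cancel_right, sub_add_cancel]
      push_cast; module)

noncomputable instance : LieRingModule (sl2 k) (Weyl k n) := repLieRingModule (rep k n)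
instance : LieModule k (sl2 k) (Weyl k n) := repLieModule (rep k n)

end Weyl

/-- The dual of the Weyl module, with `(X φ)(v) = - φ (X v)`. -/
abbrev DualWeyl : Type u := Module.Dual k (Weyl k n)

end Weyl

section ProjCover

variable (k : Type u) [Field k] (p a : ℕ)

/-- The underlying space of `Q(a)`, `0 ≤ a < p - 1`, with basis `v_0, …, v_{2p-a-2}` and
`w_{p-a-1}, …, w_{p-1}`. -/
def ProjCover (_ha : a + 1 < p) : Type u := (Fin (2 * p - a - 1) → k) × (Fin (a + 1) → k)

variable (ha : a + 1 < p)

noncomputable instance : AddCommGroup (ProjCover k p a ha) :=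
  inferInstanceAs (AddCommGroup ((Fin (2 * p - a - 1) → k) × (Fin (a + 1) → k)))
noncomputable instance : Module k (ProjCover k p a ha) :=
  inferInstanceAs (Module k ((Fin (2 * p - a - 1) → k) × (Fin (a + 1) → k)))

namespace ProjCover

/-- The basis vector `v_j`, with `v_j = 0` for `j` out of range. -/
def v (j : ℤ) : ProjCover k p a ha := (fun i ↦ if (i : ℤ) = j then 1 else 0, 0)

/-- The basis vector `w_j`, with `w_j = 0` for `j` out of range. -/
def w (j : ℤ) : ProjCover k p a ha :=
  (0, fun i ↦ if ((p - a - 1 + i : ℕ) : ℤ) = j then 1 else 0)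

/-- The linear map with given values on the basis vectors. -/
noncomputable def lift {N : Type u} [AddCommGroup N] [Module k N] (b c : ℤ → N) :
    ProjCover k p a ha →ₗ[k] N :=
  LinearMap.coprod (Fintype.linearCombination k fun i : Fin (2 * p - a - 1) ↦ b i)
    (Fintype.linearCombination k fun i : Fin (a + 1) ↦ c (p - a - 1 + i : ℕ))

variable {N : Type u} [AddCommGroup N] [Module k N]

lemma v_natCast {j : ℕ} (hj : j < 2 * p - a - 1) :
    v k p a ha j = (Pi.single (⟨j, hj⟩ : Fin (2 * p - a - 1)) (1 : k), 0) := by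
  refine Prod.ext (funext fun i ↦ ?_) rfl
  simp [v, Pi.single_apply, Fin.ext_iff]

lemma w_natCast {j : ℕ} (hj : j < a + 1) :
    w k p a ha (p - a - 1 + j : ℕ) = (0, Pi.single (⟨j, hj⟩ : Fin (a + 1)) (1 : k)) := by
  refine Prod.ext rfl (funext fun i ↦ ?_)
  simp only [w, Pi.single_apply, Fin.ext_iff]
  exact if_congr (by omega) rfl rfl

lemma lift_v (b c : ℤ → N) {j : ℤ} (h0 : 0 ≤ j) (hn : j ≤ 2 * p - a - 2) :
    lift k p a ha b c (v k p a ha j) = b j := by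
  lift j to ℕ using h0
  rw [v_natCast k p a ha (by omega)]
  refine (LinearMap.coprod_apply _ _ _).trans ?_
  rw [map_zero, add_zero]
  exact (Fintype.linearCombination_apply_single k _ _ _).trans (one_smul _ _)

lemma lift_w (b c : ℤ → N) {j : ℤ} (h0 : p - a - 1 ≤ j) (hn : j ≤ p - 1) :
    lift k p a ha b c (w k p a ha j) = c j := by
  obtain ⟨i, rfl, hi⟩ : ∃ i : ℕ, j = (p - a - 1 + i : ℕ) ∧ i < a + 1 :=
    ⟨(j - (p - a - 1)).toNat, by omega, by omega⟩
  rw [w_natCast k p a ha hi]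
  refine (LinearMap.coprod_apply _ _ _).trans ?_
  rw [map_zero, zero_add]
  exact (Fintype.linearCombination_apply_single k _ _ _).trans (one_smul _ _)

lemma v_eq_zero {j : ℤ} (hj : ¬ (0 ≤ j ∧ j ≤ 2 * p - a - 2)) : v k p a ha j = 0 :=
  Prod.ext (funext fun i ↦ if_neg (by omega)) rfl

lemma w_eq_zero {j : ℤ} (hj : ¬ (p - a - 1 ≤ j ∧ j ≤ p - 1)) : w k p a ha j = 0 :=
  Prod.ext rfl (funext fun i ↦ if_neg (by omega))

variable {k p a ha} in
lemma ext_vw {A B : ProjCover k p a ha →ₗ[k] N}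
    (h1 : ∀ j : ℤ, 0 ≤ j → j ≤ 2 * p - a - 2 → A (v k p a ha j) = B (v k p a ha j))
    (h2 : ∀ j : ℤ, p - a - 1 ≤ j → j ≤ p - 1 → A (w k p a ha j) = B (w k p a ha j)) :
    A = B := by
  refine LinearMap.prod_ext (M := Fin (2 * p - a - 1) → k) (M₂ := Fin (a + 1) → k)
    (LinearMap.pi_ext' (φ := fun _ : Fin (2 * p - a - 1) ↦ k) fun i ↦ LinearMap.ext_ring ?_)
    (LinearMap.pi_ext' (φ := fun _ : Fin (a + 1) ↦ k) fun i ↦ LinearMap.ext_ring ?_)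
  · have := h1 (i : ℕ) (by omega) (by omega)
    rwa [v_natCast k p a ha i.2] at this
  · have := h2 (p - a - 1 + i : ℕ) (by omega) (by omega)
    rwa [w_natCast k p a ha i.2] at this

/-- `e v_j = -(a + j + 1) v_{j - 1}` and `e w_j = -(a + j + 1) w_{j - 1} + j⁻¹ v_{j - 1}` -/
noncomputable def E : Module.End k (ProjCover k p a ha) :=
  lift k p a ha (fun j ↦ (-(a + j + 1) : k) • v k p a ha (j - 1))
    fun j ↦ (-(a + j + 1) : k) • w k p a ha (j - 1) + (j : k)⁻¹ • v k p a ha (j - 1)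

/-- `f v_j = (j + 1) v_{j + 1}` and `f w_j = (j + 1) w_{j + 1}`, except that
`f w_{p-1} = -(a + 1)⁻¹ v_p` -/
noncomputable def F : Module.End k (ProjCover k p a ha) :=
  lift k p a ha (fun j ↦ (j + 1 : k) • v k p a ha (j + 1))
    fun j ↦ if j = p - 1 then -((a + 1 : k)⁻¹ • v k p a ha p) else (j + 1 : k) • w k p a ha (j + 1)

/-- `h v_j = -(a + 2j + 2) v_j` and `h w_j = -(a + 2j + 2) w_j` -/
noncomputable def H : Module.End k (ProjCover k p a ha) :=
  lift k p a ha (fun j ↦ (-(a + 2 * j + 2) : k) • v k p a ha j)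
    fun j ↦ (-(a + 2 * j + 2) : k) • w k p a ha j

lemma H_v (j : ℤ) : H k p a ha (v k p a ha j) = (-(a + 2 * j + 2) : k) • v k p a ha j := by
  by_cases hj : 0 ≤ j ∧ j ≤ 2 * p - a - 2
  · exact lift_v k p a ha _ _ hj.1 hj.2
  rw [v_eq_zero k p a ha hj, map_zero, smul_zero]

lemma H_w (j : ℤ) : H k p a ha (w k p a ha j) = (-(a + 2 * j + 2) : k) • w k p a ha j := by
  by_cases hj : p - a - 1 ≤ j ∧ j ≤ p - 1
  · exact lift_w k p a ha _ _ hj.1 hj.2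
  rw [w_eq_zero k p a ha hj, map_zero, smul_zero]

lemma E_w {j : ℤ} (h0 : p - a - 1 ≤ j) (hn : j ≤ p - 1) : E k p a ha (w k p a ha j) =
    (-(a + j + 1) : k) • w k p a ha (j - 1) + (j : k)⁻¹ • v k p a ha (j - 1) :=
  lift_w k p a ha _ _ h0 hn

lemma F_w {j : ℤ} (h0 : p - a - 1 ≤ j) (hn : j < p - 1) : F k p a ha (w k p a ha j) =
    (j + 1 : k) • w k p a ha (j + 1) :=
  (lift_w k p a ha _ _ h0 hn.le).trans (if_neg hn.ne)

lemma F_w_last : F k p a ha (w k p a ha (p - 1)) = -((a + 1 : k)⁻¹ • v k p a ha p) :=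
  (lift_w k p a ha _ _ (by omega) le_rfl).trans (if_pos rfl)

lemma F_v (j : ℤ) (hj : j ≤ 2 * p - a - 2) :
    F k p a ha (v k p a ha j) = (j + 1 : k) • v k p a ha (j + 1) := by
  by_cases hj' : 0 ≤ j
  · exact lift_v k p a ha _ _ hj' hj
  rw [v_eq_zero k p a ha (by omega), map_zero]
  by_cases hj' : j = -1
  · simp [hj']
  · rw [v_eq_zero k p a ha (j := j + 1) (by omega), smul_zero]

variable [CharP k p]

lemma E_v (j : ℤ) (hj : j ≤ 2 * p - a - 1) :
    E k p a ha (v k p a ha j) = (-(a + j + 1) : k) • v k p a ha (j - 1) := by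
  by_cases hj' : 0 ≤ j ∧ j ≤ 2 * p - a - 2
  · exact lift_v k p a ha _ _ hj'.1 hj'.2
  rw [v_eq_zero k p a ha hj', map_zero]
  by_cases hj'' : j = 2 * p - a - 1
  · simp [hj'']
  · rw [v_eq_zero k p a ha (j := j - 1) (by omega), smul_zero]

/-- `f e w_j` -/
lemma F_E_w {j : ℤ} (hj : (j : k) ≠ 0) (h0 : p - a - 1 ≤ j) (hn : j ≤ p - 1) :
    F k p a ha (E k p a ha (w k p a ha j)) =
      (-(a + j + 1) * j : k) • w k p a ha j + v k p a ha j := by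
  rw [E_w k p a ha h0 hn, map_add, map_smul, map_smul, F_v k p a ha _ (by omega)]
  push_cast
  rw [sub_add_cancel, sub_add_cancel, smul_smul, inv_mul_cancel₀ hj, one_smul]
  congr 1
  by_cases h : j = p - a - 1
  · simp [h]
  · rw [F_w k p a ha (by omega) (by omega)]
    push_cast
    rw [sub_add_cancel, sub_add_cancel, smul_smul]

variable [Fact p.Prime]

lemma cast_ne_zero {j : ℤ} (h0 : 0 < j) (hn : j < p) : (j : k) ≠ 0 := by
  rw [Ne, CharP.intCast_eq_zero_iff k p]
  exact fun hd ↦ by have := Int.le_of_dvd h0 hd; omega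

/-- The representation of `sl_2` on `Q(a)`. -/
noncomputable def rep : sl2 k →ₗ⁅k⁆ Module.End k (ProjCover k p a ha) :=
  SlTwo.rep (E k p a ha) (F k p a ha) (H k p a ha)
    (by
      refine ext_vw (fun j h0 hn ↦ ?_) fun j h0 hn ↦ ?_
      · simp only [LinearMap.sub_apply, Module.End.mul_apply, E_v k p a ha j (by omega), H_v,
          map_smul, LinearMap.smul_apply]
        push_cast; module
      · simp only [LinearMap.sub_apply, Module.End.mul_apply, E_w k p a ha h0 hn, H_v, H_w,
          map_add, map_smul, LinearMap.smul_apply]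
        push_cast; module)
    (by
      refine ext_vw (fun j h0 hn ↦ ?_) fun j h0 hn ↦ ?_
      · simp only [LinearMap.sub_apply, Module.End.mul_apply, F_v k p a ha j hn, H_v,
          map_smul, LinearMap.smul_apply, LinearMap.neg_apply]
        push_cast; module
      · rcases hn.lt_or_eq with hn | rfl
        · simp only [LinearMap.sub_apply, Module.End.mul_apply, F_w k p a ha h0 hn, H_w,
            map_smul, LinearMap.smul_apply, LinearMap.neg_apply]
          push_cast; module
        · simp only [LinearMap.sub_apply, Module.End.mul_apply, F_w_last, H_w, H_v,
            map_smul, map_neg, LinearMap.smul_apply, LinearMap.neg_apply]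
          push_cast; module)
    (by
      refine ext_vw (fun j h0 hn ↦ ?_) fun j h0 hn ↦ ?_
      · simp only [LinearMap.sub_apply, Module.End.mul_apply, F_v k p a ha j hn,
          E_v k p a ha j (by omega), E_v k p a ha (j + 1) (by omega),
          F_v k p a ha (j - 1) (by omega), H_v, map_smul, add_sub_cancel_right, sub_add_cancel]
        push_cast; module
      · rw [LinearMap.sub_apply, Module.End.mul_apply, Module.End.mul_apply,
          F_E_w k p a ha (cast_ne_zero k p (by omega) (by omega)) h0 hn, H_w]
        rcases hn.lt_or_eq with hn | rfl
        · have h1 : ((j + 1 : ℤ) : k) ≠ 0 := cast_ne_zero k p (by omega) (by omega)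
          rw [F_w k p a ha h0 hn, map_smul, E_w k p a ha (by omega) (by omega), smul_add,
            smul_smul, smul_smul, add_sub_cancel_right]
          push_cast at h1 ⊢
          rw [mul_inv_cancel₀ h1]
          module
        · have h1 : ((a + 1 : ℤ) : k) ≠ 0 := cast_ne_zero k p (by omega) (by omega)
          push_cast at h1
          rw [F_w_last, map_neg, map_smul, E_v k p a ha _ (by omega), smul_smul]
          have h2 : ((a : k) + 1)⁻¹ * (-(a + (p : ℤ) + 1)) = -1 := by
            simp only [Int.cast_natCast, CharP.cast_eq_zero, add_zero, mul_neg,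
              inv_mul_cancel₀ h1]
          rw [h2]
          push_cast
          rw [CharP.cast_eq_zero k p]
          module)

noncomputable instance : LieRingModule (sl2 k) (ProjCover k p a ha) :=
  repLieRingModule (rep k p a ha)
instance : LieModule k (sl2 k) (ProjCover k p a ha) := repLieModule (rep k p a ha)

end ProjCover

end ProjCover

section Phi

variable (k : Type u) [Field k] (n : ℕ)

namespace Weyl

/-- The pairing of `V(n)` with polynomials in one variable `Y` for which `v_0, …, v_n` is dual to
`1, Y, …, Y ^ n`; here `Y ^ i` stands for the form `x ^ (n - i) * y ^ i` of degree `n`. -/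
noncomputable def pairing (u : Weyl k n) : Polynomial k →ₗ[k] k :=
  ∑ i : Fin (n + 1), u i • Polynomial.lcoeff k i

/-- The form `(a x + b y) ^ (n - j) * (c x + d y) ^ j` for `g = !![a, b; c, d]`, at `x = 1`,
`y = Y`. -/
noncomputable def form (g : Matrix (Fin 2) (Fin 2) k) (j : ℕ) : Polynomial k :=
  (Polynomial.C (g 0 0) + Polynomial.C (g 0 1) * Polynomial.X) ^ (n - j) *
    (Polynomial.C (g 1 0) + Polynomial.C (g 1 1) * Polynomial.X) ^ j

/-- The action of `g ∈ SL_2` on `V(n)`, the dual of the space of forms of degree `n` in the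
coordinates `x, y` of the standard representation: the coefficient of `v_j` in `g v_i` is the
coefficient of `x ^ (n - i) * y ^ i` in `(a x + b y) ^ (n - j) * (c x + d y) ^ j`. -/
noncomputable def slAct (g : Matrix.SpecialLinearGroup (Fin 2) k) : Module.End k (Weyl k n) where
  toFun u := fun j ↦ pairing k n u (form k n g j)
  map_add' u u' := funext fun j ↦ by
    simp only [pairing]
    change (∑ i : Fin (n + 1), (u i + u' i) • Polynomial.lcoeff k i) _ = _ + _
    simp only [add_smul, Finset.sum_add_distrib, LinearMap.add_apply]
  map_smul' c u := funext fun j ↦ by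
    simp only [pairing]
    change (∑ i : Fin (n + 1), (c * u i) • Polynomial.lcoeff k i) _ = c * _
    simp only [mul_smul, ← Finset.smul_sum, LinearMap.smul_apply, smul_eq_mul]

lemma pairing_add (u u' : Weyl k n) : pairing k n (u + u') = pairing k n u + pairing k n u' := by
  simp only [pairing]
  change (∑ i : Fin (n + 1), (u i + u' i) • Polynomial.lcoeff k i) = _
  simp only [add_smul, Finset.sum_add_distrib]

lemma pairing_smul (c : k) (u : Weyl k n) : pairing k n (c • u) = c • pairing k n u := by
  simp only [pairing]
  change (∑ i : Fin (n + 1), (c * u i) • Polynomial.lcoeff k i) = _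
  simp only [mul_smul, ← Finset.smul_sum]

/-- The pairing with a fixed polynomial. -/
noncomputable def pairingR (P : Polynomial k) : Weyl k n →ₗ[k] k where
  toFun u := pairing k n u P
  map_add' u u' := by rw [pairing_add]; rfl
  map_smul' c u := by rw [pairing_smul]; rfl

lemma pairing_X_pow (u : Weyl k n) (j : Fin (n + 1)) :
    pairing k n u (Polynomial.X ^ (j : ℕ)) = u j := by
  simp only [pairing, LinearMap.sum_apply, LinearMap.smul_apply, Polynomial.lcoeff_apply,
    Polynomial.coeff_X_pow, Fin.val_inj, smul_eq_mul, mul_ite, mul_one, mul_zero]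
  exact (Finset.sum_ite_eq' Finset.univ j fun x ↦ u x).trans (if_pos (Finset.mem_univ j))

lemma pairing_v (i : ℕ) (hi : i ≤ n) (P : Polynomial k) :
    pairing k n (v k n i) P = P.coeff i := by
  simp only [pairing, v, LinearMap.sum_apply, LinearMap.smul_apply, Polynomial.lcoeff_apply,
    smul_eq_mul, Nat.cast_inj, ite_mul, one_mul, zero_mul]
  rw [Finset.sum_eq_single ⟨i, by omega⟩]
  · simp
  · intro b _ hb
    exact if_neg fun h ↦ hb (Fin.ext h)
  · simp

lemma pairing_E (u : Weyl k n) (P : Polynomial k) : pairing k n (E k n u) P =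
    pairing k n u (n • (Polynomial.X * P) - Polynomial.X ^ 2 * P.derivative) := by
  suffices pairingR k n P ∘ₗ E k n =
      pairingR k n (n • (Polynomial.X * P) - Polynomial.X ^ 2 * P.derivative) from
    LinearMap.congr_fun this u
  refine ext_v fun i hi ↦ ?_
  change pairing k n (E k n (v k n i)) P = pairing k n (v k n i) _
  rw [E_v, pairing_smul, pairing_v k n i hi]
  rcases i with _ | _ | i
  · rw [v_eq_zero k n (by simp)]
    simp [pairing]
    exact Or.inr (Finset.sum_eq_zero fun x _ ↦ zero_mul _)
  · simp only [zero_add, Nat.cast_one, sub_self]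
    rw [LinearMap.smul_apply, ← Nat.cast_zero, pairing_v k n 0 (by omega)]
    simp [Polynomial.coeff_X_pow_mul']
  · rw [LinearMap.smul_apply, show ((i + 1 + 1 : ℕ) : ℤ) - 1 = (i + 1 : ℕ) by push_cast; ring,
      pairing_v k n (i + 1) (by omega)]
    simp [Polynomial.coeff_X_pow_mul', Polynomial.coeff_derivative]
    ring

lemma pairing_F (u : Weyl k n) (P : Polynomial k) (hP : P.natDegree ≤ n) :
    pairing k n (F k n u) P = pairing k n u P.derivative := by
  suffices pairingR k n P ∘ₗ F k n = pairingR k n P.derivative from LinearMap.congr_fun this u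
  refine ext_v fun i hi ↦ ?_
  change pairing k n (F k n (v k n i)) P = pairing k n (v k n i) _
  rw [F_v, pairing_smul, pairing_v k n i hi, LinearMap.smul_apply, Polynomial.coeff_derivative]
  rcases hi.lt_or_eq with hi | rfl
  · rw [← Nat.cast_one, ← Nat.cast_add, pairing_v k n (i + 1) (by omega)]
    simp [mul_comm]
  · rw [v_eq_zero k i (by simp), Polynomial.coeff_eq_zero_of_natDegree_lt (by omega)]
    simp [pairing]
    exact Or.inr (Finset.sum_eq_zero fun x _ ↦ zero_mul _)

lemma pairing_H (u : Weyl k n) (P : Polynomial k) : pairing k n (H k n u) P =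
    pairing k n u (n • P - 2 * Polynomial.X * P.derivative) := by
  suffices pairingR k n P ∘ₗ H k n =
      pairingR k n (n • P - 2 * Polynomial.X * P.derivative) from LinearMap.congr_fun this u
  refine ext_v fun i hi ↦ ?_
  change pairing k n (H k n (v k n i)) P = pairing k n (v k n i) _
  rw [H_v, pairing_smul, pairing_v k n i hi, LinearMap.smul_apply, pairing_v k n i hi, mul_assoc,
    ← Polynomial.C_ofNat]
  rcases i with _ | i
  · simp
  · simp [Polynomial.coeff_derivative]
    ring

lemma pairing_slAct (g : Matrix.SpecialLinearGroup (Fin 2) k) (u : Weyl k n) (j : ℕ)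
    (hj : j ≤ n) : pairing k n (slAct k n g u) (Polynomial.X ^ j) =
      pairing k n u (form k n g j) :=
  pairing_X_pow k n (slAct k n g u) ⟨j, by omega⟩

lemma natDegree_form_le (g : Matrix (Fin 2) (Fin 2) k) (j : ℕ) (hj : j ≤ n) :
    (form k n g j).natDegree ≤ n := by
  have key (a b : k) (m : ℕ) :
      ((Polynomial.C a + Polynomial.C b * Polynomial.X) ^ m).natDegree ≤ m := by
    refine Polynomial.natDegree_pow_le.trans ?_
    have : (Polynomial.C a + Polynomial.C b * Polynomial.X).natDegree ≤ 1 := by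
      rw [add_comm]
      exact Polynomial.natDegree_linear_le
    nlinarith
  refine Polynomial.natDegree_mul_le.trans ?_
  have h1 := key (g 0 0) (g 0 1) (n - j)
  have h2 := key (g 1 0) (g 1 1) j
  omega

lemma ext_pairing {u u' : Weyl k n} (hu : ∀ j : ℕ, j ≤ n →
    pairing k n u (Polynomial.X ^ j) = pairing k n u' (Polynomial.X ^ j)) : u = u' :=
  funext fun j ↦ by
    rw [← pairing_X_pow k n u j, ← pairing_X_pow k n u' j]
    exact hu j (by omega)

/-- The derivation of forms dual to the action of `α e + β f + γ h`. -/
noncomputable def der (α β γ : k) (P : Polynomial k) : Polynomial k :=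
  Polynomial.C α * ((n : Polynomial k) * (Polynomial.X * P) - Polynomial.X ^ 2 * P.derivative) +
    Polynomial.C β * P.derivative +
    Polynomial.C γ * ((n : Polynomial k) * P - 2 * Polynomial.X * P.derivative)

lemma pairing_der (u : Weyl k n) (α β γ : k) (P : Polynomial k) (hP : P.natDegree ≤ n) :
    pairing k n (α • E k n u + β • F k n u + γ • H k n u) P =
      pairing k n u (der k n α β γ P) := by
  rw [der, map_add, map_add, ← Polynomial.smul_eq_C_mul, ← Polynomial.smul_eq_C_mul,
    ← Polynomial.smul_eq_C_mul, map_smul, map_smul, map_smul, ← nsmul_eq_mul, ← nsmul_eq_mul,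
    ← pairing_E, ← pairing_F k n u P hP, ← pairing_H, pairing_add, pairing_add, pairing_smul,
    pairing_smul, pairing_smul]
  rfl

lemma derivative_form (M : Matrix (Fin 2) (Fin 2) k) (m j : ℕ) :
    Polynomial.derivative (form k (m + j) M j) =
      (m : Polynomial k) * Polynomial.C (M 0 1) * ((Polynomial.C (M 0 0) + Polynomial.C (M 0 1) * Polynomial.X) ^
        (m - 1) * (Polynomial.C (M 1 0) + Polynomial.C (M 1 1) * Polynomial.X) ^ j) +
      (j : Polynomial k) * Polynomial.C (M 1 1) * ((Polynomial.C (M 0 0) + Polynomial.C (M 0 1) * Polynomial.X) ^ m *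
        (Polynomial.C (M 1 0) + Polynomial.C (M 1 1) * Polynomial.X) ^ (j - 1)) := by
  simp only [form, Nat.add_sub_cancel, Polynomial.derivative_mul, Polynomial.derivative_pow,
    Polynomial.derivative_add, Polynomial.derivative_C, Polynomial.derivative_X, map_natCast]
  ring

variable (g : Matrix.SpecialLinearGroup (Fin 2) k)

lemma C_det : (Polynomial.C (g 0 0) * Polynomial.C (g 1 1) -
    Polynomial.C (g 0 1) * Polynomial.C (g 1 0) : Polynomial k) = 1 := by
  rw [← Polynomial.C_mul, ← Polynomial.C_mul, ← Polynomial.C_sub, ← Matrix.det_fin_two, g.2,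
    Polynomial.C_1]

lemma der_form (α β γ : k) {α' β' γ' : k} (m j : ℕ)
    (hα : α' = g 1 1 ^ 2 * α - g 0 1 ^ 2 * β + 2 * g 0 1 * g 1 1 * γ)
    (hβ : β' = -(g 1 0 ^ 2 * α) + g 0 0 ^ 2 * β - 2 * g 0 0 * g 1 0 * γ)
    (hγ : γ' = g 1 0 * g 1 1 * α - g 0 0 * g 0 1 * β + (g 0 0 * g 1 1 + g 0 1 * g 1 0) * γ) :
    der k (m + j) α' β' γ' (form k (m + j) g j) =
      Polynomial.C (α * m) * form k (m + j) g (j + 1) +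
      Polynomial.C (β * j) * form k (m + j) g (j - 1) +
      Polynomial.C (γ * (m - j)) * form k (m + j) g j := by
  have hd := C_det k g
  subst hα hβ hγ
  rw [der, derivative_form]
  have e1 : m + j - (j + 1) = m - 1 := by omega
  simp only [form, Nat.add_sub_cancel, e1, map_add, map_sub, map_mul, map_neg, map_pow,
    map_natCast, Polynomial.C_ofNat, Nat.cast_add]
  generalize Polynomial.C (g 0 0) = a at *
  generalize Polynomial.C (g 0 1) = b at *
  generalize Polynomial.C (g 1 0) = c at *
  generalize Polynomial.C (g 1 1) = d at *
  rcases m with _ | m <;> rcases j with _ | j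
  · simp
  · have e2 : 0 + (j + 1) - j = 1 := by omega
    simp only [Nat.add_sub_cancel, e2, Nat.cast_zero, Nat.cast_add, Nat.cast_one]
    linear_combination ((j + 1 : Polynomial k) * (c + d * Polynomial.X) ^ j *
      (Polynomial.C β * (a + b * Polynomial.X) - Polynomial.C γ * (c + d * Polynomial.X))) * hd
  · simp only [Nat.add_sub_cancel, Nat.cast_zero, Nat.cast_add, Nat.cast_one]
    linear_combination ((m + 1 : Polynomial k) * (a + b * Polynomial.X) ^ m *
      (Polynomial.C α * (c + d * Polynomial.X) + Polynomial.C γ * (a + b * Polynomial.X))) * hd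
  · have e2 : m + 1 + (j + 1) - j = m + 2 := by omega
    simp only [Nat.add_sub_cancel, e2, Nat.cast_add, Nat.cast_one]
    linear_combination ((m + 1 : Polynomial k) * (a + b * Polynomial.X) ^ m *
      (c + d * Polynomial.X) ^ (j + 1) *
      (Polynomial.C α * (c + d * Polynomial.X) + Polynomial.C γ * (a + b * Polynomial.X)) +
      (j + 1 : Polynomial k) * (a + b * Polynomial.X) ^ (m + 1) * (c + d * Polynomial.X) ^ j *
      (Polynomial.C β * (a + b * Polynomial.X) - Polynomial.C γ * (c + d * Polynomial.X))) * hd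

/-- The action of `SL_2` intertwines `X` with its conjugate `g⁻¹ X g`. -/
lemma slAct_conj (u : Weyl k n) (α β γ : k) :
    α • E k n (slAct k n g u) + β • F k n (slAct k n g u) + γ • H k n (slAct k n g u) =
    slAct k n g
      ((g 1 1 ^ 2 * α - g 0 1 ^ 2 * β + 2 * g 0 1 * g 1 1 * γ) • E k n u +
        (-(g 1 0 ^ 2 * α) + g 0 0 ^ 2 * β - 2 * g 0 0 * g 1 0 * γ) • F k n u +
        (g 1 0 * g 1 1 * α - g 0 0 * g 0 1 * β + (g 0 0 * g 1 1 + g 0 1 * g 1 0) * γ) •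
          H k n u) := by
  refine ext_pairing k n fun j hj ↦ ?_
  rw [pairing_slAct k n g _ j hj, pairing_der k n _ _ _ _ _ (natDegree_form_le k n g j hj),
    pairing_der k n _ _ _ _ _ ((Polynomial.natDegree_X_pow_le j).trans hj)]
  obtain ⟨m, rfl⟩ := Nat.exists_eq_add_of_le' hj
  rw [der_form k g α β γ m j rfl rfl rfl]
  have h1 : der k (m + j) α β γ (Polynomial.X ^ j) =
      Polynomial.C (α * m) * Polynomial.X ^ (j + 1) +
      Polynomial.C (β * j) * Polynomial.X ^ (j - 1) +
      Polynomial.C (γ * (m - j)) * Polynomial.X ^ j := by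
    rcases j with _ | j
    · simp [der]; ring
    · simp [der]; ring
  rw [h1]
  simp only [map_add, ← Polynomial.smul_eq_C_mul, map_smul]
  rw [pairing_slAct k _ g u j (by omega), pairing_slAct k _ g u (j - 1) (by omega)]
  rcases m with _ | m
  · simp
  · rw [pairing_slAct k _ g u (j + 1) (by omega)]

end Weyl

/-- The map `φ : ℙ¹ → SL_2` given by `[1 : ε] ↦ !![0, 1; -1, -ε]` and `[0 : 1] ↦ 1`. -/
noncomputable def phi (ξ : Projectivization k (Fin 2 → k)) : Matrix.SpecialLinearGroup (Fin 2) k :=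
  open scoped Classical in
  if ξ.rep 0 = 0 then 1
  else ⟨!![0, 1; -1, -(ξ.rep 1 / ξ.rep 0)], by rw [Matrix.det_fin_two_of]; ring⟩

variable (p : ℕ)

/-- The subspace of `V(n)` spanned by `v_{a+1}, …, v_n`, where `a` is the remainder of `n`
modulo `p`. -/
noncomputable def phiSpan : Submodule k (Weyl k n) :=
  Submodule.span k {u | ∃ j : ℕ, n % p + 1 ≤ j ∧ j ≤ n ∧ u = Weyl.v k n j}

variable [CharP k p]

lemma phiSpan_stable (u : Weyl k n) (hu : u ∈ phiSpan k n p) : Weyl.E k n u ∈ phiSpan k n p ∧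
    Weyl.F k n u ∈ phiSpan k n p ∧ Weyl.H k n u ∈ phiSpan k n p := by
  have key {j : ℤ} (hj : (n % p : ℕ) + 1 ≤ j) : Weyl.v k n j ∈ phiSpan k n p := by
    lift j to ℕ using by omega
    by_cases hn : j ≤ n
    · exact Submodule.subset_span ⟨j, by omega, hn, rfl⟩
    · rw [Weyl.v_eq_zero k n (by omega)]
      exact zero_mem _
  induction hu using Submodule.span_induction with
  | mem u hu =>
    obtain ⟨j, h1, h2, rfl⟩ := hu
    refine ⟨?_, ?_, ?_⟩
    · rw [Weyl.E_v]
      rcases h1.eq_or_lt with h1 | h1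
      · have : ((n - j + 1 : ℤ) : k) = 0 := by
          rw [CharP.intCast_eq_zero_iff k p, ← h1]
          have := Nat.div_add_mod n p
          refine ⟨(n / p : ℕ), ?_⟩
          zify at this
          push_cast
          linarith
        rw [this, zero_smul]
        exact zero_mem _
      · exact Submodule.smul_mem _ _ (key (by omega))
    · rw [Weyl.F_v]
      exact Submodule.smul_mem _ _ (key (by omega))
    · rw [Weyl.H_v]
      exact Submodule.smul_mem _ _ (key (by omega))
  | zero => simp
  | add u u' _ _ hu hu' =>
    simp only [map_add]
    exact ⟨add_mem hu.1 hu'.1, add_mem hu.2.1 hu'.2.1, add_mem hu.2.2 hu'.2.2⟩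
  | smul c u _ hu =>
    simp only [map_smul]
    exact ⟨Submodule.smul_mem _ _ hu.1, Submodule.smul_mem _ _ hu.2.1,
      Submodule.smul_mem _ _ hu.2.2⟩

/-- The module `Φ_ξ(n) = φ(ξ) Φ(n)`, where `Φ(n)` is the submodule of `V(n)` spanned by
`v_{a+1}, …, v_n`, with `a` the remainder of `n` modulo `p`. -/
noncomputable def Phi (ξ : Projectivization k (Fin 2 → k)) : LieSubmodule k (sl2 k) (Weyl k n) where
  __ := (phiSpan k n p).map (Weyl.slAct k n (phi k ξ))
  lie_mem := by
    rintro X _ ⟨u, hu, rfl⟩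
    obtain ⟨h1, h2, h3⟩ := phiSpan_stable k n p u hu
    have h4 := Weyl.slAct_conj k n (phi k ξ) u (X.1 0 1) (X.1 1 0) (X.1 0 0)
    exact ⟨_, add_mem (add_mem (Submodule.smul_mem _ _ h1) (Submodule.smul_mem _ _ h2))
      (Submodule.smul_mem _ _ h3), h4.symm⟩

end Phi

end SlTwo

attribute [local instance] Abelian.hasFiniteBiproducts

open CategoryTheory.Limits SlTwo

/-!
The kernel bundles are computed by linear algebra over the polynomial ring `k[s, t]`.

Every point of the nullcone is of the form `(s ^ 2, -t ^ 2, s t)`, so its coordinate ring is the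
even Veronese subring of `k[s, t]` (`iotaRingHom_injective`, `exists_iotaRingHom_eq`). The morphism
of `Proj`s induced by the inclusion of a Veronese subring is an isomorphism (`ProjDeg.isIso_map`),
and the sheaf of the Veronese part of a graded module is the direct image of the sheaf of the
module itself (`ProjDeg.isIso_semiTwistMap`). Pulled back to the projective line, `Θ_M` therefore
becomes the morphism of free sheaves given by the matrix of `s ^ 2 e - t ^ 2 f + s t h`. If the
kernel of this matrix over `k[s, t]` is free on homogeneous vectors of degrees `d_i`, then its
kernel sheaf is the sum of the `𝒪(-d_i)` (`ProjTwist.nonempty_kernel_twistMap_iso`,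
`IsThetaMatrix.nonempty_kerTheta_iso`). What remains is to exhibit homogeneous bases of these
kernels.

In the Weyl module `V(n)`, `n = r p + a`, the coefficients of the image of `∑ u_j v_j` are
`(n - j) s g_j - j t g_{j-1}`, where `g_j = t u_j + s u_{j+1}`. In characteristic `p` this
recurrence for the `g_j` breaks up into blocks of `p` consecutive indices: `g_j` vanishes when
`j % p < a`, and the remaining entries of a complete block form, up to binomial coefficients, a
geometric sequence with ratio `-t / s`, hence are a multiple of one vector because `s` and `t` are
coprime (`exists_diff_of_weylForm`). If `r = 0` or `a + 1 < p`, each of these `r` vectors comes from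
a vector `weylBlock` of degree `p - 2 - a` supported in its block, and the vectors with `g = 0` are
the multiples of `weylVec`, of degree `n`.

The other modules are reduced to this computation. For `Φ_ξ(n)` the action of `φ(ξ)` replaces
`(s, t)` by another pair of coprime linear forms, and `weylVec` drops out since the coefficient of
`v_0` vanishes. For the dual of `V(n)` the recurrence is of first order, and its solutions are
supported on the first `a + 1` indices of each of the `r + 1` blocks (`exists_eq_of_dualForm`).
In `Q(a)` the `v_j` span `V(2 p - a - 2)`; an element of the kernel has no component along the `w_j`
(`ProjCover.comp_inr_eq_zero`), since the equations leave only a scalar multiple of one vector there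
and the equation at `v_{p-a-2}` makes this scalar vanish.
-/

/-! ### Kernels and biproducts of sheaves of modules, computed on sections -/

namespace ModulesAux

variable {X Y : Scheme.{u}}

lemma app_injective_of_mono {F G : X.Modules} (i : F ⟶ G) [Mono i] (U : X.Opens) :
    Function.Injective (i.app U) := by
  have h1 : Mono ((Scheme.Modules.toPresheaf X).map i) := inferInstance
  have h2 : Mono (((Scheme.Modules.toPresheaf X).map i).app (op U)) := inferInstance
  exact (AddCommGrpCat.mono_iff_injective _).1 h2

lemma isIso_of_bijective {F G : X.Modules} (i : F ⟶ G)
    (hi : ∀ U : X.Opens, Function.Bijective (i.app U)) : IsIso i := by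
  rw [Scheme.Modules.Hom.isIso_iff_isIso_app]
  intro U
  exact (ConcreteCategory.isIso_iff_bijective _).2 (hi U)

lemma app_eq_zero_of_comp {F G H : X.Modules} {i : F ⟶ G} {t : G ⟶ H} (w : i ≫ t = 0)
    (U : X.Opens) (x : Γ(F, U)) : t.app U (i.app U x) = 0 := by
  have : (i ≫ t).app U = (0 : F ⟶ H).app U := by rw [w]
  exact congr($this x)

/-- A morphism which is, on sections, an injection onto the kernel of `t`, is a kernel of `t`. -/
lemma isIso_kernel_lift {F G H : X.Modules} (i : F ⟶ G) (t : G ⟶ H) (w : i ≫ t = 0)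
    (hi : ∀ U : X.Opens, Function.Injective (i.app U))
    (hs : ∀ (U : X.Opens) (x : Γ(G, U)), t.app U x = 0 → ∃ y, i.app U y = x) :
    IsIso (kernel.lift t i w) := by
  have key (U : X.Opens) (y : Γ(F, U)) :
      (kernel.ι t).app U ((kernel.lift t i w).app U y) = i.app U y := by
    have : (kernel.lift t i w ≫ kernel.ι t).app U = i.app U := by rw [kernel.lift_ι]
    exact congr($this y)
  refine isIso_of_bijective _ fun U ↦ ⟨fun y y' h ↦ hi U ?_, fun z ↦ ?_⟩
  · rw [← key, ← key, h]
  · obtain ⟨y, hy⟩ := hs U _ (app_eq_zero_of_comp (kernel.condition t) U z)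
    exact ⟨y, app_injective_of_mono (kernel.ι t) U ((key U y).trans hy)⟩

/-- Pulling back along an isomorphism undoes the pushforward. -/
lemma nonempty_pullback_iso (f : X ⟶ Y) [IsIso f] {F : Y.Modules} {G : X.Modules}
    (α : F ≅ (Scheme.Modules.pushforward f).obj G) :
    Nonempty ((Scheme.Modules.pullback f).obj F ≅ G) :=
  ⟨(Scheme.Modules.pullback f).mapIso α ≪≫
    asIso ((Scheme.Modules.pullbackPushforwardAdjunction f).counit.app G)⟩

/-- Along an isomorphism, the pullback of a kernel may be computed from a description of the
morphism in terms of a morphism upstairs. -/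
lemma nonempty_pullback_kernel_iso (f : X ⟶ Y) [IsIso f] {F F' : Y.Modules} {G G' : X.Modules}
    {t : F ⟶ F'} {t' : G ⟶ G'} (α : F ≅ (Scheme.Modules.pushforward f).obj G)
    (α' : F' ≅ (Scheme.Modules.pushforward f).obj G')
    (h : t ≫ α'.hom = α.hom ≫ (Scheme.Modules.pushforward f).map t') :
    Nonempty ((Scheme.Modules.pullback f).obj (kernel t) ≅ kernel t') :=
  nonempty_pullback_iso f (kernel.mapIso _ _ α α' h ≪≫ (PreservesKernel.iso _ t').symm)

/-- Suppose that `L` is the biproduct of the `D j` by means of `ι` and `π`. If every section of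
`G` killed by `t` is uniquely a sum of images of sections of the `D j`, then the kernel of `t` is
isomorphic to `L`. -/
lemma nonempty_kernel_iso {J : Type} [Fintype J] {G H L : X.Modules} (t : G ⟶ H)
    (D : J → X.Modules) (ι : ∀ j, D j ⟶ L) (π : ∀ j, L ⟶ D j) (hL : ∑ j, π j ≫ ι j = 𝟙 L)
    (h1 : ∀ j, ι j ≫ π j = 𝟙 (D j)) (h0 : ∀ j j', j ≠ j' → ι j ≫ π j' = 0)
    (c : ∀ j, D j ⟶ G) (hc : ∀ j, c j ≫ t = 0)
    (hinj : ∀ (U : X.Opens) (x : ∀ j, Γ(D j, U)), ∑ j, (c j).app U (x j) = 0 → x = 0)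
    (hsurj : ∀ (U : X.Opens) (x : Γ(G, U)), t.app U x = 0 →
      ∃ y : ∀ j, Γ(D j, U), ∑ j, (c j).app U (y j) = x) :
    Nonempty (kernel t ≅ L) := by
  classical
  have hsum {F F' : X.Modules} (φ : J → (F ⟶ F')) (U : X.Opens) (x : Γ(F, U)) :
      (∑ j, φ j).app U x = ∑ j, (φ j).app U x := by
    let g : (F ⟶ F') →+ Γ(F', U) :=
      { toFun ψ := ψ.app U x
        map_zero' := rfl
        map_add' _ _ := rfl }
    exact map_sum g φ Finset.univ
  have happ (U : X.Opens) (x : Γ(L, U)) :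
      (∑ j, π j ≫ c j).app U x = ∑ j, (c j).app U ((π j).app U x) := hsum _ U x
  have w : (∑ j, π j ≫ c j) ≫ t = 0 := by
    rw [Preadditive.sum_comp]
    exact Finset.sum_eq_zero fun j _ ↦ by rw [Category.assoc, hc, comp_zero]
  have := isIso_kernel_lift (∑ j, π j ≫ c j) t w ?_ ?_
  · exact ⟨(asIso (kernel.lift t _ w)).symm⟩
  · intro U
    rw [injective_iff_map_eq_zero]
    intro x hx
    rw [happ] at hx
    have h2 := hinj U _ hx
    have h3 : x = (∑ j, π j ≫ ι j).app U x := by rw [hL]; rfl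
    rw [h3, hsum]
    refine Finset.sum_eq_zero fun j _ ↦ ?_
    change (ι j).app U ((π j).app U x) = 0
    rw [show (π j).app U x = 0 from congr_fun h2 j, map_zero]
  · intro U x hx
    obtain ⟨y, hy⟩ := hsurj U x hx
    refine ⟨∑ j, (ι j).app U (y j), ?_⟩
    rw [happ, ← hy]
    refine Finset.sum_congr rfl fun j _ ↦ ?_
    rw [map_sum, Finset.sum_eq_single j]
    · change (c j).app U ((ι j ≫ π j).app U (y j)) = _
      rw [h1]; rfl
    · intro j' _ hj
      change (ι j' ≫ π j).app U (y j') = 0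
      rw [h0 j' j hj]; rfl
    · simp

end ModulesAux

/-! ### Kernels of matrices over a graded domain which are free on homogeneous vectors -/

namespace ProjTwist

section FreeKernel

variable {A σ : Type u} [CommRing A] [IsDomain A] [SetLike σ A] [AddSubgroupClass σ A]
variable (𝒜 : ℕ → σ) [GradedRing 𝒜] (J : Type) [Fintype J]

/-- The grading of the free module `J → A` by its coordinates. -/
def piGrading (i : ℕ) : AddSubgroup (J → A) where
  carrier := {r | ∀ j, r j ∈ 𝒜 i}
  zero_mem' _ := zero_mem _
  add_mem' h h' j := add_mem (h j) (h' j)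
  neg_mem' h j := neg_mem (h j)

instance : SetLike.GradedSMul 𝒜 (piGrading 𝒜 J) where
  smul_mem := fun _ _ _ _ ha hr j ↦ SetLike.mul_mem_graded ha (hr j)

/-- The stalks of the sheaf associated with a torsion-free module have no torsion. -/
lemma mk_eq_zero_iff_of_torsionFree {N : Type u} [AddCommGroup N] [Module A N]
    [Module.IsTorsionFree A N] (x : ProjectiveSpectrum 𝒜) (r : N) (s : compl 𝒜 x) :
    (LocalizedModule.mk r s : StalkAt 𝒜 N x) = 0 ↔ r = 0 := by
  constructor
  · intro h
    rw [← LocalizedModule.zero_mk (1 : compl 𝒜 x), LocalizedModule.mk_eq] at h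
    obtain ⟨u, hu⟩ := h
    have hu0 : (u : A) ≠ 0 := fun h0 ↦ u.2 (h0 ▸ zero_mem _)
    simp only [one_smul, smul_zero] at hu
    exact (smul_eq_zero.1 (show (u : A) • r = 0 from hu)).resolve_left hu0
  · rintro rfl
    exact LocalizedModule.zero_mk s

lemma sum_mk {I : Type} [Fintype I] {N : Type u} [AddCommGroup N] [Module A N]
    (x : ProjectiveSpectrum 𝒜) (r : I → N) (s : compl 𝒜 x) :
    ∑ i, (LocalizedModule.mk (r i) s : StalkAt 𝒜 N x) = LocalizedModule.mk (∑ i, r i) s := by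
  let g : N →+ StalkAt 𝒜 N x :=
    { toFun m := LocalizedModule.mk m s
      map_zero' := LocalizedModule.zero_mk s
      map_add' m m' := by
        rw [LocalizedModule.mk_add_mk, ← smul_add, LocalizedModule.mk_cancel_common_left] }
  exact (map_sum g r Finset.univ).symm

variable {𝒜 J} {I : Type} [Fintype I] {d : I → ℕ} {κ : I → J → A}

/-- A homogeneous combination of homogeneous vectors may be taken with homogeneous
coefficients. -/
lemma exists_inDegree_of_sum_smul (hκ : ∀ i j, κ i j ∈ 𝒜 (d i)) {m : ℤ} {r : J → A}
    (hr : InDegree (piGrading 𝒜 J) m r) (c : I → A) (hc : ∑ i, c i • κ i = r) :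
    ∃ c' : I → A, (∀ i, InDegree 𝒜 (m - d i) (c' i)) ∧ ∑ i, c' i • κ i = r := by
  classical
  rcases hr with rfl | ⟨n, rfl, hr⟩
  · exact ⟨0, fun i ↦ Or.inl rfl, by simp⟩
  refine ⟨fun i ↦ if d i ≤ n then DirectSum.decompose 𝒜 (c i) (n - d i) else 0,
    fun i ↦ ?_, funext fun j ↦ ?_⟩
  · by_cases h : d i ≤ n
    · refine (congrArg (InDegree 𝒜 _) (if_pos h)).mpr ?_
      exact Or.inr ⟨n - d i, by omega, SetLike.coe_mem _⟩
    · exact Or.inl (if_neg h)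
  · have h1 := DirectSum.decompose_of_mem_same 𝒜 (hr j)
    rw [← hc, Finset.sum_apply, DirectSum.decompose_sum, DFinsupp.finsetSum_apply,
      AddSubmonoidClass.coe_finsetSum] at h1
    rw [← hc, Finset.sum_apply, Finset.sum_apply, ← h1]
    refine Finset.sum_congr rfl fun i _ ↦ ?_
    simp only [Pi.smul_apply, smul_eq_mul]
    rw [DirectSum.coe_decompose_mul_of_right_mem 𝒜 n (hκ i j), ite_mul, zero_mul]

/-- Linear independence of vectors persists in the stalks. -/
lemma stalk_linearIndependent (hli : ∀ c : I → A, ∑ i, c i • κ i = 0 → c = 0)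
    (x : ProjectiveSpectrum 𝒜) (c : I → StalkAt 𝒜 A x)
    (hc : ∑ i, stalkMap 𝒜 (LinearMap.toSpanSingleton A (J → A) (κ i)) x (c i) = 0) : c = 0 := by
  obtain ⟨b, hb⟩ := IsLocalizedModule.exist_integer_multiples_of_finite (compl 𝒜 x)
    (LocalizedModule.mkLinearMap (compl 𝒜 x) A) c
  choose a ha using hb
  have h1 : LocalizedModule.mkLinearMap (compl 𝒜 x) (J → A) (∑ i, a i • κ i) = 0 := by
    rw [map_sum, ← smul_zero (b : A), ← hc, Finset.smul_sum]
    refine Finset.sum_congr rfl fun i _ ↦ ?_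
    have h2 := (stalkMap 𝒜 (LinearMap.toSpanSingleton A (J → A) (κ i)) x).map_smul_of_tower
      (b : A) (c i)
    rw [← h2, show (b : A) • c i = _ from (ha i).symm]
    exact (LocalizedModule.map_mk (compl 𝒜 x)
      (LinearMap.toSpanSingleton A (J → A) (κ i)) (a i) 1).symm
  have h2 := hli a ((mk_eq_zero_iff_of_torsionFree 𝒜 x _ 1).1 h1)
  funext i
  have h3 : b.1 • c i = 0 := by rw [← ha, h2, Pi.zero_apply, map_zero]
  exact LocalizedModule.eq_zero_of_smul_eq_zero _ b.2 _ h3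

variable {e : ℕ} {D : (J → A) →ₗ[A] (J → A)}

/-- A section killed by `D` is uniquely a combination of the homogeneous vectors on which the
kernel of `D` is free. -/
lemma exists_sections_of_sectionsMap_eq_zero (hκ : ∀ i j, κ i j ∈ 𝒜 (d i))
    (hκ' : ∀ i, ∀ m, ∀ r ∈ 𝒜 m,
      LinearMap.toSpanSingleton A (J → A) (κ i) r ∈ piGrading 𝒜 J (m + d i))
    (hD : ∀ i, ∀ r ∈ piGrading 𝒜 J i, D r ∈ piGrading 𝒜 J (i + e))
    (hli : ∀ c : I → A, ∑ i, c i • κ i = 0 → c = 0)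
    (hspan : ∀ r : J → A, D r = 0 → ∃ c : I → A, ∑ i, c i • κ i = r)
    {m : ℤ} (hm : m = 0 + e) (hd : ∀ i, (0 : ℤ) = -(d i : ℤ) + d i)
    (U : (Opens (ProjectiveSpectrum.top 𝒜))ᵒᵖ)
    (F : sectionsAddSubgroup 𝒜 (piGrading 𝒜 J) 0 U) (hF : sectionsMap D hD hm U F = 0) :
    ∃ f : ∀ i, sectionsAddSubgroup 𝒜 𝒜 (-(d i : ℤ)) U,
      ∑ i, sectionsMap (LinearMap.toSpanSingleton A (J → A) (κ i)) (hκ' i) (hd i) U (f i) = F := by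
  have hF' (x : U.unop) : stalkMap 𝒜 D x.1 (F.1 x) = 0 := congr_fun (congr_arg Subtype.val hF) x
  have loc (x : U.unop) : ∃ (V : Opens (ProjectiveSpectrum.top 𝒜)) (_ : x.1 ∈ V)
      (iV : V ⟶ U.unop) (j : ℕ) (s : A) (c : I → A), s ∈ 𝒜 j ∧
      (∀ i, InDegree 𝒜 (j + -(d i : ℤ)) (c i)) ∧ ∀ y : V, ∃ hs : s ∈ compl 𝒜 y.1,
        F.1 (iV y) = LocalizedModule.mk (∑ i, c i • κ i) ⟨s, hs⟩ := by
    obtain ⟨V, mV, iV, j, r, s, hs, hr, w⟩ := F.2 x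
    obtain ⟨hsx, e1⟩ := w ⟨x.1, mV⟩
    have h1 : D r = 0 := by
      have h2 := hF' x
      rw [show F.1 x = _ from e1, LocalizedModule.map_mk] at h2
      exact (mk_eq_zero_iff_of_torsionFree 𝒜 x.1 _ _).1 h2
    obtain ⟨c, hc⟩ := hspan r h1
    obtain ⟨c', hc', rfl⟩ := exists_inDegree_of_sum_smul hκ hr c hc
    exact ⟨V, mV, iV, j, s, c', hs, fun i ↦ by simpa [sub_eq_add_neg] using hc' i, w⟩
  have stalk (x : U.unop) (c : I → A) (s : compl 𝒜 x.1) :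
      ∑ i, stalkMap 𝒜 (LinearMap.toSpanSingleton A (J → A) (κ i)) x.1 (LocalizedModule.mk (c i) s) =
        LocalizedModule.mk (∑ i, c i • κ i) s := by
    simp only [LocalizedModule.map_mk, LinearMap.toSpanSingleton_apply]
    exact sum_mk 𝒜 x.1 _ s
  have ex (x : U.unop) : ∃ g : I → StalkAt 𝒜 A x.1,
      ∑ i, stalkMap 𝒜 (LinearMap.toSpanSingleton A (J → A) (κ i)) x.1 (g i) = F.1 x := by
    obtain ⟨V, mV, iV, j, s, c, hs, hc, w⟩ := loc x
    obtain ⟨hsx, e1⟩ := w ⟨x.1, mV⟩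
    exact ⟨fun i ↦ LocalizedModule.mk (c i) ⟨s, hsx⟩, (stalk x c _).trans e1.symm⟩
  choose g hg using ex
  refine ⟨fun i ↦ ⟨fun x ↦ g x i, fun x ↦ ?_⟩, Subtype.ext <| funext fun x ↦ ?_⟩
  · obtain ⟨V, mV, iV, j, s, c, hs, hc, w⟩ := loc x
    refine ⟨V, mV, iV, j, c i, s, hs, hc i, fun y ↦ ?_⟩
    obtain ⟨hsy, e1⟩ := w y
    refine ⟨hsy, ?_⟩
    have h1 : (g (iV y) - fun i ↦ LocalizedModule.mk (c i) ⟨s, hsy⟩) = 0 := by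
      refine stalk_linearIndependent hli _ _ ?_
      simp only [Pi.sub_apply, map_sub, Finset.sum_sub_distrib]
      rw [hg]
      exact sub_eq_zero.2 (e1.trans (stalk (iV y) c ⟨s, hsy⟩).symm)
    exact sub_eq_zero.1 (congr_fun h1 i)
  · rw [AddSubgroup.val_finsetSum, Finset.sum_apply]
    exact hg x

lemma toSpanSingleton_mem (hκ : ∀ i j, κ i j ∈ 𝒜 (d i)) (i : I) (m : ℕ) (r : A)
    (hr : r ∈ 𝒜 m) : LinearMap.toSpanSingleton A (J → A) (κ i) r ∈ piGrading 𝒜 J (m + d i) :=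
  fun j ↦ SetLike.mul_mem_graded hr (hκ i j)

/-- If the kernel of the homogeneous matrix `D` is free on the vectors `κ i`, homogeneous of degree
`d i`, then the kernel of the morphism of sheaves given by `D` is the sum of the twists
`𝒪(-d i)`. -/
theorem nonempty_kernel_twistMap_iso (hκ : ∀ i j, κ i j ∈ 𝒜 (d i))
    (hD : ∀ i, ∀ r ∈ piGrading 𝒜 J i, D r ∈ piGrading 𝒜 J (i + e)) {m : ℤ} (hm : m = 0 + e)
    (hDκ : ∀ i, D (κ i) = 0)
    (hli : ∀ c : I → A, ∑ i, c i • κ i = 0 → c = 0)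
    (hspan : ∀ r : J → A, D r = 0 → ∃ c : I → A, ∑ i, c i • κ i = r)
    {L : (Proj 𝒜).Modules} (ι : ∀ i, twist 𝒜 𝒜 (-(d i : ℤ)) ⟶ L)
    (π : ∀ i, L ⟶ twist 𝒜 𝒜 (-(d i : ℤ))) (hL : ∑ i, π i ≫ ι i = 𝟙 L)
    (h1 : ∀ i, ι i ≫ π i = 𝟙 _) (h0 : ∀ i i', i ≠ i' → ι i ≫ π i' = 0) :
    Nonempty (kernel (twistMap (𝒩 := piGrading 𝒜 J) (𝒩' := piGrading 𝒜 J) D hD hm) ≅ L) := by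
  have hd (i) : (0 : ℤ) = -(d i : ℤ) + d i := by ring
  refine ModulesAux.nonempty_kernel_iso _ _ ι π hL h1 h0
    (fun i ↦ twistMap (LinearMap.toSpanSingleton A (J → A) (κ i)) (toSpanSingleton_mem hκ i) (hd i))
    (fun i ↦ ?_) (fun U x hx ↦ ?_) fun U x hx ↦ ?_
  · refine Scheme.Modules.hom_ext _ _ fun U ↦ ?_
    ext f
    refine Subtype.ext <| funext fun x ↦ ?_
    change stalkMap 𝒜 D x.1 (stalkMap 𝒜 _ x.1 (f.1 x)) = 0
    generalize f.1 x = z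
    induction z using LocalizedModule.induction_on with
    | h a s =>
      rw [LocalizedModule.map_mk, LocalizedModule.map_mk, LinearMap.toSpanSingleton_apply, map_smul,
        hDκ, smul_zero, LocalizedModule.zero_mk]
  · funext i
    refine Subtype.ext <| funext fun y ↦ ?_
    refine congr_fun (stalk_linearIndependent hli y.1 (fun i ↦ (x i).1 y) ?_) i
    have h2 := congr_fun (congr_arg Subtype.val hx) y
    erw [AddSubgroup.val_finsetSum, Finset.sum_apply] at h2
    exact h2
  · exact exists_sections_of_sectionsMap_eq_zero hκ (toSpanSingleton_mem hκ) hD hli hspan hm hd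
      (op U) x hx

end FreeKernel

end ProjTwist

/-! ### Veronese morphisms are isomorphisms -/

namespace ProjDeg

section Veronese

variable {A B σ τ : Type u} [CommRing A] [SetLike σ A] [AddSubgroupClass σ A]
  [CommRing B] [IsDomain B] [SetLike τ B] [AddSubgroupClass τ B]
  {𝒜 : ℕ → σ} {ℬ : ℕ → τ} [GradedRing 𝒜] [GradedRing ℬ]
  {d : ℕ} (f : DegHom 𝒜 ℬ d)

/-- The `d`-th power of a homogeneous element comes from the Veronese subring. -/
lemma exists_map_eq_pow
    (hsurj : ∀ i, ∀ b ∈ ℬ (d * i), ∃ a ∈ 𝒜 i, f.toRingHom a = b)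
    {i : ℕ} {b : B} (hb : b ∈ ℬ i) : ∃ a ∈ 𝒜 i, f.toRingHom a = b ^ d :=
  hsurj i _ (by simpa using SetLike.pow_mem_graded d hb)

lemma comap_injective
    (hsurj : ∀ i, ∀ b ∈ ℬ (d * i), ∃ a ∈ 𝒜 i, f.toRingHom a = b) :
    Function.Injective (comap f) := by
  intro y y' h
  have key (b : B) (i : ℕ) (hb : b ∈ ℬ i) :
      b ∈ y.asHomogeneousIdeal ↔ b ∈ y'.asHomogeneousIdeal := by
    obtain ⟨a, -, ha⟩ := exists_map_eq_pow f hsurj hb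
    have h1 (z : ProjectiveSpectrum ℬ) :
        b ∈ z.asHomogeneousIdeal ↔ a ∈ (comapFun f z).asHomogeneousIdeal := by
      change _ ↔ f.toRingHom a ∈ z.asHomogeneousIdeal.toIdeal
      rw [ha, z.isPrime.pow_mem_iff_mem _ f.pos]
      rfl
    rw [h1, h1, show comapFun f y = comapFun f y' from h]
  exact ProjectiveSpectrum.ext (HomogeneousIdeal.ext' fun i b hb ↦ key b i hb)

lemma isIntegral_toRingHom
    (hsurj : ∀ i, ∀ b ∈ ℬ (d * i), ∃ a ∈ 𝒜 i, f.toRingHom a = b) :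
    f.toRingHom.IsIntegral := by
  classical
  intro b
  rw [← DirectSum.sum_support_decompose ℬ b]
  refine Finset.sum_induction _ f.toRingHom.IsIntegralElem
    (fun _ _ ↦ RingHom.IsIntegralElem.add _) (RingHom.isIntegralElem_zero _) fun i _ ↦ ?_
  obtain ⟨a, -, ha⟩ := exists_map_eq_pow f hsurj (SetLike.coe_mem (DirectSum.decompose ℬ b i))
  algebraize [f.toRingHom]
  refine IsIntegral.of_pow (R := A) f.pos ?_
  rw [← ha]
  exact f.toRingHom.isIntegralElem_map

/-- A prime of `B` lying over a point of `Proj 𝒜` has a homogeneous core, which still lies over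
that point. -/
lemma comap_surjective (hinj : Function.Injective f.toRingHom)
    (hsurj : ∀ i, ∀ b ∈ ℬ (d * i), ∃ a ∈ 𝒜 i, f.toRingHom a = b) :
    Function.Surjective (comap f) := by
  intro x
  algebraize [f.toRingHom]
  have : Algebra.IsIntegral A B := ⟨isIntegral_toRingHom f hsurj⟩
  have := x.isPrime
  obtain ⟨Q, hQ, hQx⟩ := Ideal.exists_ideal_over_prime_of_isIntegral_of_isDomain (S := B)
    x.asHomogeneousIdeal.toIdeal (by
      change RingHom.ker f.toRingHom ≤ _
      rw [(RingHom.injective_iff_ker_eq_bot _).1 hinj]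
      exact bot_le)
  have hQx (a : A) : f.toRingHom a ∈ Q ↔ a ∈ x.asHomogeneousIdeal.toIdeal := by
    rw [← hQx]; rfl
  have key (a : A) (i : ℕ) (ha : a ∈ 𝒜 i) :
      f.toRingHom a ∈ Q.homogeneousCore ℬ ↔ a ∈ x.asHomogeneousIdeal := by
    constructor
    · exact fun h ↦ (hQx a).1 (Ideal.toIdeal_homogeneousCore_le ℬ Q h)
    · exact fun h ↦ Ideal.mem_homogeneousCore_of_homogeneous_of_mem ⟨_, f.map_mem ha⟩
        ((hQx a).2 h)
  let y : ProjectiveSpectrum ℬ :=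
    { asHomogeneousIdeal := Q.homogeneousCore ℬ
      isPrime := hQ.homogeneousCore
      not_irrelevant_le := fun h ↦ x.not_irrelevant_le <|
        (HomogeneousIdeal.toIdeal_irrelevant_le _).2 fun i hi a ha ↦ (key a i ha).1 <|
          h <| (HomogeneousIdeal.mem_irrelevant_iff _ _).2 <|
            DirectSum.decompose_of_mem_ne _ (f.map_mem ha) (Nat.mul_pos f.pos hi).ne' }
  exact ⟨y, ProjectiveSpectrum.ext (HomogeneousIdeal.ext' fun i a ha ↦ key a i ha)⟩

lemma isHomeomorph_comap (hinj : Function.Injective f.toRingHom)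
    (hsurj : ∀ i, ∀ b ∈ ℬ (d * i), ∃ a ∈ 𝒜 i, f.toRingHom a = b) :
    IsHomeomorph (comap f) := by
  have hs := comap_surjective f hinj hsurj
  have hi := comap_injective f hsurj
  refine ⟨(comap f).continuous, ?_, hi, hs⟩
  rw [(ProjectiveSpectrum.isTopologicalBasis_basic_opens ℬ).isOpenMap_iff]
  rintro _ ⟨b, rfl⟩
  beta_reduce
  rw [ProjectiveSpectrum.basicOpen_eq_union_of_projection, Opens.coe_iSup, Set.image_iUnion]
  refine isOpen_iUnion fun i ↦ ?_
  obtain ⟨a, -, ha⟩ := exists_map_eq_pow f hsurj (SetLike.coe_mem (DirectSum.decompose ℬ b i))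
  convert (ProjectiveSpectrum.basicOpen 𝒜 a).isOpen
  rw [← Set.image_preimage_eq (ProjectiveSpectrum.basicOpen 𝒜 a : Set _) hs]
  congr 1
  ext y
  change _ ↔ f.toRingHom a ∉ y.asHomogeneousIdeal.toIdeal
  rw [ha, y.isPrime.pow_mem_iff_mem _ f.pos]
  rfl

/-- When `comap f` is a homeomorphism, every open set is the inverse image of one. -/
lemma exists_opens_comap_eq (hf : IsHomeomorph (comap f)) (V : Opens (ProjectiveSpectrum.top ℬ)) :
    ∃ W : Opens (ProjectiveSpectrum.top 𝒜), W.comap (comap f) = V :=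
  ⟨⟨comap f '' V.carrier, hf.isOpenMap _ V.isOpen⟩,
    Opens.ext (Set.preimage_image_eq _ hf.injective)⟩

lemma stalkHom_injective (hinj : Function.Injective f.toRingHom)
    (y : ProjectiveSpectrum ℬ) : Function.Injective (stalkHom f y) := by
  have h1 : Function.Injective (locHom f y) := by
    rw [injective_iff_map_eq_zero]
    intro z hz
    obtain ⟨a, s, rfl⟩ := IsLocalization.exists_mk'_eq
      (comapFun f y).asHomogeneousIdeal.toIdeal.primeCompl z
    have h0 := Localization.localRingHom_mk' (comapFun f y).asHomogeneousIdeal.toIdeal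
      y.asHomogeneousIdeal.toIdeal f.toRingHom rfl a s
    rw [h0, IsLocalization.mk'_eq_zero_iff] at hz
    obtain ⟨u, hu⟩ := hz
    have hu0 : (u : B) ≠ 0 := fun h0 ↦ u.2 (h0 ▸ zero_mem _)
    have h2 := (mul_eq_zero.1 hu).resolve_left hu0
    rw [← map_zero f.toRingHom] at h2
    rw [hinj h2, IsLocalization.mk'_zero]
  intro z z' h
  have h2 := congr_arg HomogeneousLocalization.val h
  change (stalkFun f y z).val = (stalkFun f y z').val at h2
  rw [val_stalkFun, val_stalkFun] at h2
  exact HomogeneousLocalization.val_injective _ (h1 h2)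

lemma sectionsHom_bijective (hinj : Function.Injective f.toRingHom)
    (hsurj : ∀ i, ∀ b ∈ ℬ (d * i), ∃ a ∈ 𝒜 i, f.toRingHom a = b)
    (U : Opens (ProjectiveSpectrum.top 𝒜)) :
    Function.Bijective (sectionsHom f U) := by
  have hf := isHomeomorph_comap f hinj hsurj
  constructor
  · intro s s' h
    refine Subtype.ext <| funext fun x ↦ ?_
    obtain ⟨x, hx⟩ := x
    obtain ⟨y, rfl⟩ := hf.surjective x
    exact stalkHom_injective f hinj y (congr_fun (congr_arg Subtype.val h) ⟨y, hx⟩)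
  intro g
  -- a homogeneous fraction becomes one with denominator in the Veronese subring
  -- when it is expanded by a power of its denominator
  have loc (y : (U.comap (comap f) : Opens (ProjectiveSpectrum.top ℬ))) :
      ∃ (V : Opens (ProjectiveSpectrum.top 𝒜)) (_ : comapFun f y.1 ∈ V) (_ : V ≤ U) (i : ℕ)
        (a b : 𝒜 i), ∀ z : ProjectiveSpectrum ℬ, ∀ hz : comapFun f z ∈ V, ∀ hz' : comapFun f z ∈ U,
          ∃ hb : b.1 ∈ (comapFun f z).asHomogeneousIdeal.toIdeal.primeCompl,
          stalkHom f z (HomogeneousLocalization.mk ⟨i, a, b, hb⟩) = g.1 ⟨z, hz'⟩ := by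
    obtain ⟨V, mV, iV, i, ⟨a, ha⟩, ⟨b, hb⟩, nb, w⟩ := g.2 y
    obtain ⟨W, rfl⟩ := exists_opens_comap_eq f hf V
    obtain ⟨b', hb', eb⟩ := exists_map_eq_pow f hsurj hb
    obtain ⟨a', ha', ea⟩ := hsurj i (b ^ (d - 1) * a) (by
      have := SetLike.mul_mem_graded (SetLike.pow_mem_graded (d - 1) hb) ha
      have e : (d - 1) • i + i = d * i := by
        obtain ⟨c, hc⟩ := Nat.exists_eq_succ_of_ne_zero f.pos.ne'
        rw [hc, Nat.succ_eq_add_one, Nat.add_sub_cancel, smul_eq_mul]; ring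
      rwa [e] at this)
    refine ⟨W ⊓ U, ⟨mV, y.2⟩, inf_le_right, i, ⟨a', ha'⟩, ⟨b', hb'⟩, fun z hz hz' ↦ ?_⟩
    have nbz : b ∉ z.asHomogeneousIdeal.toIdeal := nb ⟨z, hz.1⟩
    have hz1 : b' ∈ (comapFun f z).asHomogeneousIdeal.toIdeal.primeCompl := by
      change f.toRingHom b' ∉ z.asHomogeneousIdeal.toIdeal
      rwa [eb, z.isPrime.pow_mem_iff_mem _ f.pos]
    refine ⟨hz1, ?_⟩
    refine Eq.trans ?_ (w ⟨z, hz.1⟩).symm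
    refine HomogeneousLocalization.val_injective _ ?_
    refine (val_stalkFun f z
      (HomogeneousLocalization.mk ⟨i, ⟨a', ha'⟩, ⟨b', hb'⟩, hz1⟩)).trans ?_
    rw [HomogeneousLocalization.val_mk, HomogeneousLocalization.val_mk]
    refine (Localization.localRingHom_mk (comapFun f z).asHomogeneousIdeal.toIdeal
      z.asHomogeneousIdeal.toIdeal f.toRingHom rfl a' ⟨b', hz1⟩).trans ?_
    refine Localization.mk_eq_mk_iff.2 (Localization.r_iff_exists.2 ⟨1, ?_⟩)
    simp only [ea, eb, OneMemClass.coe_one, one_mul]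
    obtain ⟨c, hc⟩ := Nat.exists_eq_succ_of_ne_zero f.pos.ne'
    rw [hc, Nat.succ_eq_add_one, Nat.add_sub_cancel]
    ring
  have ex (x : ProjectiveSpectrum 𝒜) (hx : x ∈ U) :
      ∃ z : HomogeneousLocalization.AtPrime 𝒜 x.asHomogeneousIdeal.toIdeal,
      ∀ (y : ProjectiveSpectrum ℬ) (h : x = comapFun f y) (hy : comapFun f y ∈ U),
        stalkHom f y (h ▸ z) = g.1 ⟨y, hy⟩ := by
    obtain ⟨y, rfl⟩ := hf.surjective x
    obtain ⟨V, mV, iV, i, a, b, w⟩ := loc ⟨y, hx⟩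
    obtain ⟨hb, e⟩ := w y mV hx
    refine ⟨HomogeneousLocalization.mk ⟨i, a, b, hb⟩, fun y' h hy' ↦ ?_⟩
    obtain rfl := hf.injective h
    exact e
  choose s hs using ex
  have hs' (y : ProjectiveSpectrum ℬ) (hy : comapFun f y ∈ U) :
      stalkHom f y (s (comapFun f y) hy) = g.1 ⟨y, hy⟩ := hs (comapFun f y) hy y rfl hy
  refine ⟨⟨fun x ↦ s x.1 x.2, fun x ↦ ?_⟩, Subtype.ext <| funext fun y ↦ hs' y.1 y.2⟩
  obtain ⟨x, hx⟩ := x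
  obtain ⟨y, rfl⟩ := hf.surjective x
  obtain ⟨V, mV, iV, i, a, b, w⟩ := loc ⟨y, hx⟩
  have nb (x' : V) : b.1 ∉ x'.1.asHomogeneousIdeal := by
    obtain ⟨x', hx'⟩ := x'
    obtain ⟨y', rfl⟩ := hf.surjective x'
    exact (w y' hx' (iV hx')).1
  refine ⟨V, mV, homOfLE iV, i, a, b, nb, fun x' ↦ ?_⟩
  obtain ⟨x', hx'⟩ := x'
  obtain ⟨y', rfl⟩ := hf.surjective x'
  obtain ⟨hb, e⟩ := w y' hx' (iV hx')
  exact stalkHom_injective f hinj y' ((hs' y' (iV hx')).trans e.symm)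

/-- A Veronese morphism `Proj ℬ ⟶ Proj 𝒜` is an isomorphism. -/
theorem isIso_map (hinj : Function.Injective f.toRingHom)
    (hsurj : ∀ i, ∀ b ∈ ℬ (d * i), ∃ a ∈ 𝒜 i, f.toRingHom a = b) :
    IsIso (map f) := by
  have h1 : IsIso (TopCat.ofHom (comap f)) :=
    (TopCat.isIso_iff_isHomeomorph _).2 (isHomeomorph_comap f hinj hsurj)
  have h2 : IsIso (sheafedSpaceMap f).hom.base := h1
  have h3 : IsIso (sheafedSpaceMap f).hom.c := by
    rw [NatTrans.isIso_iff_isIso_app]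
    intro U
    exact (ConcreteCategory.isIso_iff_bijective _).2 (sectionsHom_bijective f hinj hsurj U.unop)
  have h4 : IsIso (sheafedSpaceMap f).hom := PresheafedSpace.isIso_of_components _
  have h5 : IsIso (sheafedSpaceMap f) := by
    have : IsIso (SheafedSpace.forgetToPresheafedSpace.map (sheafedSpaceMap f)) := h4
    exact isIso_of_reflects_iso _ SheafedSpace.forgetToPresheafedSpace
  have h6 : IsIso ((Scheme.forgetToLocallyRingedSpace ⋙
      LocallyRingedSpace.forgetToSheafedSpace).map (map f)) := h5
  exact isIso_of_reflects_iso _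
    (Scheme.forgetToLocallyRingedSpace ⋙ LocallyRingedSpace.forgetToSheafedSpace)

end Veronese

end ProjDeg

/-! ### Veronese morphisms and twisted sheaves -/

namespace ProjDeg

open ProjTwist

section VeroneseModule

variable {A B σ τ : Type u} [CommRing A] [SetLike σ A] [AddSubgroupClass σ A]
  [CommRing B] [IsDomain B] [SetLike τ B] [AddSubgroupClass τ B]
  {𝒜 : ℕ → σ} {ℬ : ℕ → τ} [GradedRing 𝒜] [GradedRing ℬ]
  {d : ℕ} (f : DegHom 𝒜 ℬ d)
  {N σ' : Type u} [AddCommGroup N] [Module A N] [SetLike σ' N] [AddSubgroupClass σ' N]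
  {𝒩 : ℕ → σ'} [SetLike.GradedSMul 𝒜 𝒩]
  {N' τ' : Type u} [AddCommGroup N'] [Module B N'] [SetLike τ' N'] [AddSubgroupClass τ' N']
  {𝒩' : ℕ → τ'} [SetLike.GradedSMul ℬ 𝒩']
  (Ψ : N →ₛₗ[f.toRingHom] N')

/-- The map of stalks `r / s ↦ Ψ r / f s` over a ring homomorphism `f`. -/
noncomputable def semiStalkMap (y : ProjectiveSpectrum ℬ) :
    StalkAt 𝒜 N (comapFun f y) →+ StalkAt ℬ N' y where
  toFun z := z.liftOn (fun q ↦ LocalizedModule.mk (Ψ q.1) ⟨f.toRingHom q.2, q.2.2⟩) (by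
    rintro ⟨r, s⟩ ⟨r', s'⟩ ⟨u, hu⟩
    refine LocalizedModule.mk_eq.2 ⟨⟨f.toRingHom u, u.2⟩, ?_⟩
    have h1 := congr_arg Ψ (show (u : A) • (s' : A) • r = (u : A) • (s : A) • r' from hu)
    rw [LinearMap.map_smulₛₗ, LinearMap.map_smulₛₗ, LinearMap.map_smulₛₗ,
      LinearMap.map_smulₛₗ] at h1
    exact h1)
  map_zero' := by
    rw [← LocalizedModule.zero_mk 1, LocalizedModule.liftOn_mk, map_zero, LocalizedModule.zero_mk]
  map_add' z z' := by
    induction z, z' using LocalizedModule.induction_on₂ with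
    | h r r' s s' =>
      rw [LocalizedModule.mk_add_mk, LocalizedModule.liftOn_mk, LocalizedModule.liftOn_mk,
        LocalizedModule.liftOn_mk, LocalizedModule.mk_add_mk]
      refine LocalizedModule.mk_eq.2 ⟨1, ?_⟩
      simp only [map_add, Submonoid.smul_def, LinearMap.map_smulₛₗ, Submonoid.coe_mul, map_mul]

lemma semiStalkMap_mk (y : ProjectiveSpectrum ℬ) (r : N) (s : compl 𝒜 (comapFun f y)) :
    semiStalkMap f Ψ y (LocalizedModule.mk r s) =
      LocalizedModule.mk (Ψ r) ⟨f.toRingHom s, s.2⟩ := rfl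

lemma semiStalkMap_smul (y : ProjectiveSpectrum ℬ)
    (c : Localization (compl 𝒜 (comapFun f y))) (z : StalkAt 𝒜 N (comapFun f y)) :
    semiStalkMap f Ψ y (c • z) = locHom f y c • semiStalkMap f Ψ y z := by
  induction z using LocalizedModule.induction_on with
  | h r s =>
    obtain ⟨⟨a, b⟩, rfl⟩ := Localization.mkHom_surjective c
    have h1 : locHom f y (Localization.mk a b) =
        Localization.mk (f.toRingHom a) ⟨f.toRingHom b, b.2⟩ :=
      Localization.localRingHom_mk (comapFun f y).asHomogeneousIdeal.toIdeal
        y.asHomogeneousIdeal.toIdeal f.toRingHom rfl a b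
    change semiStalkMap f Ψ y (Localization.mk a b • _) = locHom f y (Localization.mk a b) • _
    rw [h1, LocalizedModule.mk_smul_mk, semiStalkMap_mk, semiStalkMap_mk,
      LocalizedModule.mk_smul_mk]
    simp only [LinearMap.map_smulₛₗ, Submonoid.coe_mul, map_mul]
    rfl

lemma semiStalkMap_injective [Module.IsTorsionFree B N'] (hinj : Function.Injective Ψ)
    (y : ProjectiveSpectrum ℬ) : Function.Injective (semiStalkMap f Ψ y) := by
  rw [injective_iff_map_eq_zero]
  intro z hz
  induction z using LocalizedModule.induction_on with
  | h r s =>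
    rw [semiStalkMap_mk, mk_eq_zero_iff_of_torsionFree, ← map_zero Ψ] at hz
    rw [hinj hz, LocalizedModule.zero_mk]

/-- The action of `Ψ` on sections, `r / s ↦ Ψ r / f s`. -/
noncomputable def semiSectionsMap (hΨ : ∀ i, ∀ r ∈ 𝒩 i, Ψ r ∈ 𝒩' (d * i)) {n n' : ℤ}
    (hn : n' = d * n) (U : Opens (ProjectiveSpectrum.top 𝒜)) :
    sectionsAddSubgroup 𝒜 𝒩 n (op U) →+
      sectionsAddSubgroup ℬ 𝒩' n' (op (U.comap (comap f) : Opens (ProjectiveSpectrum.top ℬ))) where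
  toFun s := ⟨fun y ↦ semiStalkMap f Ψ y.1 (s.1 ⟨comapFun f y.1, y.2⟩), fun y ↦ by
    obtain ⟨V, mV, iV, j, r, b, hb, hr, w⟩ := s.2 ⟨comapFun f y.1, y.2⟩
    refine ⟨V.comap (comap f), mV, homOfLE fun z hz ↦ leOfHom iV hz, d * j, Ψ r, f.toRingHom b,
      f.map_mem hb, ?_, fun z ↦ ?_⟩
    · rcases hr with rfl | ⟨i, hi, hr⟩
      · exact Or.inl (map_zero Ψ)
      · exact Or.inr ⟨d * i, by push_cast; rw [hi, hn]; ring, hΨ i r hr⟩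
    · obtain ⟨h1, e1⟩ := w ⟨comapFun f z.1, z.2⟩
      exact ⟨h1, congr(semiStalkMap f Ψ z.1 $e1)⟩⟩
  map_zero' := Subtype.ext <| funext fun y ↦ map_zero (semiStalkMap f Ψ y.1)
  map_add' s t := Subtype.ext <| funext fun y ↦ map_add (semiStalkMap f Ψ y.1) _ _

/-- The morphism `N~(n) ⟶ f_* N'~(d n)` over `Proj 𝒜` induced by `Ψ`. -/
noncomputable def semiTwistMap (hΨ : ∀ i, ∀ r ∈ 𝒩 i, Ψ r ∈ 𝒩' (d * i)) {n n' : ℤ}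
    (hn : n' = d * n) :
    twist 𝒜 𝒩 n ⟶ (Scheme.Modules.pushforward (map f)).obj (twist ℬ 𝒩' n') where
  val := PresheafOfModules.homMk
    { app := fun U ↦ AddCommGrpCat.ofHom (semiSectionsMap f Ψ hΨ hn U.unop)
      naturality := fun _ _ _ ↦ rfl }
    fun U c s ↦ Subtype.ext <| funext fun y ↦
      (semiStalkMap_smul f Ψ y.1 _ _).trans
        congr($((val_stalkFun f y.1 (c.1 ⟨comapFun f y.1, y.2⟩)).symm) • _)

variable {f Ψ}

lemma semiSectionsMap_bijective [Module.IsTorsionFree B N']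
    (hf : IsHomeomorph (comap f))
    (hsurj : ∀ i, ∀ b ∈ ℬ (d * i), ∃ a ∈ 𝒜 i, f.toRingHom a = b)
    (hΨ : ∀ i, ∀ r ∈ 𝒩 i, Ψ r ∈ 𝒩' (d * i)) (hinj : Function.Injective Ψ)
    (hΨs : ∀ i, ∀ r' ∈ 𝒩' (d * i), ∃ r ∈ 𝒩 i, Ψ r = r') {n n' : ℤ}
    (hn : n' = d * n) (U : Opens (ProjectiveSpectrum.top 𝒜)) :
    Function.Bijective (semiSectionsMap f Ψ hΨ hn U) := by
  constructor
  · intro s s' h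
    refine Subtype.ext <| funext fun x ↦ ?_
    obtain ⟨x, hx⟩ := x
    obtain ⟨y, rfl⟩ := hf.surjective x
    exact semiStalkMap_injective f Ψ hinj y (congr_fun (congr_arg Subtype.val h) ⟨y, hx⟩)
  intro g
  -- a homogeneous fraction becomes one with denominator and numerator in the Veronese part
  -- when it is expanded by a power of its denominator
  have loc (y : (U.comap (comap f) : Opens (ProjectiveSpectrum.top ℬ))) :
      ∃ (V : Opens (ProjectiveSpectrum.top 𝒜)) (_ : comapFun f y.1 ∈ V) (_ : V ≤ U) (j : ℕ)
        (r : N) (s : A), s ∈ 𝒜 j ∧ InDegree 𝒩 (j + n) r ∧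
        ∀ z : ProjectiveSpectrum ℬ, ∀ hz : comapFun f z ∈ V, ∀ hz' : comapFun f z ∈ U,
          ∃ hs : s ∈ compl 𝒜 (comapFun f z),
          semiStalkMap f Ψ z (LocalizedModule.mk r ⟨s, hs⟩) = g.1 ⟨z, hz'⟩ := by
    obtain ⟨V, mV, iV, j, r, s, hs, hr, w⟩ := g.2 y
    obtain ⟨W, rfl⟩ := exists_opens_comap_eq f hf V
    obtain ⟨s', hs', es⟩ := exists_map_eq_pow f hsurj hs
    obtain ⟨r', hr', er⟩ : ∃ r' : N, InDegree 𝒩 (j + n) r' ∧ Ψ r' = s ^ (d - 1) • r := by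
      rcases hr with rfl | ⟨i, hi, hr⟩
      · exact ⟨0, Or.inl rfl, by rw [map_zero, smul_zero]⟩
      · obtain ⟨c, hc⟩ := Nat.exists_eq_succ_of_ne_zero f.pos.ne'
        have h1 : ((d - 1) • j + i : ℤ) = d * (j + n) := by
          rw [hi, hn, hc]; push_cast; ring_nf
        have h0 : 0 ≤ (j + n : ℤ) := by
          have : 0 ≤ (d : ℤ) * (j + n) := by rw [← h1]; positivity
          exact nonneg_of_mul_nonneg_right this (by exact_mod_cast f.pos)
        obtain ⟨m, hm⟩ := Int.eq_ofNat_of_zero_le h0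
        have h2 : (d - 1) • j +ᵥ i = d * m := by
          rw [hm] at h1
          change (d - 1) • j + i = d * m
          have h3 : (((d - 1) • j + i : ℕ) : ℤ) = ((d * m : ℕ) : ℤ) := by
            rw [Nat.cast_add, Nat.cast_mul, ← h1]
            simp
          exact_mod_cast h3
        obtain ⟨r', hr', er⟩ := hΨs m (s ^ (d - 1) • r)
          (h2 ▸ SetLike.GradedSMul.smul_mem (SetLike.pow_mem_graded (d - 1) hs) hr)
        exact ⟨r', Or.inr ⟨m, hm.symm, hr'⟩, er⟩
    refine ⟨W ⊓ U, ⟨mV, y.2⟩, inf_le_right, j, r', s', hs', hr', fun z hz hz' ↦ ?_⟩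
    obtain ⟨nbz, e1⟩ := w ⟨z, hz.1⟩
    have hz1 : s' ∈ compl 𝒜 (comapFun f z) := by
      change f.toRingHom s' ∉ z.asHomogeneousIdeal.toIdeal
      rw [es, z.isPrime.pow_mem_iff_mem _ f.pos]
      exact nbz
    refine ⟨hz1, Eq.trans ?_ e1.symm⟩
    rw [semiStalkMap_mk, LocalizedModule.mk_eq]
    refine ⟨1, ?_⟩
    simp only [one_smul, Submonoid.smul_def, er, es, smul_smul]
    obtain ⟨c, hc⟩ := Nat.exists_eq_succ_of_ne_zero f.pos.ne'
    rw [hc, Nat.succ_eq_add_one, Nat.add_sub_cancel, pow_succ']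
  have ex (x : ProjectiveSpectrum 𝒜) (hx : x ∈ U) : ∃ z : StalkAt 𝒜 N x,
      ∀ (y : ProjectiveSpectrum ℬ) (h : x = comapFun f y) (hy : comapFun f y ∈ U),
        semiStalkMap f Ψ y (h ▸ z) = g.1 ⟨y, hy⟩ := by
    obtain ⟨y, rfl⟩ := hf.surjective x
    obtain ⟨V, mV, iV, j, r, s, -, -, w⟩ := loc ⟨y, hx⟩
    obtain ⟨hs, e⟩ := w y mV hx
    refine ⟨LocalizedModule.mk r ⟨s, hs⟩, fun y' h hy' ↦ ?_⟩
    obtain rfl := hf.injective h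
    exact e
  choose s hs using ex
  have hs' (y : ProjectiveSpectrum ℬ) (hy : comapFun f y ∈ U) :
      semiStalkMap f Ψ y (s (comapFun f y) hy) = g.1 ⟨y, hy⟩ := hs (comapFun f y) hy y rfl hy
  refine ⟨⟨fun x ↦ s x.1 x.2, fun x ↦ ?_⟩, Subtype.ext <| funext fun y ↦ hs' y.1 y.2⟩
  obtain ⟨x, hx⟩ := x
  obtain ⟨y, rfl⟩ := hf.surjective x
  obtain ⟨V, mV, iV, j, r, b, hb, hr, w⟩ := loc ⟨y, hx⟩
  refine ⟨V, mV, homOfLE iV, j, r, b, hb, hr, fun x' ↦ ?_⟩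
  obtain ⟨x', hx'⟩ := x'
  obtain ⟨y', rfl⟩ := hf.surjective x'
  obtain ⟨h1, e⟩ := w y' hx' (iV hx')
  exact ⟨h1, semiStalkMap_injective f Ψ hinj y' ((hs' y' (iV hx')).trans e.symm)⟩

lemma isIso_semiTwistMap [Module.IsTorsionFree B N']
    (hf : IsHomeomorph (comap f))
    (hsurj : ∀ i, ∀ b ∈ ℬ (d * i), ∃ a ∈ 𝒜 i, f.toRingHom a = b)
    (hΨ : ∀ i, ∀ r ∈ 𝒩 i, Ψ r ∈ 𝒩' (d * i)) (hinj : Function.Injective Ψ)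
    (hΨs : ∀ i, ∀ r' ∈ 𝒩' (d * i), ∃ r ∈ 𝒩 i, Ψ r = r') {n n' : ℤ} (hn : n' = d * n) :
    IsIso (semiTwistMap f Ψ hΨ hn) :=
  ModulesAux.isIso_of_bijective _ (semiSectionsMap_bijective hf hsurj hΨ hinj hΨs hn)

end VeroneseModule

end ProjDeg

/-! ### The nullcone as a Veronese quotient of the plane -/

namespace SlTwo

open MvPolynomial

section Veronese

variable (k : Type u) [Field k] [IsAlgClosed k] (p : ℕ) [Fact p.Prime]

/-- Every element of the nullcone is of the form `s ^ 2 e - t ^ 2 f + s t h`. -/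
lemma exists_parametrization (v : Fin 3 → k) (hv : point k v ∈ nullcone k p) :
    ∃ w : Fin 2 → k, v = ![w 0 ^ 2, -w 1 ^ 2, w 0 * w 1] := by
  have h1 : (point k v : Matrix (Fin 2) (Fin 2) k).det = 0 := by
    have h2 : (point k v : Matrix (Fin 2) (Fin 2) k) ^ p = 0 := hv
    have h3 := congr_arg Matrix.det h2
    rw [Matrix.det_pow, Matrix.det_zero] at h3
    exact pow_eq_zero_iff (Fact.out : p.Prime).ne_zero |>.1 h3
  have h4 : (point k v : Matrix (Fin 2) (Fin 2) k).det = -(v 2 * v 2) - v 0 * v 1 := by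
    simp [point, e, f, h, Matrix.det_fin_two]
  rw [h4] at h1
  obtain ⟨s, hs⟩ := IsAlgClosed.exists_pow_nat_eq (v 0) two_pos
  obtain ⟨t, ht⟩ := IsAlgClosed.exists_pow_nat_eq (-v 1) two_pos
  have h5 : (v 2 - s * t) * (v 2 + s * t) = 0 := by
    linear_combination -h1 + v 1 * hs - s ^ 2 * ht
  have key (t' : k) (ht' : t' ^ 2 = -v 1) (h6 : v 2 = s * t') :
      v = ![s ^ 2, -t' ^ 2, s * t'] := by
    funext i
    fin_cases i
    · exact hs.symm
    · exact (neg_eq_iff_eq_neg.2 ht').symm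
    · exact h6
  rcases mul_eq_zero.1 h5 with h6 | h6
  · exact ⟨![s, t], key t ht (by linear_combination h6)⟩
  · exact ⟨![s, -t], key (-t) (by rw [neg_sq, ht]) (by linear_combination h6)⟩

lemma iotaRingHom_injective : Function.Injective (iotaRingHom k p) := by
  rw [injective_iff_map_eq_zero]
  intro z hz
  obtain ⟨F, rfl⟩ := Ideal.Quotient.mk_surjective z
  have hF : iotaPoly k F = 0 := hz
  refine Ideal.Quotient.eq_zero_iff_mem.2 fun v hv ↦ ?_
  obtain ⟨w, rfl⟩ := exists_parametrization k p v hv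
  have h0 : (aeval w : MvPolynomial (Fin 2) k →ₐ[k] k).comp (iotaPoly k) =
      aeval ![w 0 ^ 2, - w 1 ^ 2, w 0 * w 1] := by
    ext j
    fin_cases j <;> simp [iotaPoly]
  rw [← h0, AlgHom.comp_apply, hF, map_zero]

/-- The forms of even degree in `s, t` are polynomials in `s ^ 2`, `-t ^ 2`, `s t`. -/
lemma exists_iotaRingHom_eq (i : ℕ) (b : MvPolynomial (Fin 2) k)
    (hb : b ∈ homogeneousSubmodule (Fin 2) k (2 * i)) :
    ∃ a ∈ coordGrading k p i, iotaRingHom k p a = b := by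
  suffices ∃ F ∈ homogeneousSubmodule (Fin 3) k i, iotaPoly k F = b by
    obtain ⟨F, hF, h1⟩ := this
    exact ⟨Ideal.Quotient.mk _ F, ⟨F, hF, rfl⟩, h1⟩
  suffices homogeneousSubmodule (Fin 2) k (2 * i) ≤
      (homogeneousSubmodule (Fin 3) k i).map (iotaPoly k).toLinearMap from this hb
  intro b hb
  rw [b.as_sum]
  refine sum_mem fun m hm ↦ ?_
  have hm' : m 0 + m 1 = 2 * i := by
    have h1 := hb (mem_support_iff.1 hm)
    have h2 : m.degree = 2 * i := by
      rw [Finsupp.degree_eq_weight_one]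
      exact h1
    rwa [Finsupp.degree_eq_sum, Fin.sum_univ_two] at h2
  rw [← mul_one (coeff m b), ← smul_eq_mul, ← smul_monomial]
  refine Submodule.smul_mem _ _ ?_
  have hmon : (monomial m 1 : MvPolynomial (Fin 2) k) = X 0 ^ m 0 * X 1 ^ m 1 := by
    rw [monomial_eq, Finsupp.prod_fintype _ _ (by simp), Fin.prod_univ_two, C_1, one_mul]
  rw [hmon]
  rcases Nat.even_or_odd' (m 0) with ⟨a, ha | ha⟩
  · refine ⟨X 0 ^ a * (-X 1) ^ (i - a), ?_, ?_⟩
    · have h1 := (isHomogeneous_X_pow (R := k) (0 : Fin 3) a).mul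
        ((isHomogeneous_X k (1 : Fin 3)).neg.pow (i - a))
      rwa [one_mul, show a + (i - a) = i by omega] at h1
    · simp only [iotaPoly, AlgHom.toLinearMap_apply, map_mul, map_pow, map_neg, aeval_X,
        Matrix.cons_val_zero, Matrix.cons_val_one, neg_neg, ← pow_mul]
      rw [show m 0 = 2 * a by omega, show m 1 = 2 * (i - a) by omega]
  · refine ⟨X 0 ^ a * (-X 1) ^ (i - a - 1) * X 2, ?_, ?_⟩
    · have h1 := ((isHomogeneous_X_pow (R := k) (0 : Fin 3) a).mul
        ((isHomogeneous_X k (1 : Fin 3)).neg.pow (i - a - 1))).mul (isHomogeneous_X k (2 : Fin 3))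
      rwa [one_mul, show a + (i - a - 1) + 1 = i by omega] at h1
    · simp only [iotaPoly, AlgHom.toLinearMap_apply, map_mul, map_pow, map_neg, aeval_X,
        Matrix.cons_val_zero, Matrix.cons_val_one, Matrix.cons_val, neg_neg, ← pow_mul]
      rw [show m 0 = 2 * a + 1 by omega, show m 1 = 2 * (i - a - 1) + 1 by omega]
      ring

instance isIso_iota : IsIso (iota k p) :=
  ProjDeg.isIso_map (iotaDegHom k p) (iotaRingHom_injective k p) (exists_iotaRingHom_eq k p)

end Veronese

section Coordinates

variable {k : Type u} [Field k] [IsAlgClosed k] {p : ℕ} [Fact p.Prime]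
  {M : Type u} [AddCommGroup M] [Module k M] {J : Type} [Fintype J] (c : M ≃ₗ[k] (J → k))

lemma iotaRingHom_algebraMap (r : k) : iotaRingHom k p (algebraMap k _ r) = C r :=
  (iotaPoly k).commutes r

/-- The coordinate vector of `m`, as a vector of constant polynomials. -/
noncomputable def constVec (m : M) (j : J) : MvPolynomial (Fin 2) k := C (c m j)

variable (p) in
/-- The bilinear map underlying `coordMap`. -/
noncomputable def coordBilin : CoordRing k p →ₗ[k] M →ₗ[k] (J → MvPolynomial (Fin 2) k) :=
  LinearMap.mk₂ k (fun a m ↦ iotaRingHom k p a • constVec c m)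
    (fun a a' m ↦ by rw [map_add, add_smul])
    (fun r a m ↦ by
      rw [Algebra.smul_def r a, map_mul, iotaRingHom_algebraMap, mul_smul, ← algebraMap_eq,
        algebraMap_smul])
    (fun a m m' ↦ by
      rw [← smul_add]
      congr 1
      funext j
      simp [constVec])
    (fun r a m ↦ by
      rw [smul_comm]
      congr 1
      funext j
      simp [constVec, smul_eq_C_mul])

open scoped TensorProduct

variable (p) in
/-- The map `a ⊗ m ↦ (a(s ^ 2, -t ^ 2, s t) m_j)_j` from `A ⊗ M` to vectors of polynomials in
`s, t`. -/
noncomputable def coordMap :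
    CoordRing k p ⊗[k] M →ₛₗ[(iotaDegHom k p).toRingHom] (J → MvPolynomial (Fin 2) k) where
  __ := (TensorProduct.lift (coordBilin p c)).toAddMonoidHom
  map_smul' a t := by
    change TensorProduct.lift (coordBilin p c) (a • t) =
      iotaRingHom k p a • TensorProduct.lift (coordBilin p c) t
    induction t using TensorProduct.induction_on with
    | zero => simp
    | tmul b m =>
      rw [TensorProduct.smul_tmul', TensorProduct.lift.tmul, TensorProduct.lift.tmul]
      simp only [coordBilin, LinearMap.mk₂_apply, smul_eq_mul, map_mul, mul_smul]
    | add t t' ht ht' => rw [smul_add, map_add, map_add, ht, ht', smul_add]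

lemma coordMap_tmul (a : CoordRing k p) (m : M) :
    coordMap p c (a ⊗ₜ m) = iotaRingHom k p a • constVec c m := rfl

lemma coordMap_sum [DecidableEq J] (a : J → CoordRing k p) (j : J) :
    coordMap p c (∑ j, a j ⊗ₜ c.symm (Pi.single j 1)) j = iotaRingHom k p (a j) := by
  rw [map_sum, Finset.sum_apply, Finset.sum_eq_single j]
  · simp [coordMap_tmul, constVec]
  · intro j' _ hj
    simp [coordMap_tmul, constVec, hj.symm]
  · simp

lemma exists_eq_sum_tmul [DecidableEq J] (t : CoordRing k p ⊗[k] M) :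
    ∃ a : J → CoordRing k p, t = ∑ j, a j ⊗ₜ c.symm (Pi.single j 1) := by
  induction t using TensorProduct.induction_on with
  | zero => exact ⟨0, by simp⟩
  | tmul b m =>
    refine ⟨fun j ↦ c m j • b, ?_⟩
    simp only [TensorProduct.smul_tmul, ← TensorProduct.tmul_sum, ← map_smul, ← map_sum]
    congr 1
    rw [LinearEquiv.eq_symm_apply]
    funext j
    simp [Pi.single_apply]
  | add t t' ht ht' =>
    obtain ⟨a, rfl⟩ := ht
    obtain ⟨a', rfl⟩ := ht'
    exact ⟨a + a', by simp [TensorProduct.add_tmul, Finset.sum_add_distrib]⟩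

lemma coordMap_injective : Function.Injective (coordMap p c) := by
  classical
  rw [injective_iff_map_eq_zero]
  intro t ht
  obtain ⟨a, rfl⟩ := exists_eq_sum_tmul c t
  refine Finset.sum_eq_zero fun j _ ↦ ?_
  have h1 : iotaRingHom k p (a j) = 0 := by rw [← coordMap_sum c a j, ht]; rfl
  rw [iotaRingHom_injective k p (h1.trans (map_zero _).symm), TensorProduct.zero_tmul]

open ProjTwist

lemma constVec_mem (m : M) : constVec c m ∈ piGrading (homogeneousSubmodule (Fin 2) k) J 0 :=
  fun _ ↦ isHomogeneous_C _ _

lemma coordMap_mem (i : ℕ) (t : CoordRing k p ⊗[k] M) (ht : t ∈ tensorGrading k p M i) :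
    coordMap p c t ∈ piGrading (homogeneousSubmodule (Fin 2) k) J (2 * i) := by
  obtain ⟨t, rfl⟩ := ht
  induction t using TensorProduct.induction_on with
  | zero => simp [zero_mem]
  | tmul b m =>
    exact fun j ↦ SetLike.mul_mem_graded (i := 2 * i) (j := 0) ((iotaDegHom k p).map_mem b.2)
      (constVec_mem c m j)
  | add t t' ht ht' =>
    rw [map_add, map_add]
    exact add_mem ht ht'

lemma exists_coordMap_eq (i : ℕ) (r : J → MvPolynomial (Fin 2) k)
    (hr : r ∈ piGrading (homogeneousSubmodule (Fin 2) k) J (2 * i)) :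
    ∃ t ∈ tensorGrading k p M i, coordMap p c t = r := by
  classical
  choose a ha har using fun j ↦ exists_iotaRingHom_eq k p i (r j) (hr j)
  refine ⟨∑ j, a j ⊗ₜ c.symm (Pi.single j 1), sum_mem fun j _ ↦ ?_, funext fun j ↦ ?_⟩
  · exact ⟨⟨a j, ha j⟩ ⊗ₜ _, rfl⟩
  · rw [coordMap_sum, har]

variable [LieRingModule (sl2 k) M] [LieModule k (sl2 k) M]

/-- The matrix `D` over `k[s, t]` is that of the operator `s ^ 2 e - t ^ 2 f + s t h` in the
coordinates `c` of `M`. -/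
def IsThetaMatrix
    (D : (J → MvPolynomial (Fin 2) k) →ₗ[MvPolynomial (Fin 2) k] (J → MvPolynomial (Fin 2) k)) :
    Prop :=
  ∀ m : M, D (constVec c m) = (X 0 ^ 2 : MvPolynomial (Fin 2) k) • constVec c ⁅e k, m⁆ -
    (X 1 ^ 2 : MvPolynomial (Fin 2) k) • constVec c ⁅f k, m⁆ +
    (X 0 * X 1 : MvPolynomial (Fin 2) k) • constVec c ⁅h k, m⁆

variable {c}
variable {D : (J → MvPolynomial (Fin 2) k) →ₗ[MvPolynomial (Fin 2) k]
  (J → MvPolynomial (Fin 2) k)}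

lemma IsThetaMatrix.mem (hc : IsThetaMatrix c D) (i : ℕ) (r : J → MvPolynomial (Fin 2) k)
    (hr : r ∈ piGrading (homogeneousSubmodule (Fin 2) k) J i) :
    D r ∈ piGrading (homogeneousSubmodule (Fin 2) k) J (i + 2) := by
  classical
  have h1 : r = ∑ j, r j • constVec c (c.symm (Pi.single j 1)) := by
    funext j
    rw [Finset.sum_apply, Finset.sum_eq_single j]
    · simp [constVec]
    · intro j' _ hj
      simp [constVec, hj.symm]
    · simp
  rw [h1, map_sum]
  refine sum_mem fun j _ ↦ ?_
  rw [map_smul]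
  intro j'
  refine SetLike.mul_mem_graded (hr j) (?_ : _ ∈ homogeneousSubmodule (Fin 2) k 2)
  rw [hc]
  have key (q : MvPolynomial (Fin 2) k) (hq : q.IsHomogeneous 2) (m : M) :
      (q • constVec c m) j' ∈ homogeneousSubmodule (Fin 2) k 2 :=
    SetLike.mul_mem_graded (i := 2) (j := 0) hq (constVec_mem c m j')
  exact add_mem (sub_mem (key _ (isHomogeneous_X_pow 0 2) _) (key _ (isHomogeneous_X_pow 1 2) _))
    (key _ ((isHomogeneous_X k 0).mul (isHomogeneous_X k 1)) _)

lemma IsThetaMatrix.coordMap_thetaLin (hc : IsThetaMatrix c D) (t : CoordRing k p ⊗[k] M) :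
    coordMap p c (thetaLin k p M t) = D (coordMap p c t) := by
  induction t using TensorProduct.induction_on with
  | zero => simp
  | tmul b m =>
    have h0 : iotaRingHom k p (coord k p 0) = X 0 ^ 2 := by
      change iotaPoly k (X 0) = _; simp [iotaPoly]
    have h1 : iotaRingHom k p (coord k p 1) = -X 1 ^ 2 := by
      change iotaPoly k (X 1) = _; simp [iotaPoly]
    have h2 : iotaRingHom k p (coord k p 2) = X 0 * X 1 := by
      change iotaPoly k (X 2) = _; simp [iotaPoly]
    have h3 : thetaLin k p M (b ⊗ₜ m) = (coord k p 0 * b) ⊗ₜ ⁅e k, m⁆ +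
      (coord k p 1 * b) ⊗ₜ ⁅f k, m⁆ + (coord k p 2 * b) ⊗ₜ ⁅h k, m⁆ := rfl
    rw [h3, map_add, map_add, coordMap_tmul, coordMap_tmul, coordMap_tmul, coordMap_tmul, map_smul,
      hc, map_mul, map_mul, map_mul, h0, h1, h2]
    module
  | add t t' ht ht' => rw [map_add, map_add, map_add, map_add, ht, ht']

variable (p c) in
/-- The isomorphism between `𝒪(n) ⊗ M` and the direct image of the free sheaf `𝒪(2 n) ^ J` on the
projective line which is given by the coordinates `c` of `M`. -/
noncomputable def coordTwistMap {n n' : ℤ} (hn : n' = (2 : ℕ) * n) :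
    Mtilde k p M n ⟶ (Scheme.Modules.pushforward (iota k p)).obj
      (twist (homogeneousSubmodule (Fin 2) k) (piGrading (homogeneousSubmodule (Fin 2) k) J) n') :=
  ProjDeg.semiTwistMap (iotaDegHom k p) (coordMap p c) (coordMap_mem c) hn

instance {n n' : ℤ} (hn : n' = (2 : ℕ) * n) : IsIso (coordTwistMap p c hn) :=
  ProjDeg.isIso_semiTwistMap (ProjDeg.isHomeomorph_comap (iotaDegHom k p)
      (iotaRingHom_injective k p) (exists_iotaRingHom_eq k p))
    (exists_iotaRingHom_eq k p) _ (coordMap_injective c) (exists_coordMap_eq c) _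

lemma IsThetaMatrix.semiStalkMap_stalkMap (hc : IsThetaMatrix c D)
    (y : ProjectiveSpectrum (homogeneousSubmodule (Fin 2) k))
    (z : StalkAt (coordGrading k p) (CoordRing k p ⊗[k] M)
      (ProjDeg.comapFun (iotaDegHom k p) y)) :
    ProjDeg.semiStalkMap (iotaDegHom k p) (coordMap p c) y
        (stalkMap (coordGrading k p) (thetaLin k p M) _ z) =
      stalkMap (homogeneousSubmodule (Fin 2) k) D y
        (ProjDeg.semiStalkMap (iotaDegHom k p) (coordMap p c) y z) := by
  induction z using LocalizedModule.induction_on with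
  | h r b =>
    rw [ProjDeg.semiStalkMap_mk, LocalizedModule.map_mk, LocalizedModule.map_mk,
      ProjDeg.semiStalkMap_mk, hc.coordMap_thetaLin]

variable (p) in
lemma IsThetaMatrix.Theta_comp_coordTwistMap (hc : IsThetaMatrix c D) :
    Theta k p M ≫ coordTwistMap p c (show (2 : ℤ) = (2 : ℕ) * 1 by simp) =
      coordTwistMap p c (show (0 : ℤ) = (2 : ℕ) * 0 by simp) ≫
        (Scheme.Modules.pushforward (iota k p)).map (twistMap D hc.mem (by simp)) := by
  refine Scheme.Modules.hom_ext _ _ fun U ↦ ?_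
  ext s
  refine Subtype.ext <| funext fun y ↦ ?_
  exact hc.semiStalkMap_stalkMap y.1 _

variable (p) in
/-- The kernel bundle of `M` splits as `⨁ 𝒪(-d i)` as soon as the kernel of the matrix of
`s ^ 2 e - t ^ 2 f + s t h` over `k[s, t]` is free on vectors `κ i` homogeneous of degree `d i`. -/
theorem IsThetaMatrix.nonempty_kerTheta_iso (hc : IsThetaMatrix c D) {I : Type} [Fintype I]
    {d : I → ℕ} {κ : I → J → MvPolynomial (Fin 2) k}
    (hκ : ∀ i j, (κ i j).IsHomogeneous (d i)) (hDκ : ∀ i, D (κ i) = 0)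
    (hli : ∀ c : I → MvPolynomial (Fin 2) k, ∑ i, c i • κ i = 0 → c = 0)
    (hspan : ∀ r : J → MvPolynomial (Fin 2) k, D r = 0 →
      ∃ c : I → MvPolynomial (Fin 2) k, ∑ i, c i • κ i = r)
    {L : (P1 k).Modules} (ι : ∀ i, O k (-(d i : ℤ)) ⟶ L)
    (π : ∀ i, L ⟶ O k (-(d i : ℤ))) (hL : ∑ i, π i ≫ ι i = 𝟙 L)
    (h1 : ∀ i, ι i ≫ π i = 𝟙 _) (h0 : ∀ i i', i ≠ i' → ι i ≫ π i' = 0) :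
    Nonempty (kerTheta k p M ≅ L) := by
  obtain ⟨α⟩ := nonempty_kernel_twistMap_iso (𝒜 := homogeneousSubmodule (Fin 2) k) hκ hc.mem
    (m := 2) (by simp) hDκ hli hspan ι π hL h1 h0
  obtain ⟨β⟩ := ModulesAux.nonempty_pullback_kernel_iso (iota k p) (asIso (coordTwistMap p c _))
    (asIso (coordTwistMap p c _)) (hc.Theta_comp_coordTwistMap p)
  exact ⟨β ≪≫ α⟩

end Coordinates

end SlTwo

/-! ### The recurrences for vectors killed by the operator -/

namespace SlTwo

section Recurrence

variable {R : Type*} [CommRing R]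

/-- The coefficient of `v_j` in `(S ^ 2 e - T ^ 2 f + S T h) u`, for `u = ∑ u_j v_j` in the Weyl
module `V(n)`. -/
def weylForm (S T : R) (n : ℕ) (u : ℕ → R) (j : ℕ) : R :=
  ((n : R) - j) * S * (T * u j + S * u (j + 1)) - j * T * (T * u (j - 1) + S * u j)

/-- The value on `v_j` of `(S ^ 2 e - T ^ 2 f + S T h) φ`, for the linear form `φ` on the Weyl
module `V(n)` with values `u_j` on `v_j`. -/
def dualForm (S T : R) (n : ℕ) (u : ℕ → R) (j : ℕ) : R :=
  T * ((j + 1) * T * u (j + 1) - ((n : R) - j) * S * u j) +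
    if j = 0 then 0 else S * (j * T * u j - ((n : R) - (j - 1 : ℕ)) * S * u (j - 1))

/-- The coordinates of the vector of `V(n)`, killed by the operator, for which all the combinations
`T u_j + S u_{j + 1}` vanish. -/
def weylVec (S T : R) (n j : ℕ) : R := (-1) ^ j * T ^ j * S ^ (n - j)

/-- The coordinates of the vector killed by the operator which is supported in one block of `p`
consecutive basis vectors. -/
def weylBlock (p : ℕ) (S T : R) (a q : ℕ) : R :=
  (-1) ^ (q + a + 1) * (q.choose (a + 1) : R) * T ^ (q - (a + 1)) * S ^ (p - 1 - q)

/-- The combinations `T u_q + S u_{q + 1}` for the vector `weylBlock`. -/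
def weylBlockDiff (p : ℕ) (S T : R) (a q : ℕ) : R :=
  (-1) ^ (q + a) * (q.choose a : R) * T ^ (q - a) * S ^ (p - 1 - q)

/-- The values on one block of basis vectors of a linear form killed by the operator: the
coefficients of the `a`-th power of `S X + T`. -/
def dualBlock (S T : R) (a q : ℕ) : R := (a.choose q : R) * S ^ q * T ^ (a - q)

section Chain

variable [IsDomain R] {S T : R}

lemma pow_dvd_of_pow_dvd_mul (hT : T ≠ 0) (hST : ∀ x, T ∣ S * x → T ∣ x) (N : ℕ) (x : R)
    (h : T ^ N ∣ S * x) : T ^ N ∣ x := by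
  induction N generalizing x with
  | zero => simp
  | succ N ih =>
    obtain ⟨y, rfl⟩ := hST x ((dvd_pow_self T N.succ_ne_zero).trans h)
    rw [pow_succ', mul_left_comm] at h
    rw [pow_succ']
    exact mul_dvd_mul_left T (ih y ((mul_dvd_mul_iff_left hT).1 h))

/-- A sequence with ratio `T / S`, for `S`, `T` without common factors, is a multiple of
`S ^ N, S ^ (N - 1) T, …, T ^ N`. -/
lemma exists_eq_of_chain (hT : T ≠ 0) (hST : ∀ x, T ∣ S * x → T ∣ x) (N : ℕ) (x : ℕ → R)
    (hx : ∀ m < N, S * x (m + 1) = T * x m) : ∃ b, ∀ m ≤ N, x m = T ^ m * S ^ (N - m) * b := by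
  induction N with
  | zero => exact ⟨x 0, fun m hm ↦ by obtain rfl : m = 0 := by omega
                                      simp⟩
  | succ N ih =>
    obtain ⟨b, hb⟩ := ih fun m hm ↦ hx m (by omega)
    have h1 := hx N (by omega)
    rw [hb N le_rfl, Nat.sub_self, pow_zero, mul_one, ← mul_assoc, ← pow_succ'] at h1
    obtain ⟨b', hb'⟩ := pow_dvd_of_pow_dvd_mul hT hST (N + 1) (x (N + 1)) ⟨b, h1⟩
    have h2 : S * b' = b := by
      rw [hb', mul_left_comm] at h1
      exact mul_left_cancel₀ (pow_ne_zero _ hT) h1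
    refine ⟨b', fun m hm ↦ ?_⟩
    rcases hm.lt_or_eq with hm | rfl
    · rw [hb m (by omega), ← h2, show N + 1 - m = N - m + 1 by omega]
      ring
    · rw [hb', Nat.sub_self]
      ring

end Chain

variable (p : ℕ) [Fact p.Prime] [CharP R p]

lemma exists_mul_natCast_eq_one {m : ℕ} (hm : ¬ p ∣ m) : ∃ c : R, c * (m : R) = 1 := by
  have h1 := Nat.isCoprime_iff_coprime.2 (((Fact.out : p.Prime).coprime_iff_not_dvd).2 hm)
  obtain ⟨x, y, h⟩ := h1
  refine ⟨y, ?_⟩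
  have h2 := congr_arg (Int.cast : ℤ → R) h
  push_cast at h2
  rw [← h2, CharP.cast_eq_zero R p]
  ring

lemma natCast_ne_zero_of_lt [Nontrivial R] {m : ℕ} (h0 : 0 < m) (hm : m < p) : (m : R) ≠ 0 := by
  rw [Ne, CharP.cast_eq_zero_iff R p]
  exact fun h ↦ absurd (Nat.le_of_dvd h0 h) (by omega)

lemma not_dvd_choose {m q : ℕ} (hq : q ≤ m) (hm : m < p) : ¬ p ∣ m.choose q := fun h ↦ by
  have h1 := (Fact.out : p.Prime).dvd_factorial.1
    (h.trans ⟨q.factorial * (m - q).factorial, by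
      rw [← Nat.choose_mul_factorial_mul_factorial hq, mul_assoc]⟩)
  omega

lemma natCast_eq_mod (j : ℕ) : (j : R) = (j % p : ℕ) := by
  conv_lhs => rw [← Nat.div_add_mod j p]
  rw [Nat.cast_add, Nat.cast_mul, CharP.cast_eq_zero R p, zero_mul, zero_add]

variable {p}

/-- The combinations `T u_q + S u_{q + 1}` for the vector `weylBlock`. At the end of the block, where
the next coordinate is zero, the formula persists because `p` divides `p.choose (a + 1)`. -/
lemma weylBlock_diff {S T : R} {a q : ℕ} (hq : q < p) (hqa : q + 1 = p → a + 1 < p) :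
    T * weylBlock p S T a q + (if q + 1 = p then 0 else S * weylBlock p S T a (q + 1)) =
      weylBlockDiff p S T a q := by
  have h1 : (if q + 1 = p then 0 else S * weylBlock p S T a (q + 1)) =
      (-1) ^ (q + a) * ((q + 1).choose (a + 1) : R) * T ^ (q - a) * S ^ (p - 1 - q) := by
    split_ifs with h
    · have h2 : (((q + 1).choose (a + 1) : ℕ) : R) = 0 := by
        rw [CharP.cast_eq_zero_iff R p, h]
        exact (Fact.out : p.Prime).dvd_choose_self (by omega) (hqa h)
      rw [h2]
      ring
    · rw [weylBlock, show q + 1 - (a + 1) = q - a by omega,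
        show p - 1 - q = p - 1 - (q + 1) + 1 by omega]
      ring
  rw [h1, weylBlock, weylBlockDiff, Nat.choose_succ_succ' q a]
  rcases lt_or_ge a q with h | h
  · rw [show q - a = q - (a + 1) + 1 by omega]
    push_cast
    ring
  · rw [Nat.choose_eq_zero_of_lt (show q < a + 1 by omega)]
    push_cast
    ring

lemma div_mod_succ {j : ℕ} (h : j % p + 1 ≠ p) : (j + 1) / p = j / p ∧ (j + 1) % p = j % p + 1 := by
  have hp := (Fact.out : p.Prime).pos
  have h1 := Nat.mod_lt j hp
  have h2 := Nat.mod_add_div j p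
  exact (Nat.div_mod_unique hp).2 ⟨by omega, by omega⟩

lemma div_mod_succ_of_eq {j : ℕ} (h : j % p + 1 = p) :
    (j + 1) / p = j / p + 1 ∧ (j + 1) % p = 0 := by
  have hp := (Fact.out : p.Prime).pos
  have h2 := Nat.mod_add_div j p
  exact (Nat.div_mod_unique hp).2 ⟨by rw [mul_add, mul_one]; omega, hp⟩

lemma weylBlock_diff_apply {S T : R} {a : ℕ} (bb : ℕ → R) (j : ℕ)
    (hj : j % p + 1 = p → a + 1 < p) :
    T * (bb (j / p) * weylBlock p S T a (j % p)) +
        S * (bb ((j + 1) / p) * weylBlock p S T a ((j + 1) % p)) =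
      bb (j / p) * weylBlockDiff p S T a (j % p) := by
  rw [← weylBlock_diff (Nat.mod_lt j (Fact.out : p.Prime).pos) hj]
  by_cases h : j % p + 1 = p
  · rw [(div_mod_succ_of_eq h).1, (div_mod_succ_of_eq h).2, if_pos h]
    simp [weylBlock]
    ring
  · rw [(div_mod_succ h).1, (div_mod_succ h).2, if_neg h]
    ring

variable [IsDomain R] {S T : R} {n r a : ℕ}

lemma mod_add_one_eq_imp (hn : n = r * p + a) (ha : a < p) (hr : r = 0 ∨ a + 1 < p) {j : ℕ}
    (hj : j < n) (h : j % p + 1 = p) : a + 1 < p := by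
  rcases hr with rfl | hr
  · rw [zero_mul] at hn
    have := Nat.mod_le j p
    omega
  · exact hr

lemma weylForm_eq_zero_of_diff (hn : n = r * p + a) (ha : a < p) (u bb : ℕ → R)
    (hu : ∀ j < n, T * u j + S * u (j + 1) = bb (j / p) * weylBlockDiff p S T a (j % p))
    (j : ℕ) (hj : j ≤ n) : weylForm S T n u j = 0 := by
  have hp := (Fact.out : p.Prime).pos
  have hna : (n : R) = a := by rw [natCast_eq_mod p n, hn, Nat.mul_add_mod', Nat.mod_eq_of_lt ha]
  have key : ((n : R) - j) * S * (T * u j + S * u (j + 1)) =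
      ((n : R) - j) * S * (bb (j / p) * weylBlockDiff p S T a (j % p)) := by
    rcases hj.lt_or_eq with hj | rfl
    · rw [hu j hj]
    · simp
  rw [weylForm, key, hna, natCast_eq_mod p j]
  rcases j with _ | j
  · rcases a with _ | a <;> simp [weylBlockDiff]
  rw [Nat.add_sub_cancel, hu j (by omega)]
  by_cases h : j % p + 1 = p
  · rw [(div_mod_succ_of_eq h).1, (div_mod_succ_of_eq h).2]
    rcases a with _ | a <;> simp [weylBlockDiff]
  rw [(div_mod_succ h).1, (div_mod_succ h).2, weylBlockDiff, weylBlockDiff]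
  generalize hq : j % p = q at h
  have hqp : q < p := hq ▸ Nat.mod_lt j hp
  rcases lt_or_ge q a with h1 | h1
  · rw [Nat.choose_eq_zero_of_lt h1]
    rcases (Nat.succ_le_of_lt h1).eq_or_lt with h2 | h2
    · rw [← h2]; simp
    · rw [Nat.choose_eq_zero_of_lt h2]; simp
  have h3 : ((q + 1).choose a : R) * ((q : R) + 1 - a) = (q.choose a : R) * (q + 1) := by
    have h4 := Nat.choose_mul_succ_eq q a
    have h5 : ((q + 1 - a : ℕ) : R) = (q : R) + 1 - a := by
      rw [Nat.cast_sub (by omega)]; push_cast; ring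
    rw [← h5]
    have h6 := congr_arg (Nat.cast : ℕ → R) h4
    rw [Nat.cast_mul, Nat.cast_mul] at h6
    rw [← h6, Nat.cast_succ]
  rw [show q + 1 - a = q - a + 1 by omega, show p - 1 - q = p - 1 - (q + 1) + 1 by omega]
  push_cast
  linear_combination
    ((-1) ^ (q + a) * T ^ (q - a + 1) * S ^ (p - 1 - (q + 1) + 1) * bb (j / p)) * h3

lemma weylForm_eq_zero (hn : n = r * p + a) (ha : a < p) (hr : r = 0 ∨ a + 1 < p) (u bb : ℕ → R)
    (b : R) (hu : ∀ j ≤ n, u j = b * weylVec S T n j + bb (j / p) * weylBlock p S T a (j % p))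
    (j : ℕ) (hj : j ≤ n) : weylForm S T n u j = 0 := by
  refine weylForm_eq_zero_of_diff hn ha u bb (fun j hj ↦ ?_) j hj
  rw [hu j hj.le, hu (j + 1) hj,
    ← weylBlock_diff_apply bb j (mod_add_one_eq_imp hn ha hr hj), weylVec, weylVec,
    show n - j = n - (j + 1) + 1 by omega]
  ring

/-- For a vector killed by the operator, the combinations `T u_j + S u_{j + 1}` at the first `a`
places of each block vanish: the recurrence starts with zero there, since `p i = 0`, and its leading
coefficient `n - j` does not vanish. -/
lemma diff_eq_zero_of_weylForm (hS : S ≠ 0) (hn : n = r * p + a) (ha : a < p) (u : ℕ → R) (i : ℕ)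
    {m : ℕ} (hu : ∀ m' ≤ m, weylForm S T n u (p * i + m') = 0) (hm : m < a) :
    T * u (p * i + m) + S * u (p * i + m + 1) = 0 := by
  have hna : (n : R) = a := by rw [natCast_eq_mod p n, hn, Nat.mul_add_mod', Nat.mod_eq_of_lt ha]
  have cast (q : ℕ) : ((p * i + q : ℕ) : R) = q := by
    rw [Nat.cast_add, Nat.cast_mul, CharP.cast_eq_zero R p, zero_mul, zero_add]
  have ne (q : ℕ) (hq : q < a) : ((a : R) - q) ≠ 0 := by
    rw [← Nat.cast_sub hq.le]
    exact natCast_ne_zero_of_lt p (by omega) (by omega)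
  induction m with
  | zero =>
    have h1 := hu 0 le_rfl
    rw [weylForm, hna, cast, Nat.cast_zero, zero_mul, zero_mul, sub_zero] at h1
    refine (mul_eq_zero.1 h1).resolve_left (mul_ne_zero ?_ hS)
    simpa using ne 0 hm
  | succ m ih =>
    have h1 := hu (m + 1) le_rfl
    have h2 := ih (fun m' hm' ↦ hu m' (by omega)) (by omega)
    rw [weylForm, hna, cast, show p * i + (m + 1) - 1 = p * i + m by omega, ← add_assoc, h2,
      mul_zero, sub_zero] at h1
    exact (mul_eq_zero.1 h1).resolve_left (mul_ne_zero (ne (m + 1) hm) hS)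

/-- For a vector killed by the operator, the combinations `T u_j + S u_{j + 1}` in each complete
block are a multiple of `weylBlockDiff`. After division by the binomial coefficients, which are
invertible because `j % p < p`, the recurrence at the places `a, …, p - 1` of the block becomes that
of a sequence with ratio `T / S`. -/
lemma exists_diff_of_weylForm (hS : S ≠ 0) (hT : T ≠ 0) (hST : ∀ x, T ∣ S * x → T ∣ x)
    (hn : n = r * p + a) (ha : a < p) (u : ℕ → R) (hu : ∀ j ≤ n, weylForm S T n u j = 0) :
    ∃ bb : ℕ → R, ∀ j < n,
      T * u j + S * u (j + 1) = bb (j / p) * weylBlockDiff p S T a (j % p) := by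
  have hna : (n : R) = a := by rw [natCast_eq_mod p n, hn, Nat.mul_add_mod', Nat.mod_eq_of_lt ha]
  have block (i : ℕ) : ∃ b : R, i < r → ∀ m ≤ p - 1 - a,
      T * u (p * i + a + m) + S * u (p * i + a + m + 1) =
        b * weylBlockDiff p S T a (a + m) := by
    by_cases hi : i < r
    swap
    · exact ⟨0, fun h ↦ absurd h hi⟩
    have hir : p * i + p ≤ r * p := by nlinarith
    choose! inv hinv using fun m (hm : m ≤ p - 1 - a) ↦ exists_mul_natCast_eq_one (R := R) p
      (not_dvd_choose p (show a ≤ a + m by omega) (by omega))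
    obtain ⟨x, hx⟩ : ∃ x : ℕ → R, ∀ m ≤ p - 1 - a,
        T * u (p * i + a + m) + S * u (p * i + a + m + 1) =
          (-1) ^ m * ((a + m).choose a : R) * x m := by
      refine ⟨fun m ↦ (-1) ^ m * inv m * (T * u (p * i + a + m) + S * u (p * i + a + m + 1)),
        fun m hm ↦ ?_⟩
      have h2 : ((-1 : R) ^ m) * (-1) ^ m = 1 := by rw [← mul_pow]; simp
      linear_combination (-(T * u (p * i + a + m) + S * u (p * i + a + m + 1))) *
        (inv m * ((a + m).choose a : R) * h2 + hinv m hm)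
    obtain ⟨b, hb⟩ := exists_eq_of_chain hT hST (p - 1 - a) x (fun m hm ↦ by
      have h1 := hu (p * i + a + (m + 1)) (by rw [hn]; omega)
      have cast : ((p * i + a + (m + 1) : ℕ) : R) = a + (m + 1) := by
        push_cast
        rw [CharP.cast_eq_zero R p]
        ring
      rw [weylForm, show p * i + a + (m + 1) - 1 = p * i + a + m by omega,
        show p * i + a + (m + 1) = p * i + a + m + 1 by omega] at h1
      rw [hna, show ((p * i + a + m + 1 : ℕ) : R) = a + (m + 1) from cast,
        hx m (by omega)] at h1
      rw [show p * i + a + m + 1 = p * i + a + (m + 1) by omega, hx (m + 1) (by omega)] at h1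
      have h3 : ((a + m + 1).choose a : R) * ((m : R) + 1) =
          ((a + m).choose a : R) * (a + m + 1) := by
        have h4 := Nat.choose_mul_succ_eq (a + m) a
        rw [show a + m + 1 - a = m + 1 by omega] at h4
        have h6 := congr_arg (Nat.cast : ℕ → R) h4
        push_cast at h6
        exact h6.symm
      have hne : ((m + 1 : ℕ) : R) * ((a + (m + 1)).choose a : R) ≠ 0 :=
        mul_ne_zero (natCast_ne_zero_of_lt p (by omega) (by omega))
          fun h ↦ not_dvd_choose p (show a ≤ a + (m + 1) by omega) (by omega)
            ((CharP.cast_eq_zero_iff R p _).1 h)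
      have hs : ((-1 : R) ^ m) * (-1) ^ m = 1 := by rw [← mul_pow]; simp
      refine mul_left_cancel₀ hne ?_
      rw [pow_succ, ← Nat.add_assoc a m 1] at h1
      rw [← Nat.add_assoc a m 1]
      push_cast
      linear_combination (-1) ^ m * h1 - T * x m * h3 -
        (((m : R) + 1) * S * ((a + m + 1).choose a : R) * x (m + 1) -
          ((a : R) + m + 1) * T * ((a + m).choose a : R) * x m) * hs)
    refine ⟨b, fun _ m hm ↦ ?_⟩
    have hs : (-1 : R) ^ (a + m + a) = (-1) ^ m := by
      rw [show a + m + a = m + 2 * a by ring, pow_add, pow_mul]; simp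
    rw [hx m hm, hb m hm, weylBlockDiff, hs, show a + m - a = m by omega,
      show p - 1 - (a + m) = p - 1 - a - m by omega]
    ring
  choose bb hbb using block
  refine ⟨bb, fun j hj ↦ ?_⟩
  have hp := (Fact.out : p.Prime).pos
  have hjm := Nat.mod_lt j hp
  have hjd := Nat.div_add_mod j p
  rcases lt_or_ge (j % p) a with h | h
  · rw [weylBlockDiff, Nat.choose_eq_zero_of_lt h, Nat.cast_zero, mul_zero, zero_mul, zero_mul,
      mul_zero]
    have h1 := diff_eq_zero_of_weylForm hS hn ha u (j / p) (m := j % p)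
      (fun m' hm' ↦ hu _ (by omega)) h
    rwa [hjd] at h1
  · have hi : j / p < r := by
      rw [Nat.div_lt_iff_lt_mul hp]
      by_contra! h1
      have h2 : j / p = r := by
        refine le_antisymm ?_ ((Nat.le_div_iff_mul_le hp).2 h1)
        rw [← Nat.lt_succ_iff, Nat.div_lt_iff_lt_mul hp, Nat.succ_mul]
        omega
      rw [h2, mul_comm] at hjd
      omega
    have h1 := hbb (j / p) hi (j % p - a) (by omega)
    rwa [show p * (j / p) + a + (j % p - a) = j by omega,
      show a + (j % p - a) = j % p by omega] at h1

/-- The vectors of `V(n)` killed by the operator. -/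
lemma exists_eq_of_weylForm (hS : S ≠ 0) (hT : T ≠ 0) (hST : ∀ x, T ∣ S * x → T ∣ x)
    (hn : n = r * p + a) (ha : a < p) (hr : r = 0 ∨ a + 1 < p) (u : ℕ → R)
    (hu : ∀ j ≤ n, weylForm S T n u j = 0) : ∃ (b : R) (bb : ℕ → R), ∀ j ≤ n,
      u j = b * weylVec S T n j + bb (j / p) * weylBlock p S T a (j % p) := by
  obtain ⟨bb, hbb⟩ := exists_diff_of_weylForm hS hT hST hn ha u hu
  obtain ⟨b, hb⟩ := exists_eq_of_chain hT hST n
    (fun j ↦ (-1) ^ j * (u j - bb (j / p) * weylBlock p S T a (j % p))) (fun j hj ↦ by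
      have h1 := hbb j hj
      rw [← weylBlock_diff_apply bb j (mod_add_one_eq_imp hn ha hr hj)] at h1
      linear_combination (-1) ^ (j + 1) * h1)
  refine ⟨b, bb, fun j hj ↦ ?_⟩
  have h1 := hb j hj
  have hs : ((-1 : R) ^ j) * (-1) ^ j = 1 := by rw [← mul_pow]; simp
  rw [weylVec]
  linear_combination (-1) ^ j * h1 - (u j - bb (j / p) * weylBlock p S T a (j % p)) * hs

/-- The coefficients in `exists_eq_of_weylForm` are determined by the vector. -/
lemma weyl_coeff_eq_zero (hS : S ≠ 0) (hn : n = r * p + a) (ha : a < p) (hr : r = 0 ∨ a + 1 < p)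
    (b : R) (bb : ℕ → R)
    (h : ∀ j ≤ n, b * weylVec S T n j + bb (j / p) * weylBlock p S T a (j % p) = 0) :
    b = 0 ∧ ∀ i < r, bb i = 0 := by
  have hp := (Fact.out : p.Prime).pos
  have hb : b = 0 := by
    have h1 := h 0 (Nat.zero_le n)
    simp only [weylVec, weylBlock, pow_zero, Nat.zero_mod, Nat.choose_zero_succ, Nat.cast_zero,
      mul_zero, zero_mul, add_zero, mul_one, one_mul, Nat.sub_zero] at h1
    exact (mul_eq_zero.1 h1).resolve_right (pow_ne_zero _ hS)
  refine ⟨hb, fun i hi ↦ ?_⟩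
  have ha' : a + 1 < p := hr.resolve_left (by omega)
  have h1 := h (p * i + (a + 1)) (by
    rw [hn]
    have : p * i + p ≤ r * p := by nlinarith
    omega)
  rw [hb, zero_mul, zero_add, Nat.mul_add_mod, Nat.mod_eq_of_lt ha', Nat.mul_add_div hp,
    Nat.div_eq_of_lt ha', add_zero, weylBlock] at h1
  refine (mul_eq_zero.1 h1).resolve_right ?_
  simp [hS]

end Recurrence

end SlTwo

namespace SlTwo

section DualRecurrence

variable {R : Type*} [CommRing R] {p : ℕ} [Fact p.Prime] [CharP R p] {S T : R} {n r a : ℕ}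

lemma dualForm_eq_zero_of_recurrence (u : ℕ → R)
    (hu : ∀ j ≤ n, ((j : R) + 1) * T * u (j + 1) = ((n : R) - j) * S * u j) (j : ℕ) (hj : j ≤ n) :
    dualForm S T n u j = 0 := by
  rw [dualForm, hu j hj, sub_self, mul_zero, zero_add]
  rcases j with _ | j
  · simp
  · have h1 := hu j (by omega)
    rw [if_neg j.succ_ne_zero, Nat.add_sub_cancel, Nat.cast_succ, h1, sub_self, mul_zero]

lemma dualForm_eq_zero_of_block (hn : n = r * p + a) (ha : a < p) (u bb : ℕ → R)
    (hu : ∀ j ≤ n, u j = bb (j / p) * dualBlock S T a (j % p)) (hu' : u (n + 1) = 0) (j : ℕ)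
    (hj : j ≤ n) : dualForm S T n u j = 0 := by
  have hp := (Fact.out : p.Prime).pos
  have hna : (n : R) = a := by rw [natCast_eq_mod p n, hn, Nat.mul_add_mod', Nat.mod_eq_of_lt ha]
  refine dualForm_eq_zero_of_recurrence u (fun j hj ↦ ?_) j hj
  rcases hj.lt_or_eq with hj | rfl
  swap
  · rw [hu']
    ring
  rw [hu j hj.le, hu (j + 1) hj, ← Nat.cast_succ, natCast_eq_mod p (j + 1), hna, natCast_eq_mod p j]
  by_cases h : j % p + 1 = p
  · rw [(div_mod_succ_of_eq h).2, dualBlock, dualBlock]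
    rcases lt_or_ge a (j % p) with h1 | h1
    · rw [Nat.choose_eq_zero_of_lt h1]
      simp
    · rw [show j % p = a by omega]
      simp
  rw [(div_mod_succ h).1, (div_mod_succ h).2, dualBlock, dualBlock]
  generalize j % p = m at h
  have h3 : (a.choose (m + 1) : R) * (m + 1) = a.choose m * ((a : R) - m) := by
    rcases le_or_gt m a with h1 | h1
    · have h4 := congr_arg (Nat.cast : ℕ → R) (Nat.choose_succ_right_eq a m)
      push_cast [Nat.cast_sub h1] at h4
      exact h4
    · rw [Nat.choose_eq_zero_of_lt h1, Nat.choose_eq_zero_of_lt (by omega)]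
      simp
  rcases lt_or_ge m a with h1 | h1
  · rw [show a - m = a - (m + 1) + 1 by omega]
    push_cast
    linear_combination (bb (j / p) * S ^ (m + 1) * T ^ (a - (m + 1) + 1)) * h3
  · rw [Nat.choose_eq_zero_of_lt (show a < m + 1 by omega)] at h3 ⊢
    push_cast at h3 ⊢
    linear_combination (bb (j / p) * S ^ (m + 1) * T ^ (a - m)) * h3

variable [IsDomain R]

/-- The two parts of the operator on the dual of `V(n)` vanish separately, by induction on `j`. -/
lemma recurrence_of_dualForm (hT : T ≠ 0) (u : ℕ → R) (hu : ∀ j ≤ n, dualForm S T n u j = 0) (j : ℕ)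
    (hj : j ≤ n) : ((j : R) + 1) * T * u (j + 1) = ((n : R) - j) * S * u j := by
  induction j with
  | zero =>
    have h1 := hu 0 hj
    rw [dualForm, if_pos rfl, add_zero] at h1
    exact sub_eq_zero.1 ((mul_eq_zero.1 h1).resolve_left hT)
  | succ j ih =>
    have h1 := hu (j + 1) hj
    rw [dualForm, if_neg j.succ_ne_zero, Nat.add_sub_cancel, Nat.cast_succ, ih (by omega), sub_self,
      mul_zero, add_zero] at h1
    rw [Nat.cast_succ]
    exact sub_eq_zero.1 ((mul_eq_zero.1 h1).resolve_left hT)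

/-- The linear forms on `V(n)` killed by the operator. -/
lemma exists_eq_of_dualForm (hS : S ≠ 0) (hT : T ≠ 0) (hST : ∀ x, S ∣ T * x → S ∣ x)
    (hn : n = r * p + a) (ha : a < p) (u : ℕ → R) (hu : ∀ j ≤ n, dualForm S T n u j = 0) :
    ∃ bb : ℕ → R, ∀ j ≤ n, u j = bb (j / p) * dualBlock S T a (j % p) := by
  have hp := (Fact.out : p.Prime).pos
  have hna : (n : R) = a := by rw [natCast_eq_mod p n, hn, Nat.mul_add_mod', Nat.mod_eq_of_lt ha]
  have step (i m : ℕ) (him : p * i + m ≤ n) :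
      ((m : R) + 1) * T * u (p * i + m + 1) = ((a : R) - m) * S * u (p * i + m) := by
    have h1 := recurrence_of_dualForm hT u hu _ him
    rw [hna] at h1
    push_cast at h1
    rwa [CharP.cast_eq_zero R p, zero_mul, zero_add] at h1
  have block (i : ℕ) : ∃ b : R, ∀ m < p, p * i + m ≤ n → u (p * i + m) = b * dualBlock S T a m := by
    by_cases hi : i ≤ r
    swap
    · refine ⟨0, fun m _ h ↦ ?_⟩
      have : r * p + p ≤ p * i := by
        rw [mul_comm p, ← Nat.succ_mul]
        exact Nat.mul_le_mul_right p (by omega)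
      omega
    have hir : p * i ≤ r * p := by rw [mul_comm p]; exact Nat.mul_le_mul_right p hi
    choose! inv hinv using fun m (hm : m ≤ a) ↦ exists_mul_natCast_eq_one (R := R) p
      (not_dvd_choose p hm ha)
    obtain ⟨x, hx⟩ : ∃ x : ℕ → R, ∀ m ≤ a, u (p * i + m) = (a.choose m : R) * x m :=
      ⟨fun m ↦ inv m * u (p * i + m), fun m hm ↦ by
        linear_combination (-u (p * i + m)) * hinv m hm⟩
    obtain ⟨b, hb⟩ := exists_eq_of_chain hS hST a x (fun m hm ↦ by
      have h1 := step i m (by omega)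
      rw [show p * i + m + 1 = p * i + (m + 1) by omega, hx m (by omega), hx (m + 1) hm] at h1
      have h3 : (a.choose (m + 1) : R) * (m + 1) = a.choose m * ((a : R) - m) := by
        have h4 := congr_arg (Nat.cast : ℕ → R) (Nat.choose_succ_right_eq a m)
        push_cast [Nat.cast_sub hm.le] at h4
        exact h4
      have hne : ((m + 1 : ℕ) : R) * (a.choose (m + 1) : R) ≠ 0 :=
        mul_ne_zero (natCast_ne_zero_of_lt p (by omega) (by omega))
          fun h ↦ not_dvd_choose p (show m + 1 ≤ a by omega) ha
            ((CharP.cast_eq_zero_iff R p _).1 h)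
      refine mul_left_cancel₀ hne ?_
      push_cast
      linear_combination h1 - S * x m * h3)
    refine ⟨b, fun m hm hmn ↦ ?_⟩
    rcases le_or_gt m a with h | h
    · rw [hx m h, hb m h, dualBlock]
      ring
    · rw [dualBlock, Nat.choose_eq_zero_of_lt h, Nat.cast_zero, zero_mul, zero_mul, mul_zero]
      -- past the end of the string of length `a + 1` the recurrence has vanishing right-hand side
      induction m with
      | zero => omega
      | succ m ih =>
        have h1 := step i m (by omega)
        have h2 : ((a : R) - m) * u (p * i + m) = 0 := by
          rcases Nat.lt_succ_iff.1 h |>.eq_or_lt with h | h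
          · rw [h, sub_self, zero_mul]
          · rw [ih (by omega) (by omega) h, mul_zero]
        rw [mul_right_comm _ S, h2, zero_mul] at h1
        refine (mul_eq_zero.1 h1).resolve_left (mul_ne_zero ?_ hT)
        exact_mod_cast natCast_ne_zero_of_lt (R := R) p (Nat.succ_pos m) hm
  choose bb hbb using block
  refine ⟨bb, fun j hj ↦ ?_⟩
  have hjd := Nat.div_add_mod j p
  have h1 := hbb (j / p) (j % p) (Nat.mod_lt j hp) (by omega)
  rwa [hjd] at h1

/-- The coefficients in `exists_eq_of_dualForm` are determined by the linear form. -/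
lemma dual_coeff_eq_zero (hT : T ≠ 0) (hn : n = r * p + a) (bb : ℕ → R)
    (h : ∀ j ≤ n, bb (j / p) * dualBlock S T a (j % p) = 0) (i : ℕ) (hi : i ≤ r) : bb i = 0 := by
  have hp := (Fact.out : p.Prime).pos
  have h1 := h (p * i) (by
    have : p * i ≤ r * p := by rw [mul_comm p]; exact Nat.mul_le_mul_right p hi
    omega)
  rw [Nat.mul_mod_right, Nat.mul_div_cancel_left _ hp, dualBlock] at h1
  refine (mul_eq_zero.1 h1).resolve_right ?_
  simp [hT]

end DualRecurrence

end SlTwo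

/-! ### Bases of the vectors killed by the operator -/

namespace SlTwo

section Extension

variable {R : Type*} [CommRing R] {N : ℕ}

/-- The extension by zero of a finite sequence. -/
def zext (u : Fin N → R) (j : ℕ) : R := if h : j < N then u ⟨j, h⟩ else 0

lemma zext_val (u : Fin N → R) (j : Fin N) : zext u j = u j := dif_pos j.2

lemma zext_of_lt (u : Fin N → R) {j : ℕ} (h : j < N) : zext u j = u ⟨j, h⟩ := dif_pos h

lemma zext_of_le (u : Fin N → R) {j : ℕ} (h : N ≤ j) : zext u j = 0 := dif_neg (by omega)

lemma zext_zero (j : ℕ) : zext (0 : Fin N → R) j = 0 := by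
  unfold zext
  split_ifs <;> rfl

lemma zext_add (u u' : Fin N → R) (j : ℕ) : zext (u + u') j = zext u j + zext u' j := by
  unfold zext
  split_ifs <;> simp

lemma zext_smul (r : R) (u : Fin N → R) (j : ℕ) : zext (r • u) j = r * zext u j := by
  unfold zext
  split_ifs <;> simp

lemma map_zext {R' : Type*} [CommRing R'] (φ : R →+* R') (u : Fin N → R) (j : ℕ) :
    zext (fun i ↦ φ (u i)) j = φ (zext u j) := by
  unfold zext
  split_ifs <;> simp

lemma sum_mul_ite_eq_zext (c : Fin N → R) (q : ℕ) (x : R) :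
    ∑ i, c i * (if q = i then x else 0) = zext c q * x := by
  unfold zext
  split_ifs with h
  · rw [Finset.sum_eq_single ⟨q, h⟩]
    · simp
    · intro i _ hi
      rw [if_neg fun h ↦ hi (Fin.ext h.symm), mul_zero]
    · simp
  · rw [zero_mul]
    refine Finset.sum_eq_zero fun i _ ↦ ?_
    rw [if_neg (by omega), mul_zero]

end Extension

section Bases

variable {R : Type*} [CommRing R]

/-- A basis of the vectors of `V(n)`, `n = r p + a`, killed by the operator. -/
def weylKer (p : ℕ) (S T : R) (n a : ℕ) {r : ℕ} : Option (Fin r) → ℕ → R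
  | none, j => weylVec S T n j
  | some i, j => if j / p = i then weylBlock p S T a (j % p) else 0

/-- A basis of the linear forms on `V(n)`, `n = r p + a`, killed by the operator. -/
def dualKer (p : ℕ) (S T : R) (a : ℕ) {r : ℕ} (i : Fin (r + 1)) (j : ℕ) : R :=
  if j / p = i then dualBlock S T a (j % p) else 0

lemma sum_weylKer (p : ℕ) (S T : R) (n a : ℕ) {r : ℕ} (c : Option (Fin r) → R) (j : ℕ) :
    ∑ i, c i * weylKer p S T n a i j = c none * weylVec S T n j +
      zext (fun i ↦ c (some i)) (j / p) * weylBlock p S T a (j % p) := by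
  rw [Fintype.sum_option, ← sum_mul_ite_eq_zext]
  rfl

variable {p : ℕ} [Fact p.Prime] [CharP R p] [IsDomain R] {S T : R} {n r a : ℕ}

lemma weylForm_weylKer (hn : n = r * p + a) (ha : a < p) (hr : r = 0 ∨ a + 1 < p)
    (i : Option (Fin r)) (u : ℕ → R) (hu : ∀ j ≤ n, u j = weylKer p S T n a i j) (j : ℕ)
    (hj : j ≤ n) : weylForm S T n u j = 0 := by
  rcases i with _ | i
  · exact weylForm_eq_zero hn ha hr u 0 1 (fun j hj ↦ by rw [hu j hj]; simp [weylKer]) j hj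
  · exact weylForm_eq_zero hn ha hr u (fun q ↦ if q = i then 1 else 0) 0
      (fun j hj ↦ by rw [hu j hj]; simp [weylKer]) j hj

lemma weylKer_linearIndependent (hS : S ≠ 0) (hn : n = r * p + a) (ha : a < p)
    (hr : r = 0 ∨ a + 1 < p) (c : Option (Fin r) → R)
    (h : ∀ j ≤ n, ∑ i, c i * weylKer p S T n a i j = 0) : c = 0 := by
  obtain ⟨h1, h2⟩ := weyl_coeff_eq_zero hS hn ha hr _ _
    (fun j hj ↦ (sum_weylKer p S T n a c j).symm.trans (h j hj))
  funext i
  rcases i with _ | i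
  · exact h1
  · rw [← zext_val (fun i ↦ c (some i)) i, h2 i i.2]
    rfl

lemma exists_sum_weylKer_eq (hS : S ≠ 0) (hT : T ≠ 0) (hST : ∀ x, T ∣ S * x → T ∣ x)
    (hn : n = r * p + a) (ha : a < p) (hr : r = 0 ∨ a + 1 < p) (u : ℕ → R)
    (hu : ∀ j ≤ n, weylForm S T n u j = 0) :
    ∃ c : Option (Fin r) → R, ∀ j ≤ n, ∑ i, c i * weylKer p S T n a i j = u j := by
  obtain ⟨b, bb, h⟩ := exists_eq_of_weylForm hS hT hST hn ha hr u hu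
  refine ⟨fun i ↦ i.elim b fun i ↦ bb i, fun j hj ↦ ?_⟩
  rw [sum_weylKer, h j hj]
  congr 1
  rcases lt_or_ge (j / p) r with h1 | h1
  · rw [zext_of_lt _ h1]
    rfl
  · have h2 : j % p < a + 1 := by
      have h3 := Nat.div_add_mod j p
      have h4 : r * p ≤ p * (j / p) := by rw [mul_comm]; exact Nat.mul_le_mul_left p h1
      omega
    rw [weylBlock, Nat.choose_eq_zero_of_lt h2]
    simp

lemma dualForm_dualKer (hn : n = r * p + a) (ha : a < p) (i : Fin (r + 1)) (u : ℕ → R)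
    (hu : ∀ j ≤ n, u j = dualKer p S T a i j) (hu' : u (n + 1) = 0) (j : ℕ) (hj : j ≤ n) :
    dualForm S T n u j = 0 :=
  dualForm_eq_zero_of_block hn ha u (fun q ↦ if q = i then 1 else 0)
    (fun j hj ↦ by rw [hu j hj]; simp [dualKer]) hu' j hj

lemma dualKer_linearIndependent (hT : T ≠ 0) (hn : n = r * p + a) (c : Fin (r + 1) → R)
    (h : ∀ j ≤ n, ∑ i, c i * dualKer p S T a i j = 0) : c = 0 := by
  funext i
  rw [← zext_val c i]
  exact dual_coeff_eq_zero hT hn _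
    (fun j hj ↦ (sum_mul_ite_eq_zext c _ _).symm.trans (h j hj)) i (by omega)

lemma exists_sum_dualKer_eq (hS : S ≠ 0) (hT : T ≠ 0) (hST : ∀ x, S ∣ T * x → S ∣ x)
    (hn : n = r * p + a) (ha : a < p) (u : ℕ → R) (hu : ∀ j ≤ n, dualForm S T n u j = 0) :
    ∃ c : Fin (r + 1) → R, ∀ j ≤ n, ∑ i, c i * dualKer p S T a i j = u j := by
  obtain ⟨bb, h⟩ := exists_eq_of_dualForm hS hT hST hn ha u hu
  refine ⟨fun i ↦ bb i, fun j hj ↦ (sum_mul_ite_eq_zext _ _ _).trans ?_⟩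
  rw [h j hj, zext_of_lt]
  rw [Nat.div_lt_iff_lt_mul (Fact.out : p.Prime).pos, Nat.succ_mul]
  omega

end Bases

section Homogeneous

open MvPolynomial

variable {k σ : Type*} [Field k] {S T : MvPolynomial σ k}

lemma isHomogeneous_natCast (m : ℕ) : (m : MvPolynomial σ k).IsHomogeneous 0 := by
  rw [← map_natCast (C : k →+* MvPolynomial σ k)]
  exact isHomogeneous_C _ _

lemma isHomogeneous_neg_one_pow (m : ℕ) : ((-1) ^ m : MvPolynomial σ k).IsHomogeneous 0 := by
  have h := isHomogeneous_C (R := k) σ ((-1) ^ m)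
  rwa [map_pow, map_neg, map_one] at h

lemma isHomogeneous_weylVec (hS : S.IsHomogeneous 1) (hT : T.IsHomogeneous 1) {n j : ℕ}
    (hj : j ≤ n) : (weylVec S T n j).IsHomogeneous n := by
  have h := ((isHomogeneous_neg_one_pow (k := k) (σ := σ) j).mul (hT.pow j)).mul (hS.pow (n - j))
  rwa [show 0 + 1 * j + 1 * (n - j) = n by omega] at h

lemma isHomogeneous_weylBlock (hS : S.IsHomogeneous 1) (hT : T.IsHomogeneous 1) {p a q : ℕ}
    (hq : q < p) : (weylBlock p S T a q).IsHomogeneous (p - 2 - a) := by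
  rcases lt_or_ge q (a + 1) with h1 | h1
  · rw [weylBlock, Nat.choose_eq_zero_of_lt h1, Nat.cast_zero, mul_zero, zero_mul, zero_mul]
    exact isHomogeneous_zero _ _ _
  · have h := (((isHomogeneous_neg_one_pow (k := k) (σ := σ) (q + a + 1)).mul
      (isHomogeneous_natCast (q.choose (a + 1)))).mul (hT.pow (q - (a + 1)))).mul
        (hS.pow (p - 1 - q))
    rwa [show 0 + 0 + 1 * (q - (a + 1)) + 1 * (p - 1 - q) = p - 2 - a by omega] at h

lemma isHomogeneous_dualBlock (hS : S.IsHomogeneous 1) (hT : T.IsHomogeneous 1) {a q : ℕ} :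
    (dualBlock S T a q).IsHomogeneous a := by
  rcases lt_or_ge a q with h1 | h1
  · rw [dualBlock, Nat.choose_eq_zero_of_lt h1, Nat.cast_zero, zero_mul, zero_mul]
    exact isHomogeneous_zero _ _ _
  · have h := ((isHomogeneous_natCast (k := k) (σ := σ) (a.choose q)).mul (hS.pow q)).mul
      (hT.pow (a - q))
    rwa [show 0 + 1 * q + 1 * (a - q) = a by omega] at h

lemma isHomogeneous_weylKer (hS : S.IsHomogeneous 1) (hT : T.IsHomogeneous 1) {p n a r : ℕ}
    (hp : 0 < p) (i : Option (Fin r)) {j : ℕ} (hj : j ≤ n) :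
    (weylKer p S T n a i j).IsHomogeneous (i.elim n fun _ ↦ p - 2 - a) := by
  rcases i with _ | i
  · exact isHomogeneous_weylVec hS hT hj
  · rw [weylKer]
    split_ifs
    · exact isHomogeneous_weylBlock hS hT (Nat.mod_lt j hp)
    · exact isHomogeneous_zero _ _ _

lemma isHomogeneous_dualKer (hS : S.IsHomogeneous 1) (hT : T.IsHomogeneous 1) {p a r : ℕ}
    (i : Fin (r + 1)) (j : ℕ) : (dualKer p S T a i j).IsHomogeneous a := by
  rw [dualKer]
  split_ifs
  · exact isHomogeneous_dualBlock hS hT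
  · exact isHomogeneous_zero _ _ _

end Homogeneous

end SlTwo

/-! ### Weyl modules and their duals -/

namespace SlTwo

open MvPolynomial

section Operators

variable {R : Type*} [CommRing R]

lemma weylForm_add (S T : R) (n : ℕ) (u u' : ℕ → R) (j : ℕ) :
    weylForm S T n (fun i ↦ u i + u' i) j = weylForm S T n u j + weylForm S T n u' j := by
  simp only [weylForm]
  ring

lemma weylForm_smul (S T : R) (n : ℕ) (r : R) (u : ℕ → R) (j : ℕ) :
    weylForm S T n (fun i ↦ r * u i) j = r * weylForm S T n u j := by
  simp only [weylForm]
  ring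

lemma dualForm_add (S T : R) (n : ℕ) (u u' : ℕ → R) (j : ℕ) :
    dualForm S T n (fun i ↦ u i + u' i) j = dualForm S T n u j + dualForm S T n u' j := by
  simp only [dualForm]
  split_ifs <;> ring

lemma dualForm_smul (S T : R) (n : ℕ) (r : R) (u : ℕ → R) (j : ℕ) :
    dualForm S T n (fun i ↦ r * u i) j = r * dualForm S T n u j := by
  simp only [dualForm]
  split_ifs <;> ring

/-- The operator `S ^ 2 e - T ^ 2 f + S T h` of the Weyl module `V(n)` over a ring `R`; here `N` is
the number `n + 1` of basis vectors. -/
def weylLin (S T : R) (n N : ℕ) : (Fin N → R) →ₗ[R] (Fin N → R) where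
  toFun u j := weylForm S T n (zext u) j
  map_add' u u' := funext fun j ↦ by
    rw [show zext (u + u') = fun i ↦ zext u i + zext u' i from funext (zext_add u u'),
      weylForm_add]
    rfl
  map_smul' r u := funext fun j ↦ by
    rw [show zext (r • u) = fun i ↦ r * zext u i from funext (zext_smul r u), weylForm_smul]
    rfl

/-- The operator `S ^ 2 e - T ^ 2 f + S T h` of the dual of the Weyl module `V(n)` over a ring `R`;
here `N` is the number `n + 1` of basis vectors. -/
def dualLin (S T : R) (n N : ℕ) : (Fin N → R) →ₗ[R] (Fin N → R) where
  toFun u j := dualForm S T n (zext u) j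
  map_add' u u' := funext fun j ↦ by
    rw [show zext (u + u') = fun i ↦ zext u i + zext u' i from funext (zext_add u u'),
      dualForm_add]
    rfl
  map_smul' r u := funext fun j ↦ by
    rw [show zext (r • u) = fun i ↦ r * zext u i from funext (zext_smul r u), dualForm_smul]
    rfl

end Operators

section Splitting

variable {k : Type u} [Field k] [IsAlgClosed k] {p : ℕ} [Fact p.Prime] [CharP k p]
  {M : Type u} [AddCommGroup M] [Module k M] [LieRingModule (sl2 k) M] [LieModule k (sl2 k) M]
  {J : Type} [Fintype J] {c : M ≃ₗ[k] (J → k)}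
  {D : (J → MvPolynomial (Fin 2) k) →ₗ[MvPolynomial (Fin 2) k] (J → MvPolynomial (Fin 2) k)}

/-- The criterion `IsThetaMatrix.nonempty_kerTheta_iso`, for a chosen biproduct. -/
lemma IsThetaMatrix.nonempty_kerTheta_iso_biproduct (hc : IsThetaMatrix c D) {r : ℕ}
    {d : Fin r → ℕ} {κ : Fin r → J → MvPolynomial (Fin 2) k} {m : Fin r → ℤ}
    (hm : ∀ i, m i = -(d i : ℤ)) (hκ : ∀ i j, (κ i j).IsHomogeneous (d i)) (hDκ : ∀ i, D (κ i) = 0)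
    (hli : ∀ c : Fin r → MvPolynomial (Fin 2) k, ∑ i, c i • κ i = 0 → c = 0)
    (hspan : ∀ u : J → MvPolynomial (Fin 2) k, D u = 0 →
      ∃ c : Fin r → MvPolynomial (Fin 2) k, ∑ i, c i • κ i = u) :
    Nonempty (kerTheta k p M ≅ ⨁ fun i ↦ O k (m i)) := by
  obtain rfl : m = fun i ↦ -(d i : ℤ) := funext hm
  exact hc.nonempty_kerTheta_iso p hκ hDκ hli hspan (biproduct.ι _) (biproduct.π _)
    biproduct.total (fun i ↦ biproduct.ι_π_self _ i) fun i i' h ↦ biproduct.ι_π_ne _ h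

lemma biprod_biproduct_total {C : Type*} [Category C] [Preadditive C] [HasFiniteBiproducts C]
    [HasBinaryBiproducts C] (A : C) {r : ℕ} (Y : Fin r → C) :
    biprod.fst ≫ biprod.inl +
      ∑ i, (biprod.snd ≫ biproduct.π Y i) ≫ biproduct.ι Y i ≫ biprod.inr = 𝟙 (A ⊞ ⨁ Y) := by
  have h1 : ∑ i, (biprod.snd ≫ biproduct.π Y i) ≫ biproduct.ι Y i ≫ biprod.inr =
      (biprod.snd : A ⊞ ⨁ Y ⟶ _) ≫ (∑ i, biproduct.π Y i ≫ biproduct.ι Y i) ≫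
        (biprod.inr : _ ⟶ A ⊞ ⨁ Y) := by
    rw [Preadditive.sum_comp, Preadditive.comp_sum]
    simp only [Category.assoc]
  rw [h1, biproduct.total, Category.id_comp, biprod.total]

/-- The criterion `IsThetaMatrix.nonempty_kerTheta_iso`, with one summand singled out. -/
lemma IsThetaMatrix.nonempty_kerTheta_iso_biprod (hc : IsThetaMatrix c D) {r : ℕ}
    {d : Option (Fin r) → ℕ} {κ : Option (Fin r) → J → MvPolynomial (Fin 2) k} {m₀ : ℤ}
    {m : Fin r → ℤ} (hm₀ : m₀ = -(d none : ℤ)) (hm : ∀ i, m i = -(d (some i) : ℤ))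
    (hκ : ∀ i j, (κ i j).IsHomogeneous (d i)) (hDκ : ∀ i, D (κ i) = 0)
    (hli : ∀ c : Option (Fin r) → MvPolynomial (Fin 2) k, ∑ i, c i • κ i = 0 → c = 0)
    (hspan : ∀ u : J → MvPolynomial (Fin 2) k, D u = 0 →
      ∃ c : Option (Fin r) → MvPolynomial (Fin 2) k, ∑ i, c i • κ i = u) :
    Nonempty (kerTheta k p M ≅ O k m₀ ⊞ ⨁ fun i ↦ O k (m i)) := by
  obtain rfl : m = fun i ↦ -(d (some i) : ℤ) := funext hm
  subst hm₀
  refine hc.nonempty_kerTheta_iso p hκ hDκ hli hspan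
    (fun i ↦ match i with
      | none => biprod.inl
      | some i => biproduct.ι (fun i ↦ O k (-(d (some i) : ℤ))) i ≫ biprod.inr)
    (fun i ↦ match i with
      | none => biprod.fst
      | some i => biprod.snd ≫ biproduct.π (fun i ↦ O k (-(d (some i) : ℤ))) i)
    ?_ ?_ ?_
  · rw [Fintype.sum_option]
    exact biprod_biproduct_total _ _
  · rintro (_ | i)
    · exact biprod.inl_fst
    · simp
  · rintro (_ | i) (_ | i') h
    · exact absurd rfl h
    · simp
    · simp
    · have h' : i ≠ i' := fun e ↦ h (congrArg some e)
      simp [biproduct.ι_π_ne _ h']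

lemma X_dvd_of_dvd_mul {k σ : Type*} [Field k] {i : σ} {S : MvPolynomial σ k} (hS : ¬ X i ∣ S)
    (x : MvPolynomial σ k) (h : X i ∣ S * x) : X i ∣ x :=
  (X_prime.dvd_or_dvd h).resolve_left hS

lemma X_dvd_of_dvd_X_mul {k σ : Type*} [Field k] {i i' : σ} (hi : i ≠ i') (x : MvPolynomial σ k)
    (h : X i ∣ X i' * x) : X i ∣ x :=
  X_dvd_of_dvd_mul (fun h ↦ hi (X_dvd_X.1 h)) x h

end Splitting

section Rep

variable {k : Type u} [Field k] {M : Type u} [AddCommGroup M] [Module k M]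
  {E F H : Module.End k M} {hE : H * E - E * H = (2 : k) • E}
  {hF : H * F - F * H = -((2 : k) • F)} {hH : E * F - F * E = H}

lemma rep_e : rep E F H hE hF hH (e k) = E := by
  change (1 : k) • E + (0 : k) • F + (0 : k) • H = E
  module

lemma rep_f : rep E F H hE hF hH (f k) = F := by
  change (0 : k) • E + (1 : k) • F + (0 : k) • H = F
  module

lemma rep_h : rep E F H hE hF hH (h k) = H := by
  change (0 : k) • E + (0 : k) • F + (1 : k) • H = H
  module

end Rep

namespace Weyl

section Coordinates

variable (k : Type u) [Field k] {n : ℕ}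

lemma lie_e (u : Weyl k n) : ⁅e k, u⁆ = E k n u := LinearMap.congr_fun rep_e u

lemma lie_f (u : Weyl k n) : ⁅f k, u⁆ = F k n u := LinearMap.congr_fun rep_f u

lemma lie_h (u : Weyl k n) : ⁅h k, u⁆ = H k n u := LinearMap.congr_fun rep_h u

variable (n) in
/-- The coordinates in the basis `v_0, …, v_n`. -/
noncomputable def coordEquiv : Weyl k n ≃ₗ[k] (Fin (n + 1) → k) := LinearEquiv.refl k _

lemma coordEquiv_v (i : ℕ) (j : Fin (n + 1)) :
    coordEquiv k n (v k n i) j = if (j : ℕ) = i then 1 else 0 := by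
  change (if ((j : ℕ) : ℤ) = i then (1 : k) else 0) = _
  simp only [Nat.cast_inj]

lemma zext_coordEquiv_v (i j : ℕ) (hi : i ≤ n) :
    zext (coordEquiv k n (v k n i)) j = if j = i then 1 else 0 := by
  rcases lt_or_ge j (n + 1) with h | h
  · rw [zext_of_lt _ h, coordEquiv_v]
  · rw [zext_of_le _ h, if_neg (by omega)]

variable (n) in
/-- The coefficient of `v_j`, which is zero for `j > n`. -/
noncomputable def coeff (j : ℕ) : Weyl k n →ₗ[k] k where
  toFun u := zext (coordEquiv k n u) j
  map_add' u u' := by rw [map_add, zext_add]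
  map_smul' c u := by rw [map_smul, zext_smul]; rfl

lemma coeff_v (i j : ℕ) (hi : i ≤ n) : coeff k n j (v k n i) = if j = i then 1 else 0 :=
  zext_coordEquiv_v k i j hi

lemma coeff_E (u : Weyl k n) (j : ℕ) (hj : j ≤ n) :
    coeff k n j (E k n u) = ((n : k) - j) * coeff k n (j + 1) u := by
  suffices coeff k n j ∘ₗ E k n = ((n : k) - j) • coeff k n (j + 1) from LinearMap.congr_fun this u
  refine ext_v fun i hi ↦ ?_
  rw [LinearMap.comp_apply, E_v, map_smul, LinearMap.smul_apply, coeff_v k i _ hi]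
  rcases i with _ | i
  · rw [v_eq_zero k n (by simp)]
    simp
  · rw [show ((i + 1 : ℕ) : ℤ) - 1 = (i : ℕ) by push_cast; ring, coeff_v k i _ (by omega)]
    by_cases h : j = i
    · subst h
      simp
      ring
    · simp [h]

lemma coeff_F (u : Weyl k n) (j : ℕ) (hj : j ≤ n) :
    coeff k n j (F k n u) = j * coeff k n (j - 1) u := by
  suffices coeff k n j ∘ₗ F k n = (j : k) • coeff k n (j - 1) from LinearMap.congr_fun this u
  refine ext_v fun i hi ↦ ?_
  rw [LinearMap.comp_apply, F_v, map_smul, LinearMap.smul_apply, coeff_v k i _ hi]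
  have h1 : coeff k n j (v k n (i + 1)) = if j = i + 1 then 1 else 0 := by
    rcases hi.lt_or_eq with hi | rfl
    · exact_mod_cast coeff_v k (i + 1) j hi
    · rw [v_eq_zero k i (by simp), map_zero, if_neg (by omega)]
  rw [h1]
  rcases j with _ | j
  · simp
  · by_cases h : j = i
    · subst h
      simp
    · simp [h]

lemma coeff_H (u : Weyl k n) (j : ℕ) :
    coeff k n j (H k n u) = ((n : k) - 2 * j) * coeff k n j u := by
  suffices coeff k n j ∘ₗ H k n = ((n : k) - 2 * j) • coeff k n j from LinearMap.congr_fun this u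
  refine ext_v fun i hi ↦ ?_
  rw [LinearMap.comp_apply, H_v, map_smul, LinearMap.smul_apply, coeff_v k i _ hi]
  by_cases h : j = i
  · subst h
    simp
  · simp [h]

/-- The operator `S ^ 2 e - T ^ 2 f + S T h` on vectors with constant coordinates. -/
lemma weylForm_coeff {σ : Type*} (S T : MvPolynomial σ k) (u : Weyl k n) (j : ℕ) (hj : j ≤ n) :
    weylForm S T n (fun i ↦ C (coeff k n i u)) j = S ^ 2 * C (coeff k n j (E k n u)) -
      T ^ 2 * C (coeff k n j (F k n u)) + S * T * C (coeff k n j (H k n u)) := by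
  rw [coeff_E k u j hj, coeff_F k u j hj, coeff_H, weylForm]
  simp only [map_mul, map_sub, map_natCast, map_ofNat]
  ring

lemma isThetaMatrix : IsThetaMatrix (coordEquiv k n)
    (weylLin (X 0 : MvPolynomial (Fin 2) k) (X 1) n (n + 1)) := by
  intro u
  funext j
  have h1 : zext (constVec (coordEquiv k n) u) = fun i ↦ C (σ := Fin 2) (coeff k n i u) :=
    funext fun i ↦ map_zext C (coordEquiv k n u) i
  change weylForm _ _ _ (zext (constVec (coordEquiv k n) u)) _ = _
  rw [h1, weylForm_coeff k _ _ u j (by omega), lie_e, lie_f, lie_h]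
  have h2 (w : Weyl k n) : coeff k n j w = coordEquiv k n w j := zext_val _ j
  rw [h2, h2, h2]
  rfl

end Coordinates

end Weyl

section Kernel

variable {k : Type u} [Field k] [IsAlgClosed k] {p : ℕ} [Fact p.Prime] [CharP k p] {n r a : ℕ}

theorem nonempty_kerTheta_weyl_iso (hn : n = r * p + a) (ha : a < p) (hr : r = 0 ∨ a + 1 < p) :
    Nonempty (kerTheta k p (Weyl k n) ≅
      O k (-(n : ℤ)) ⊞ ⨁ fun _ : Fin r ↦ O k ((a : ℤ) + 2 - p)) := by
  refine (Weyl.isThetaMatrix k).nonempty_kerTheta_iso_biprod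
    (d := fun i ↦ i.elim n fun _ ↦ p - 2 - a)
    (κ := fun i j ↦ weylKer p (X 0) (X 1) n a i j) rfl (fun i ↦ ?_)
    (fun i j ↦ isHomogeneous_weylKer (isHomogeneous_X k 0) (isHomogeneous_X k 1)
      (Fact.out : p.Prime).pos i (by omega))
    (fun i ↦ funext fun j ↦ weylForm_weylKer hn ha hr i _
      (fun j hj ↦ zext_of_lt _ (by omega)) j (by omega))
    (fun c hc ↦ weylKer_linearIndependent (T := X 1) (X_ne_zero 0) hn ha hr c fun j hj ↦ ?_)
    (fun u hu ↦ ?_)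
  · have : a + 1 < p := hr.resolve_left (by have := i.2; omega)
    simp only [Option.elim_some]
    omega
  · have h1 := congr_fun hc (⟨j, by omega⟩ : Fin (n + 1))
    rwa [Finset.sum_apply] at h1
  · obtain ⟨c, h1⟩ := exists_sum_weylKer_eq (X_ne_zero 0) (X_ne_zero 1)
      (X_dvd_of_dvd_X_mul (by decide)) hn ha hr (zext u)
      (fun j hj ↦ congr_fun hu (⟨j, by omega⟩ : Fin (n + 1)))
    refine ⟨c, funext fun j ↦ ?_⟩
    rw [Finset.sum_apply, ← zext_val u j, ← h1 j (by omega)]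
    rfl

end Kernel

namespace DualWeyl

variable (k : Type u) [Field k] {n : ℕ}

variable (n) in
/-- The values on `v_0, …, v_n`, as coordinates of the dual of the Weyl module. -/
noncomputable def coordEquiv : DualWeyl k n ≃ₗ[k] (Fin (n + 1) → k) where
  toFun φ j := φ (Weyl.v k n (j : ℕ))
  map_add' φ ψ := rfl
  map_smul' c φ := rfl
  invFun u := Weyl.lift k n fun j ↦ zext u j.toNat
  left_inv φ := Weyl.ext_v fun j hj ↦ by
    rw [Weyl.lift_v k n _ (by omega) (by omega), Int.toNat_natCast, zext_of_lt _ (by omega)]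
  right_inv u := funext fun j ↦ by
    refine (Weyl.lift_v k n _ (by omega) (by omega)).trans ?_
    rw [Int.toNat_natCast, zext_val]

lemma zext_coordEquiv (φ : DualWeyl k n) (j : ℕ) :
    zext (coordEquiv k n φ) j = φ (Weyl.v k n j) := by
  rcases lt_or_ge j (n + 1) with h | h
  · rw [zext_of_lt _ h]
    rfl
  · rw [zext_of_le _ h, Weyl.v_eq_zero k n (by omega), map_zero]

lemma isThetaMatrix : IsThetaMatrix (coordEquiv k n)
    (dualLin (X 0 : MvPolynomial (Fin 2) k) (X 1) n (n + 1)) := by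
  intro φ
  funext j
  have h1 : zext (constVec (coordEquiv k n) φ) = fun i : ℕ ↦ C (σ := Fin 2) (φ (Weyl.v k n i)) :=
    funext fun i ↦ (map_zext C (coordEquiv k n φ) i).trans
      (congrArg (C : k → MvPolynomial (Fin 2) k) (zext_coordEquiv k φ i))
  have he : coordEquiv k n ⁅e k, φ⁆ j = -φ (Weyl.E k n (Weyl.v k n (j : ℕ))) :=
    (Module.Dual.lie_apply _ _ _).trans (congrArg (fun w ↦ -φ w) (Weyl.lie_e k _))
  have hf : coordEquiv k n ⁅f k, φ⁆ j = -φ (Weyl.F k n (Weyl.v k n (j : ℕ))) :=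
    (Module.Dual.lie_apply _ _ _).trans (congrArg (fun w ↦ -φ w) (Weyl.lie_f k _))
  have hh : coordEquiv k n ⁅h k, φ⁆ j = -φ (Weyl.H k n (Weyl.v k n (j : ℕ))) :=
    (Module.Dual.lie_apply _ _ _).trans (congrArg (fun w ↦ -φ w) (Weyl.lie_h k _))
  change dualForm _ _ _ (zext (constVec (coordEquiv k n) φ)) _ =
    X 0 ^ 2 * C (coordEquiv k n ⁅e k, φ⁆ j) - X 1 ^ 2 * C (coordEquiv k n ⁅f k, φ⁆ j) +
      X 0 * X 1 * C (coordEquiv k n ⁅h k, φ⁆ j)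
  rw [h1, he, hf, hh, Weyl.E_v, Weyl.F_v, Weyl.H_v, dualForm]
  obtain ⟨j, hj⟩ := j
  rcases j with _ | j
  · rw [if_pos rfl]
    simp [Weyl.v_eq_zero k n (j := -1) (by simp)]
    ring
  · rw [if_neg j.succ_ne_zero]
    simp [map_ofNat]
    ring

end DualWeyl

section Kernel

variable {k : Type u} [Field k] [IsAlgClosed k] {p : ℕ} [Fact p.Prime] [CharP k p] {n r a : ℕ}

theorem nonempty_kerTheta_dualWeyl_iso (hn : n = r * p + a) (ha : a < p) :
    Nonempty (kerTheta k p (DualWeyl k n) ≅ ⨁ fun _ : Fin (r + 1) ↦ O k (-(a : ℤ))) := by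
  have hD (i : Fin (r + 1)) : dualLin (X 0 : MvPolynomial (Fin 2) k) (X 1) n (n + 1)
      (fun j ↦ dualKer p (X 0) (X 1) a i j) = 0 := funext fun j ↦
    dualForm_dualKer hn ha i (zext fun j : Fin (n + 1) ↦ dualKer p (X 0) (X 1) a i j)
      (fun j hj ↦ zext_of_lt _ (by omega)) (zext_of_le _ le_rfl) j (by omega)
  refine (DualWeyl.isThetaMatrix k).nonempty_kerTheta_iso_biproduct (d := fun _ ↦ a)
    (κ := fun i j ↦ dualKer p (X 0) (X 1) a i j) (fun i ↦ rfl)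
    (fun i j ↦ isHomogeneous_dualKer (isHomogeneous_X k 0) (isHomogeneous_X k 1) i j)
    hD
    (fun c hc ↦ dualKer_linearIndependent (S := X 0) (X_ne_zero 1) hn c fun j hj ↦ ?_)
    (fun u hu ↦ ?_)
  · have h1 := congr_fun hc (⟨j, by omega⟩ : Fin (n + 1))
    rwa [Finset.sum_apply] at h1
  · obtain ⟨c, h1⟩ := exists_sum_dualKer_eq (X_ne_zero 0) (X_ne_zero 1)
      (X_dvd_of_dvd_X_mul (by decide)) hn ha (zext u)
      (fun j hj ↦ congr_fun hu (⟨j, by omega⟩ : Fin (n + 1)))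
    refine ⟨c, funext fun j ↦ ?_⟩
    rw [Finset.sum_apply, ← zext_val u j, ← h1 j (by omega)]
    rfl

end Kernel

end SlTwo

/-! ### The submodules `Φ_ξ` -/

namespace SlTwo

open MvPolynomial

namespace Weyl

variable (k : Type u) [Field k] {n : ℕ}

lemma pairing_X_pow_of_le (u : Weyl k n) {j : ℕ} (hj : j ≤ n) :
    pairing k n u (Polynomial.X ^ j) = coeff k n j u :=
  (pairing_X_pow k n u ⟨j, by omega⟩).trans (zext_val (coordEquiv k n u) ⟨j, by omega⟩).symm

variable {k} in
lemma ext_coeff {u u' : Weyl k n} (h : ∀ j ≤ n, coeff k n j u = coeff k n j u') : u = u' :=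
  ext_pairing k n fun j hj ↦ by
    rw [pairing_X_pow_of_le k u hj, pairing_X_pow_of_le k u' hj, h j hj]

lemma coeff_of_lt (u : Weyl k n) {j : ℕ} (hj : n < j) : coeff k n j u = 0 := zext_of_le _ hj

/-- If `G` is a polynomial of degree at most one which does not vanish at zero, then the forms
`X ^ (n - j) G ^ j` span the polynomials of degree at most `n`, by triangularity. -/
lemma pairing_eq_zero (u : Weyl k n) {G : Polynomial k} (hG : G.natDegree ≤ 1)
    (hG0 : G.coeff 0 ≠ 0)
    (h : ∀ j ≤ n, pairing k n u (Polynomial.X ^ (n - j) * G ^ j) = 0) {j : ℕ} (hj : j ≤ n)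
    (Q : Polynomial k) (hQ : Q.natDegree ≤ j) :
    pairing k n u (Polynomial.X ^ (n - j) * Q) = 0 := by
  induction j generalizing Q with
  | zero =>
    rw [Polynomial.eq_C_of_natDegree_le_zero hQ, mul_comm, ← Polynomial.smul_eq_C_mul, map_smul]
    have h1 := h 0 hj
    rw [pow_zero, mul_one] at h1
    rw [h1, smul_zero]
  | succ j ih =>
    have hX : (Polynomial.X : Polynomial k) ^ (n - j) =
        Polynomial.X ^ (n - (j + 1)) * Polynomial.X := by
      rw [← pow_succ, show n - (j + 1) + 1 = n - j by omega]
    have key (Q : Polynomial k) (hQ : Q.natDegree ≤ j + 1) :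
        pairing k n u (Polynomial.X ^ (n - (j + 1)) * Q) =
          Q.coeff 0 • pairing k n u (Polynomial.X ^ (n - (j + 1))) := by
      have h1 := ih (by omega) Q.divX (by
        rw [Polynomial.natDegree_divX_eq_natDegree_tsub_one]
        omega)
      rw [hX, mul_assoc, mul_comm Polynomial.X] at h1
      conv_lhs => rw [← Polynomial.divX_mul_X_add Q]
      rw [mul_add, map_add, h1, zero_add, mul_comm, ← Polynomial.smul_eq_C_mul, map_smul]
    have h2 := h (j + 1) hj
    rw [key _ (Polynomial.natDegree_pow_le.trans (by nlinarith)),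
      Polynomial.coeff_zero_eq_eval_zero, Polynomial.eval_pow, ← Polynomial.coeff_zero_eq_eval_zero] at h2
    rw [key Q hQ, (smul_eq_zero.1 h2).resolve_left (pow_ne_zero _ hG0), smul_zero]

end Weyl

section Phi

variable (k : Type u) [Field k]

lemma phi_eq (ξ : Projectivization k (Fin 2 → k)) : (phi k ξ).1 = 1 ∨
    ∃ ε, (phi k ξ).1 = !![0, 1; -1, -ε] := by
  unfold phi
  by_cases h : ξ.rep 0 = 0
  · exact Or.inl (congrArg Subtype.val (if_pos h))
  · exact Or.inr ⟨_, congrArg Subtype.val (if_neg h)⟩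

variable (n : ℕ) (ξ : Projectivization k (Fin 2 → k))

lemma slAct_phi_injective : Function.Injective (Weyl.slAct k n (phi k ξ)) := by
  rw [injective_iff_map_eq_zero]
  intro u hu
  have h1 (j : ℕ) (hj : j ≤ n) : Weyl.pairing k n u (Weyl.form k n (phi k ξ).1 j) = 0 := by
    rw [← Weyl.pairing_slAct k n _ u j hj, hu, Weyl.pairing_X_pow_of_le k _ hj, map_zero]
  refine Weyl.ext_coeff fun j hj ↦ ?_
  rw [← Weyl.pairing_X_pow_of_le k u hj, map_zero]
  rcases phi_eq k ξ with h | ⟨ε, h⟩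
  · have h2 := h1 j hj
    rw [h] at h2
    simpa [Weyl.form] using h2
  · have h2 := Weyl.pairing_eq_zero k u (G := Polynomial.C (-ε) * Polynomial.X + Polynomial.C (-1))
      Polynomial.natDegree_linear_le (by simp) (fun j hj ↦ by
        have h2 := h1 j hj
        rw [h] at h2
        simp only [Weyl.form, Matrix.of_apply, Matrix.cons_val', Matrix.cons_val_zero,
          Matrix.cons_val_one, Matrix.cons_val_fin_one, map_zero, map_one, one_mul, zero_add] at h2
        rwa [add_comm])
      (Nat.sub_le n j) 1 (by simp)
    rwa [mul_one, show n - (n - j) = j by omega] at h2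

/-- The linear form in `s, t` which takes the place of `s` after the action of `φ(ξ)`. -/
noncomputable def phiS : MvPolynomial (Fin 2) k :=
  C ((phi k ξ).1 1 1) * X 0 + C ((phi k ξ).1 0 1) * X 1

/-- The linear form in `s, t` which takes the place of `t` after the action of `φ(ξ)`. -/
noncomputable def phiT : MvPolynomial (Fin 2) k :=
  C ((phi k ξ).1 1 0) * X 0 + C ((phi k ξ).1 0 0) * X 1

lemma isHomogeneous_phiS : (phiS k ξ).IsHomogeneous 1 :=
  ((isHomogeneous_X k 0).C_mul _).add ((isHomogeneous_X k 1).C_mul _)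

lemma isHomogeneous_phiT : (phiT k ξ).IsHomogeneous 1 :=
  ((isHomogeneous_X k 0).C_mul _).add ((isHomogeneous_X k 1).C_mul _)

/-- The linear forms `phiS` and `phiT` are nonzero and without common factors. -/
lemma phiS_phiT : phiS k ξ ≠ 0 ∧ phiT k ξ ≠ 0 ∧ ∀ x, phiT k ξ ∣ phiS k ξ * x → phiT k ξ ∣ x := by
  unfold phiS phiT
  rcases phi_eq k ξ with h | ⟨ε, h⟩
  · rw [h]
    simpa using X_dvd_of_dvd_X_mul (k := k) (show (1 : Fin 2) ≠ 0 by decide)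
  · have h1 : ¬ (X 0 : MvPolynomial (Fin 2) k) ∣ C (-ε) * X 0 + C 1 * X 1 := fun h ↦ by
      have h2 := (dvd_add_right (dvd_mul_left _ _)).1 h
      rw [map_one, one_mul, X_dvd_X] at h2
      exact absurd h2 (by decide)
    have h2 : C (-1) * X 0 + C 0 * X 1 = -(X 0 : MvPolynomial (Fin 2) k) := by simp
    rw [h]
    simp only [Matrix.of_apply, Matrix.cons_val', Matrix.cons_val_zero,
      Matrix.cons_val_one, Matrix.cons_val_fin_one, h2, neg_dvd, neg_ne_zero]
    exact ⟨fun h ↦ h1 (h ▸ dvd_zero _), X_ne_zero 0, X_dvd_of_dvd_mul h1⟩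

variable {k n} {p : ℕ}

lemma mem_phiSpan_iff (u : Weyl k n) :
    u ∈ phiSpan k n p ↔ ∀ j ≤ n, j ≤ n % p → Weyl.coeff k n j u = 0 := by
  constructor
  · intro hu
    induction hu using Submodule.span_induction with
    | mem u hu =>
      obtain ⟨i, h1, h2, rfl⟩ := hu
      intro j hj hj'
      rw [Weyl.coeff_v k i j h2, if_neg (by omega)]
    | zero => simp
    | add u u' _ _ hu hu' =>
      intro j hj hj'
      rw [map_add, hu j hj hj', hu' j hj hj', add_zero]
    | smul c u _ hu =>
      intro j hj hj'
      rw [map_smul, hu j hj hj', smul_zero]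
  · intro hu
    have h1 : u = ∑ i : Fin (n + 1), Weyl.coeff k n i u • Weyl.v k n (i : ℕ) := by
      refine Weyl.ext_coeff fun j hj ↦ ?_
      rw [map_sum, Finset.sum_eq_single ⟨j, by omega⟩]
      · rw [map_smul, Weyl.coeff_v k _ _ (by omega)]
        simp
      · intro i _ hi
        rw [map_smul, Weyl.coeff_v k _ _ (by omega), if_neg, smul_zero]
        exact fun h ↦ hi (Fin.ext h.symm)
      · simp
    rw [h1]
    refine sum_mem fun i _ ↦ ?_
    by_cases hi : (i : ℕ) ≤ n % p
    · rw [hu i (by omega) hi, zero_smul]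
      exact zero_mem _
    · exact Submodule.smul_mem _ _ (Submodule.subset_span ⟨i, by omega, by omega, rfl⟩)

end Phi

section Shift

variable {R : Type*} [CommRing R] {N : ℕ}

/-- A finite sequence, placed after `s` zeros and followed by zeros. -/
def shiftExt (s : ℕ) (u : Fin N → R) (i : ℕ) : R := if i < s then 0 else zext u (i - s)

lemma shiftExt_add_val (s : ℕ) (u : Fin N → R) (j : Fin N) : shiftExt s u (s + j) = u j := by
  rw [shiftExt, if_neg (by omega), Nat.add_sub_cancel_left, zext_val]

lemma shiftExt_of_lt {s i : ℕ} (u : Fin N → R) (h : i < s) : shiftExt s u i = 0 := if_pos h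

lemma shiftExt_add (s : ℕ) (u u' : Fin N → R) (i : ℕ) :
    shiftExt s (u + u') i = shiftExt s u i + shiftExt s u' i := by
  simp only [shiftExt, zext_add]
  split_ifs <;> simp

lemma shiftExt_smul (s : ℕ) (r : R) (u : Fin N → R) (i : ℕ) :
    shiftExt s (r • u) i = r * shiftExt s u i := by
  simp only [shiftExt, zext_smul]
  split_ifs <;> simp

/-- The operator `S ^ 2 e - T ^ 2 f + S T h` on the vectors of `V(n)` with vanishing coefficients
of `v_0, …, v_{s-1}`. -/
def shiftLin (S T : R) (n s N : ℕ) : (Fin N → R) →ₗ[R] (Fin N → R) where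
  toFun u j := weylForm S T n (shiftExt s u) (s + j)
  map_add' u u' := funext fun j ↦ by
    rw [show shiftExt s (u + u') = fun i ↦ shiftExt s u i + shiftExt s u' i from
      funext (shiftExt_add s u u'), weylForm_add]
    rfl
  map_smul' r u := funext fun j ↦ by
    rw [show shiftExt s (r • u) = fun i ↦ r * shiftExt s u i from
      funext (shiftExt_smul s r u), weylForm_smul]
    rfl

end Shift

namespace Phi

variable {k : Type u} [Field k] {n p : ℕ} [CharP k p] {ξ : Projectivization k (Fin 2 → k)}

lemma coeff_shiftExt (u : Fin (n - n % p) → k) {i : ℕ} (hi : i ≤ n) :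
    Weyl.coeff k n i ((Weyl.coordEquiv k n).symm fun j ↦ shiftExt (n % p + 1) u j) =
      shiftExt (n % p + 1) u i := by
  change zext (Weyl.coordEquiv k n ((Weyl.coordEquiv k n).symm _)) i = _
  rw [LinearEquiv.apply_symm_apply, zext_of_lt _ (by omega)]

variable (k n p ξ) in
/-- The parametrization of `Φ_ξ(n)` by the coefficients of `v_{a+1}, …, v_n` before the action of
`φ(ξ)`. -/
noncomputable def param : (Fin (n - n % p) → k) →ₗ[k] Phi k n p ξ where
  toFun u := ⟨Weyl.slAct k n (phi k ξ)
      ((Weyl.coordEquiv k n).symm fun j ↦ shiftExt (n % p + 1) u j), _,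
    (mem_phiSpan_iff _).2 fun j hj hj' ↦ by
      rw [coeff_shiftExt u hj, shiftExt_of_lt u (by omega)], rfl⟩
  map_add' u u' := Subtype.ext <| by
    refine Eq.trans ?_ (map_add (Weyl.slAct k n (phi k ξ)) _ _)
    rw [← map_add]
    exact congrArg
      (fun w : Fin (n + 1) → k ↦ Weyl.slAct k n (phi k ξ) ((Weyl.coordEquiv k n).symm w))
      (funext fun i ↦ shiftExt_add _ u u' i)
  map_smul' r u := Subtype.ext <| by
    refine Eq.trans ?_ (map_smul (Weyl.slAct k n (phi k ξ)) r _)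
    rw [← map_smul]
    exact congrArg
      (fun w : Fin (n + 1) → k ↦ Weyl.slAct k n (phi k ξ) ((Weyl.coordEquiv k n).symm w))
      (funext fun i ↦ shiftExt_smul _ r u i)

lemma param_coeff (u : Weyl k n) (hu : u ∈ phiSpan k n p) :
    (param k n p ξ fun j ↦ Weyl.coeff k n (n % p + 1 + j) u : Phi k n p ξ).1 =
      Weyl.slAct k n (phi k ξ) u := by
  change Weyl.slAct k n (phi k ξ) _ = _
  congr 1
  refine Weyl.ext_coeff fun j hj ↦ ?_
  rw [coeff_shiftExt _ hj]
  rcases lt_or_ge j (n % p + 1) with h | h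
  · rw [shiftExt_of_lt _ h, (mem_phiSpan_iff u).1 hu j hj (by omega)]
  · obtain ⟨i, rfl⟩ := Nat.exists_eq_add_of_le h
    exact shiftExt_add_val _ _ (⟨i, by omega⟩ : Fin (n - n % p))

lemma param_bijective : Function.Bijective (param k n p ξ) := by
  constructor
  · rw [injective_iff_map_eq_zero]
    intro u hu
    have h1 := congrArg Subtype.val hu
    have h2 := slAct_phi_injective k n ξ (h1.trans (map_zero _).symm)
    funext j
    rw [← shiftExt_add_val (n % p + 1) u j, ← coeff_shiftExt u (by omega), h2, map_zero]
    rfl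
  · rintro ⟨_, u, hu, rfl⟩
    exact ⟨_, Subtype.ext (param_coeff u hu)⟩

variable (k n p ξ) in
/-- The coordinates of `Φ_ξ(n)`, inverse to `param`. -/
noncomputable def coordEquiv : Phi k n p ξ ≃ₗ[k] (Fin (n - n % p) → k) :=
  (LinearEquiv.ofBijective (param k n p ξ) param_bijective).symm

lemma coordEquiv_eq (m : Phi k n p ξ) (u : Weyl k n) (hu : u ∈ phiSpan k n p)
    (hm : m.1 = Weyl.slAct k n (phi k ξ) u) :
    coordEquiv k n p ξ m = fun j : Fin (n - n % p) ↦ Weyl.coeff k n (n % p + 1 + j) u := by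
  rw [coordEquiv, LinearEquiv.symm_apply_eq]
  exact Subtype.ext (hm.trans (param_coeff u hu).symm)

/-- Conjugation by `φ(ξ)` turns `s ^ 2 e - t ^ 2 f + s t h` into `S ^ 2 e - T ^ 2 f + S T h`, where
`S`, `T` are `phiS`, `phiT`. -/
lemma isThetaMatrix : IsThetaMatrix (coordEquiv k n p ξ)
    (shiftLin (phiS k ξ) (phiT k ξ) n (n % p + 1) (n - n % p)) := by
  rintro ⟨_, u, hu, rfl⟩
  obtain ⟨hE, hF, hH⟩ := phiSpan_stable k n p u hu
  have h1 : shiftExt (n % p + 1) (constVec (coordEquiv k n p ξ) ⟨_, u, hu, rfl⟩) =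
      fun i ↦ C (σ := Fin 2) (Weyl.coeff k n i u) := by
    funext i
    rcases lt_or_ge i (n % p + 1) with h | h
    · have h2 := Nat.mod_le n p
      rw [shiftExt_of_lt _ h, (mem_phiSpan_iff u).1 hu i (by omega) (by omega), map_zero]
    obtain ⟨i, rfl⟩ := Nat.exists_eq_add_of_le h
    rcases lt_or_ge i (n - n % p) with h | h
    · refine (shiftExt_add_val _ _ (⟨i, h⟩ : Fin (n - n % p))).trans ?_
      rw [constVec, coordEquiv_eq _ u hu rfl]
    · rw [shiftExt, if_neg (by omega), zext_of_le _ (by omega), Weyl.coeff_of_lt k u (by omega),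
        map_zero]
  have h2 (α β γ : k) (x : sl2 k) (hx : ∀ w : Weyl k n,
      ⁅x, w⁆ = α • Weyl.E k n w + β • Weyl.F k n w + γ • Weyl.H k n w) :=
    coordEquiv_eq (⁅x, (⟨_, u, hu, rfl⟩ : Phi k n p ξ)⁆) _
      (add_mem (add_mem (Submodule.smul_mem _ _ hE) (Submodule.smul_mem _ _ hF))
        (Submodule.smul_mem _ _ hH))
      ((hx _).trans (Weyl.slAct_conj k n (phi k ξ) u α β γ))
  have he := h2 1 0 0 (e k) fun w ↦ by rw [Weyl.lie_e]; module
  have hf := h2 0 1 0 (f k) fun w ↦ by rw [Weyl.lie_f]; module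
  have hh := h2 0 0 1 (h k) fun w ↦ by rw [Weyl.lie_h]; module
  funext j
  change weylForm _ _ _ (shiftExt (n % p + 1) (constVec (coordEquiv k n p ξ) ⟨_, u, hu, rfl⟩)) _ =
    X 0 ^ 2 * C (coordEquiv k n p ξ ⁅e k, _⁆ j) - X 1 ^ 2 * C (coordEquiv k n p ξ ⁅f k, _⁆ j) +
      X 0 * X 1 * C (coordEquiv k n p ξ ⁅h k, _⁆ j)
  rw [h1, he, hf, hh, Weyl.weylForm_coeff k _ _ u _ (by omega), phiS, phiT]
  simp only [map_add, map_smul, smul_eq_mul, map_mul, map_sub, map_neg, map_pow, map_one, map_zero,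
    map_ofNat]
  ring

end Phi

section Kernel

variable {k : Type u} [Field k] [IsAlgClosed k] {p : ℕ} [Fact p.Prime] [CharP k p] {n r a : ℕ}

theorem nonempty_kerTheta_phi_iso (hn : n = r * p + a) (ha : a + 1 < p)
    (ξ : Projectivization k (Fin 2 → k)) :
    Nonempty (kerTheta k p (Phi k n p ξ) ≅ ⨁ fun _ : Fin r ↦ O k ((a : ℤ) + 2 - p)) := by
  obtain ⟨hS, hT, hST⟩ := phiS_phiT k ξ
  have hnp : n % p = a := by rw [hn, Nat.mul_add_mod', Nat.mod_eq_of_lt (by omega)]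
  have hκ (i : Fin r) (j : ℕ) (hj : j ≤ n) :
      shiftExt (n % p + 1) (fun j : Fin (n - n % p) ↦
        weylKer p (phiS k ξ) (phiT k ξ) n a (some i) (n % p + 1 + j)) j =
      weylKer p (phiS k ξ) (phiT k ξ) n a (some i) j := by
    rcases lt_or_ge j (n % p + 1) with h | h
    · rw [shiftExt_of_lt _ h, weylKer, weylBlock,
        Nat.choose_eq_zero_of_lt ((Nat.mod_le j p).trans_lt (by omega))]
      simp
    · obtain ⟨j, rfl⟩ := Nat.exists_eq_add_of_le h
      exact shiftExt_add_val _ _ (⟨j, by omega⟩ : Fin (n - n % p))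
  refine Phi.isThetaMatrix.nonempty_kerTheta_iso_biproduct
    (d := fun _ ↦ p - 2 - a)
    (κ := fun i j ↦ weylKer p (phiS k ξ) (phiT k ξ) n a (some i) (n % p + 1 + j))
    (fun i ↦ by omega)
    (fun i j ↦ isHomogeneous_weylKer (isHomogeneous_phiS k ξ) (isHomogeneous_phiT k ξ)
      (Fact.out : p.Prime).pos (some i) (by omega))
    (fun i ↦ funext fun j ↦ weylForm_weylKer hn (by omega) (Or.inr ha) (some i) _ (hκ i) _
      (by omega))
    (fun c hc ↦ ?_) (fun u hu ↦ ?_)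
  · have h1 := weylKer_linearIndependent hS hn (by omega) (Or.inr ha) (fun i ↦ i.elim 0 c)
      (T := phiT k ξ) fun j hj ↦ by
        rw [Fintype.sum_option, Option.elim_none, zero_mul, zero_add]
        rcases lt_or_ge j (n % p + 1) with h | h
        · refine Finset.sum_eq_zero fun i _ ↦ ?_
          rw [← hκ i j hj, shiftExt_of_lt _ h, mul_zero]
        · obtain ⟨j, rfl⟩ := Nat.exists_eq_add_of_le h
          have h1 := congr_fun hc (⟨j, by omega⟩ : Fin (n - n % p))
          rwa [Finset.sum_apply] at h1
    funext i
    exact congr_fun h1 (some i)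
  · have hna : (n : MvPolynomial (Fin 2) k) = (n % p : ℕ) := natCast_eq_mod p n
    obtain ⟨c, h1⟩ := exists_sum_weylKer_eq hS hT hST hn (by omega) (Or.inr ha)
      (shiftExt (n % p + 1) u) fun j hj ↦ by
        rcases lt_or_ge j (n % p + 1) with h | h
        · -- the coefficients of `v_0, …, v_a` in the image vanish because `n = a` in `k`
          rw [weylForm, shiftExt_of_lt u h, shiftExt_of_lt u (show j - 1 < _ by omega)]
          rcases (Nat.lt_succ_iff.1 h).lt_or_eq with h | h
          · rw [shiftExt_of_lt u (show j + 1 < _ by omega)]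
            ring
          · have h2 : (n : MvPolynomial (Fin 2) k) - j = 0 := by rw [hna, h, sub_self]
            rw [h2]
            ring
        · obtain ⟨j, rfl⟩ := Nat.exists_eq_add_of_le h
          exact congr_fun hu (⟨j, by omega⟩ : Fin (n - n % p))
    -- the coefficient of `v_0` vanishes, so that the first basis vector does not occur
    have h0 : c none = 0 := by
      have h2 := h1 0 (Nat.zero_le n)
      rw [sum_weylKer, shiftExt_of_lt u (Nat.succ_pos _)] at h2
      simp only [weylVec, weylBlock, pow_zero, Nat.zero_mod, Nat.choose_zero_succ, Nat.cast_zero,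
        mul_zero, zero_mul, add_zero, mul_one, one_mul, Nat.sub_zero] at h2
      exact (mul_eq_zero.1 h2).resolve_right (pow_ne_zero _ hS)
    refine ⟨fun i ↦ c (some i), funext fun j ↦ ?_⟩
    have h2 := h1 (n % p + 1 + j) (by omega)
    rw [Fintype.sum_option, h0, zero_mul, zero_add, shiftExt_add_val] at h2
    rw [Finset.sum_apply, ← h2]
    rfl

end Kernel

end SlTwo

/-! ### Projective covers -/

namespace SlTwo

open MvPolynomial

namespace ProjCover

section Coefficients

variable (k : Type u) [Field k] (p a : ℕ) (ha : a + 1 < p)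

/-- The coefficient of `v_j`, which is zero for `j > 2 p - a - 2`. -/
noncomputable def coeffV (j : ℕ) : ProjCover k p a ha →ₗ[k] k where
  toFun x := zext x.1 j
  map_add' x y := zext_add x.1 y.1 j
  map_smul' c x := zext_smul c x.1 j

/-- The coefficient of `w_{p - a - 1 + l}`, which is zero for `l > a`. -/
noncomputable def coeffW (l : ℕ) : ProjCover k p a ha →ₗ[k] k where
  toFun x := zext x.2 l
  map_add' x y := zext_add x.2 y.2 l
  map_smul' c x := zext_smul c x.2 l

lemma coeffV_v (i j : ℕ) (hj : j ≤ 2 * p - a - 2) :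
    coeffV k p a ha j (v k p a ha i) = if j = i then 1 else 0 := by
  refine (zext_of_lt (N := 2 * p - a - 1) _ (by omega)).trans ?_
  change (if ((j : ℕ) : ℤ) = i then (1 : k) else 0) = _
  simp only [Nat.cast_inj]

lemma coeffV_v_of_le (i j : ℕ) (hi : i ≤ 2 * p - a - 2) :
    coeffV k p a ha j (v k p a ha i) = if j = i then 1 else 0 := by
  rcases le_or_gt j (2 * p - a - 2) with h | h
  · exact coeffV_v k p a ha i j h
  · rw [if_neg (by omega)]
    exact zext_of_le (N := 2 * p - a - 1) _ (by omega)

lemma coeffV_w (i : ℤ) (j : ℕ) : coeffV k p a ha j (w k p a ha i) = 0 :=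
  zext_zero (N := 2 * p - a - 1) j

lemma coeffW_v (i : ℤ) (l : ℕ) : coeffW k p a ha l (v k p a ha i) = 0 :=
  zext_zero (N := a + 1) l

lemma coeffW_w (i l : ℕ) (hi : i ≤ a) :
    coeffW k p a ha l (w k p a ha (p - a - 1 + i : ℕ)) = if l = i then 1 else 0 := by
  rcases lt_or_ge l (a + 1) with h | h
  · refine (zext_of_lt (N := a + 1) _ h).trans ?_
    change (if ((p - a - 1 + l : ℕ) : ℤ) = (p - a - 1 + i : ℕ) then (1 : k) else 0) = _
    simp only [Nat.cast_inj, Nat.add_left_cancel_iff]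
  · rw [if_neg (by omega)]
    exact zext_of_le _ h

variable {k p a ha} in
lemma ext_natCast {A B : ProjCover k p a ha →ₗ[k] k}
    (h1 : ∀ i : ℕ, i ≤ 2 * p - a - 2 → A (v k p a ha i) = B (v k p a ha i))
    (h2 : ∀ i ≤ a, A (w k p a ha (p - a - 1 + i : ℕ)) = B (w k p a ha (p - a - 1 + i : ℕ))) :
    A = B :=
  ext_vw (fun j h0 hj ↦ by
    lift j to ℕ using h0
    exact h1 j (by omega)) fun j h0 hj ↦ by
    obtain ⟨i, rfl, hi⟩ : ∃ i : ℕ, j = (p - a - 1 + i : ℕ) ∧ i ≤ a :=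
      ⟨(j - (p - a - 1)).toNat, by omega, by omega⟩
    exact h2 i hi

variable [CharP k p]

/-- The index `j = p - a - 1 + i` of `w_j`, modulo `p`. -/
lemma cast_weight (ha : a + 1 < p) (i : ℕ) : ((p - a - 1 + i : ℕ) : k) = i - a - 1 := by
  have h1 : ((p - a - 1 + i : ℕ) : k) + (a + 1 : ℕ) = (p : k) + i := by
    rw [← Nat.cast_add, ← Nat.cast_add, show p - a - 1 + i + (a + 1) = p + i by omega]
  rw [CharP.cast_eq_zero k p] at h1
  push_cast at h1 ⊢
  linear_combination h1

lemma coeffV_E (x : ProjCover k p a ha) (m : ℕ) (hm : m ≤ 2 * p - a - 2) :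
    coeffV k p a ha m (E k p a ha x) = -((a : k) + m + 2) * coeffV k p a ha (m + 1) x +
      if p ≤ m + a + 2 ∧ m + 2 ≤ p then ((m : k) + 1)⁻¹ * coeffW k p a ha (m + a + 2 - p) x
      else 0 := by
  suffices coeffV k p a ha m ∘ₗ E k p a ha =
      (-((a : k) + m + 2)) • coeffV k p a ha (m + 1) +
      if p ≤ m + a + 2 ∧ m + 2 ≤ p then ((m : k) + 1)⁻¹ • coeffW k p a ha (m + a + 2 - p)
      else 0 by
    have h1 := LinearMap.congr_fun this x
    split_ifs at h1 ⊢ <;> exact h1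
  refine ext_natCast (fun i hi ↦ ?_) fun i hi ↦ ?_
  · rw [LinearMap.comp_apply, E_v k p a ha _ (by omega), map_smul, LinearMap.add_apply,
      LinearMap.smul_apply, coeffV_v_of_le k p a ha i _ hi]
    have h2 : (if p ≤ m + a + 2 ∧ m + 2 ≤ p then
        ((m : k) + 1)⁻¹ • coeffW k p a ha (m + a + 2 - p) else 0) (v k p a ha i) = 0 := by
      split_ifs <;> simp [coeffW_v]
    rw [h2, add_zero]
    rcases i with _ | i
    · rw [v_eq_zero k p a ha (by simp)]
      simp
    · rw [show ((i + 1 : ℕ) : ℤ) - 1 = (i : ℕ) by push_cast; ring,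
        coeffV_v_of_le k p a ha i _ (by omega)]
      by_cases h : m = i
      · subst h
        simp
        ring
      · simp [h]
  · have hne : ((p - a - 1 + i : ℕ) : ℤ) - 1 = (p - a - 2 + i : ℕ) := by omega
    rw [LinearMap.comp_apply, E_w k p a ha (by omega) (by omega), map_add, map_smul, map_smul,
      coeffV_w, smul_zero, zero_add, hne, coeffV_v k p a ha _ _ hm, LinearMap.add_apply,
      LinearMap.smul_apply, coeffV_w, smul_zero, zero_add]
    by_cases h : m = p - a - 2 + i
    · rw [if_pos h, if_pos (by omega), LinearMap.smul_apply, show m + a + 2 - p = i by omega,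
        coeffW_w k p a ha i i hi, if_pos rfl, Int.cast_natCast,
        show p - a - 1 + i = m + 1 by omega, Nat.cast_succ]
    · rw [if_neg h, smul_zero]
      split_ifs
      · rw [LinearMap.smul_apply, coeffW_w k p a ha i _ hi, if_neg (by omega), smul_zero]
      · rfl

lemma coeffW_E (x : ProjCover k p a ha) (l : ℕ) :
    coeffW k p a ha l (E k p a ha x) = -((l : k) + 1) * coeffW k p a ha (l + 1) x := by
  suffices coeffW k p a ha l ∘ₗ E k p a ha = (-((l : k) + 1)) • coeffW k p a ha (l + 1) from
    LinearMap.congr_fun this x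
  refine ext_natCast (fun i hi ↦ ?_) fun i hi ↦ ?_
  · rw [LinearMap.comp_apply, E_v k p a ha _ (by omega), map_smul, coeffW_v, LinearMap.smul_apply,
      coeffW_v, smul_zero, smul_zero]
  · rw [LinearMap.comp_apply, E_w k p a ha (by omega) (by omega), map_add, map_smul, map_smul,
      coeffW_v, smul_zero, add_zero, LinearMap.smul_apply, coeffW_w k p a ha i _ hi]
    rcases i with _ | i
    · rw [w_eq_zero k p a ha (by omega), map_zero]
      simp
    · rw [show ((p - a - 1 + (i + 1) : ℕ) : ℤ) - 1 = (p - a - 1 + i : ℕ) by omega,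
        coeffW_w k p a ha i _ (by omega), Int.cast_natCast, cast_weight k p a ha]
      by_cases h : l = i
      · subst h
        simp
        ring
      · simp [h]

lemma coeffV_F (x : ProjCover k p a ha) (m : ℕ) (hm : m ≤ 2 * p - a - 2) :
    coeffV k p a ha m (F k p a ha x) = m * coeffV k p a ha (m - 1) x -
      if m = p then ((a : k) + 1)⁻¹ * coeffW k p a ha a x else 0 := by
  suffices coeffV k p a ha m ∘ₗ F k p a ha = (m : k) • coeffV k p a ha (m - 1) -
      if m = p then ((a : k) + 1)⁻¹ • coeffW k p a ha a else 0 by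
    have h1 := LinearMap.congr_fun this x
    split_ifs at h1 ⊢ <;> exact h1
  refine ext_natCast (fun i hi ↦ ?_) fun i hi ↦ ?_
  · rw [LinearMap.comp_apply, F_v k p a ha _ (by omega), map_smul, LinearMap.sub_apply,
      LinearMap.smul_apply, coeffV_v k p a ha i _ (by omega)]
    have h2 : (if m = p then ((a : k) + 1)⁻¹ • coeffW k p a ha a else 0) (v k p a ha i) = 0 := by
      split_ifs <;> simp [coeffW_v]
    rw [h2, sub_zero, ← Nat.cast_succ, coeffV_v k p a ha _ _ hm]
    rcases m with _ | m
    · simp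
    · by_cases h : m = i
      · subst h
        simp
      · simp [h]
  · rw [LinearMap.comp_apply, LinearMap.sub_apply, LinearMap.smul_apply, coeffV_w, smul_zero,
      zero_sub]
    rcases hi.lt_or_eq with hi' | rfl
    · rw [F_w k p a ha (by omega) (by omega), map_smul, coeffV_w, smul_zero]
      split_ifs
      · rw [LinearMap.smul_apply, coeffW_w k p a ha i _ hi, if_neg (by omega), smul_zero, neg_zero]
      · exact neg_zero.symm
    · have h1 : ((p - i - 1 + i : ℕ) : ℤ) = p - 1 := by omega
      have h2 : coeffW k p i ha i (w k p i ha (p - 1)) = 1 := by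
        rw [← h1, coeffW_w k p i ha i i le_rfl, if_pos rfl]
      rw [h1, F_w_last, map_neg, map_smul, coeffV_v k p i ha _ _ hm]
      split_ifs
      · rw [LinearMap.smul_apply, h2]
      · rw [smul_zero]
        rfl

lemma coeffW_F (x : ProjCover k p a ha) (l : ℕ) (hl : l ≤ a) :
    coeffW k p a ha l (F k p a ha x) =
      if l = 0 then 0 else -((a : k) - (l - 1 : ℕ)) * coeffW k p a ha (l - 1) x := by
  suffices coeffW k p a ha l ∘ₗ F k p a ha =
      if l = 0 then 0 else (-((a : k) - (l - 1 : ℕ))) • coeffW k p a ha (l - 1) by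
    have h1 := LinearMap.congr_fun this x
    split_ifs at h1 ⊢ <;> exact h1
  refine ext_natCast (fun i hi ↦ ?_) fun i hi ↦ ?_
  · rw [LinearMap.comp_apply, F_v k p a ha _ (by omega), map_smul, coeffW_v, smul_zero]
    split_ifs
    · rfl
    · rw [LinearMap.smul_apply, coeffW_v, smul_zero]
  · rw [LinearMap.comp_apply]
    rcases hi.lt_or_eq with hi' | rfl
    · rw [F_w k p a ha (by omega) (by omega), map_smul,
        show ((p - a - 1 + i : ℕ) : ℤ) + 1 = (p - a - 1 + (i + 1) : ℕ) by omega,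
        coeffW_w k p a ha _ _ (by omega), Int.cast_natCast, cast_weight k p a ha]
      rcases l with _ | l
      · simp
      · rw [if_neg l.succ_ne_zero, LinearMap.smul_apply, coeffW_w k p a ha i _ hi,
          Nat.add_sub_cancel]
        by_cases h : l = i
        · subst h
          simp
        · simp [h]
    · rw [show ((p - i - 1 + i : ℕ) : ℤ) = p - 1 by omega, F_w_last, map_neg, map_smul, coeffW_v,
        smul_zero, neg_zero, show (p : ℤ) - 1 = (p - i - 1 + i : ℕ) by omega]
      split_ifs
      · rfl
      · rw [LinearMap.smul_apply, coeffW_w k p i ha i _ le_rfl, if_neg (by omega), smul_zero]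

lemma coeffV_H (x : ProjCover k p a ha) (m : ℕ) (hm : m ≤ 2 * p - a - 2) :
    coeffV k p a ha m (H k p a ha x) = -((a : k) + 2 * m + 2) * coeffV k p a ha m x := by
  suffices coeffV k p a ha m ∘ₗ H k p a ha = (-((a : k) + 2 * m + 2)) • coeffV k p a ha m from
    LinearMap.congr_fun this x
  refine ext_natCast (fun i hi ↦ ?_) fun i hi ↦ ?_
  · rw [LinearMap.comp_apply, H_v, map_smul, LinearMap.smul_apply, coeffV_v k p a ha i m hm]
    by_cases h : m = i
    · subst h
      simp
    · simp [h]
  · rw [LinearMap.comp_apply, H_w, map_smul, LinearMap.smul_apply, coeffV_w, smul_zero, smul_zero]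

lemma coeffW_H (x : ProjCover k p a ha) (l : ℕ) :
    coeffW k p a ha l (H k p a ha x) = ((a : k) - 2 * l) * coeffW k p a ha l x := by
  suffices coeffW k p a ha l ∘ₗ H k p a ha = ((a : k) - 2 * l) • coeffW k p a ha l from
    LinearMap.congr_fun this x
  refine ext_natCast (fun i hi ↦ ?_) fun i hi ↦ ?_
  · rw [LinearMap.comp_apply, H_v, map_smul, LinearMap.smul_apply, coeffW_v, smul_zero, smul_zero]
  · rw [LinearMap.comp_apply, H_w, map_smul, LinearMap.smul_apply, coeffW_w k p a ha i l hi,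
      Int.cast_natCast, cast_weight k p a ha]
    by_cases h : l = i
    · subst h
      simp
      ring
    · simp [h]

end Coefficients

section Operator

variable (k : Type u) [Field k] (p a : ℕ)

/-- The operator `s ^ 2 e - t ^ 2 f + s t h` of `Q(a)`. The span of the `v_j` is the Weyl module
`V(2 p - a - 2)`, and the quotient is the dual of `V(a)` twisted by the automorphism of `sl_2` which
exchanges `e` and `f` and maps `h` to `-h`. -/
noncomputable def thetaMat :
    (Fin (2 * p - a - 1) ⊕ Fin (a + 1) → MvPolynomial (Fin 2) k) →ₗ[MvPolynomial (Fin 2) k]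
      (Fin (2 * p - a - 1) ⊕ Fin (a + 1) → MvPolynomial (Fin 2) k) where
  toFun u := Sum.elim
    (fun m ↦ weylForm (X 0) (X 1) (2 * p - a - 2) (zext (u ∘ Sum.inl)) m +
      (if p ≤ m + a + 2 ∧ (m : ℕ) + 2 ≤ p then
        X 0 ^ 2 * C (((m : ℕ) : k) + 1)⁻¹ * zext (u ∘ Sum.inr) (m + a + 2 - p) else 0) +
      (if (m : ℕ) = p then X 1 ^ 2 * C ((a : k) + 1)⁻¹ * zext (u ∘ Sum.inr) a else 0))
    (fun l ↦ -dualForm (X 1) (X 0) a (zext (u ∘ Sum.inr)) l)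
  map_add' u u' := by
    have h1 : zext ((u + u') ∘ Sum.inl) = fun i ↦ zext (u ∘ Sum.inl) i + zext (u' ∘ Sum.inl) i :=
      funext (zext_add (u ∘ Sum.inl) (u' ∘ Sum.inl))
    have h2 : zext ((u + u') ∘ Sum.inr) = fun i ↦ zext (u ∘ Sum.inr) i + zext (u' ∘ Sum.inr) i :=
      funext (zext_add (u ∘ Sum.inr) (u' ∘ Sum.inr))
    rw [h1, h2]
    funext j
    rcases j with m | l
    · simp only [Sum.elim_inl, Pi.add_apply, weylForm_add]
      split_ifs <;> ring
    · simp only [Sum.elim_inr, Pi.add_apply, dualForm_add]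
      ring
  map_smul' r u := by
    have h1 : zext ((r • u) ∘ Sum.inl) = fun i ↦ r * zext (u ∘ Sum.inl) i :=
      funext (zext_smul r (u ∘ Sum.inl))
    have h2 : zext ((r • u) ∘ Sum.inr) = fun i ↦ r * zext (u ∘ Sum.inr) i :=
      funext (zext_smul r (u ∘ Sum.inr))
    rw [h1, h2]
    funext j
    rcases j with m | l
    · simp only [Sum.elim_inl, Pi.smul_apply, weylForm_smul, RingHom.id_apply, smul_eq_mul]
      split_ifs <;> ring
    · simp only [Sum.elim_inr, Pi.smul_apply, dualForm_smul, RingHom.id_apply, smul_eq_mul]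
      ring

variable (ha : a + 1 < p)

/-- The coordinates in the basis `v_0, …, v_{2p-a-2}, w_{p-a-1}, …, w_{p-1}`. -/
noncomputable def coordEquiv :
    ProjCover k p a ha ≃ₗ[k] (Fin (2 * p - a - 1) ⊕ Fin (a + 1) → k) :=
  (LinearEquiv.sumArrowLequivProdArrow (Fin (2 * p - a - 1)) (Fin (a + 1)) k k).symm

variable [CharP k p] [Fact p.Prime]

lemma lie_e (x : ProjCover k p a ha) : ⁅e k, x⁆ = E k p a ha x := LinearMap.congr_fun rep_e x

lemma lie_f (x : ProjCover k p a ha) : ⁅f k, x⁆ = F k p a ha x := LinearMap.congr_fun rep_f x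

lemma lie_h (x : ProjCover k p a ha) : ⁅h k, x⁆ = H k p a ha x := LinearMap.congr_fun rep_h x

lemma isThetaMatrix : IsThetaMatrix (coordEquiv k p a ha) (thetaMat k p a) := by
  intro x
  have h1 : zext (constVec (coordEquiv k p a ha) x ∘ Sum.inl) =
      fun i ↦ C (σ := Fin 2) (coeffV k p a ha i x) :=
    funext fun i ↦ map_zext C x.1 i
  have h2 : zext (constVec (coordEquiv k p a ha) x ∘ Sum.inr) =
      fun i ↦ C (σ := Fin 2) (coeffW k p a ha i x) :=
    funext fun i ↦ map_zext C x.2 i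
  have hV (y : ProjCover k p a ha) (m : Fin (2 * p - a - 1)) :
      coordEquiv k p a ha y (Sum.inl m) = coeffV k p a ha m y := (zext_val y.1 m).symm
  have hW (y : ProjCover k p a ha) (l : Fin (a + 1)) :
      coordEquiv k p a ha y (Sum.inr l) = coeffW k p a ha l y := (zext_val y.2 l).symm
  have hn : ((2 * p - a - 2 : ℕ) : MvPolynomial (Fin 2) k) = -a - 2 := by
    have h3 : ((2 * p - a - 2 : ℕ) : MvPolynomial (Fin 2) k) + (a + 2 : ℕ) = (p : _) + p := by
      rw [← Nat.cast_add, ← Nat.cast_add, show 2 * p - a - 2 + (a + 2) = p + p by omega]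
    rw [CharP.cast_eq_zero _ p] at h3
    push_cast at h3
    linear_combination h3
  funext j
  change thetaMat k p a _ j = X 0 ^ 2 * C (coordEquiv k p a ha ⁅e k, x⁆ j) -
    X 1 ^ 2 * C (coordEquiv k p a ha ⁅f k, x⁆ j) + X 0 * X 1 * C (coordEquiv k p a ha ⁅h k, x⁆ j)
  rw [lie_e, lie_f, lie_h]
  rcases j with m | l
  · rw [hV, hV, hV, coeffV_E k p a ha x m (by omega), coeffV_F k p a ha x m (by omega),
      coeffV_H k p a ha x m (by omega)]
    change weylForm _ _ _ (zext (constVec (coordEquiv k p a ha) x ∘ Sum.inl)) _ + _ + _ = _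
    rw [h1, h2, weylForm, hn]
    split_ifs <;> simp only [map_add, map_sub, map_mul, map_neg, map_natCast, map_ofNat,
      map_zero] <;> ring
  · rw [hW, hW, hW, coeffW_E, coeffW_F k p a ha x l (by omega), coeffW_H]
    change -dualForm _ _ _ (zext (constVec (coordEquiv k p a ha) x ∘ Sum.inr)) _ = _
    rw [h2, dualForm]
    split_ifs with h
    · rw [h]
      simp only [map_add, map_sub, map_mul, map_neg, map_natCast, map_ofNat, map_one,
        map_zero, Nat.cast_zero]
      ring
    · simp only [map_add, map_sub, map_mul, map_neg, map_natCast, map_ofNat, map_one]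
      ring

end Operator

end ProjCover

section Kernel

variable {k : Type u} [Field k] [IsAlgClosed k] {p : ℕ} [Fact p.Prime] [CharP k p] {a : ℕ}

/-- A vector of `Q(a)` killed by the operator has vanishing coefficients of `w_j`. -/
lemma ProjCover.comp_inr_eq_zero (ha : a + 1 < p)
    (u : Fin (2 * p - a - 1) ⊕ Fin (a + 1) → MvPolynomial (Fin 2) k)
    (hu : ProjCover.thetaMat k p a u = 0) : u ∘ Sum.inr = 0 := by
  have hp := (Fact.out : p.Prime).pos
  have hn : 2 * p - a - 2 = 1 * p + (p - 2 - a) := by omega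
  obtain ⟨bb, hbb⟩ := exists_eq_of_dualForm (p := p) (r := 0) (a := a) (n := a)
    (X_ne_zero (R := k) (1 : Fin 2)) (X_ne_zero 0) (X_dvd_of_dvd_X_mul (by decide)) (by omega)
    (by omega) (zext (u ∘ Sum.inr)) (fun l hl ↦ neg_eq_zero.1 <|
      congr_fun hu (Sum.inr (⟨l, by omega⟩ : Fin (a + 1))))
  -- the equations at `v_0, …, v_{p-a-3}` do not involve the coefficients of the `w_j`
  have hV (m : ℕ) (hm : m < p - 2 - a) :
      weylForm (X 0) (X 1) (2 * p - a - 2) (zext (u ∘ Sum.inl)) m = 0 := by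
    have h1 := congr_fun hu (Sum.inl (⟨m, by omega⟩ : Fin (2 * p - a - 1)))
    change weylForm _ _ _ _ m + (if p ≤ m + a + 2 ∧ m + 2 ≤ p then _ else 0) +
      (if m = p then _ else 0) = (0 : MvPolynomial (Fin 2) k) at h1
    rwa [if_neg (by omega), if_neg (by omega), add_zero, add_zero] at h1
  have hna : ((2 * p - a - 2 : ℕ) : MvPolynomial (Fin 2) k) = (p - 2 - a : ℕ) := by
    rw [hn, one_mul, Nat.cast_add, CharP.cast_eq_zero _ p, zero_add]
  have hV' : weylForm (X 0) (X 1) (2 * p - a - 2) (zext (u ∘ Sum.inl)) (p - 2 - a) = 0 := by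
    rw [weylForm, hna, sub_self, zero_mul, zero_mul, zero_sub, neg_eq_zero]
    rcases Nat.eq_zero_or_pos (p - 2 - a) with h | h
    · rw [h, Nat.cast_zero, zero_mul, zero_mul]
    · have h1 := diff_eq_zero_of_weylForm (X_ne_zero (R := k) (0 : Fin 2)) hn (by omega)
        (zext (u ∘ Sum.inl)) 0 (m := p - 2 - a - 1)
        (fun m hm ↦ by rw [mul_zero, zero_add]; exact hV m (by omega)) (by omega)
      rw [mul_zero, zero_add, show p - 2 - a - 1 + 1 = p - 2 - a by omega] at h1
      rw [h1, mul_zero]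
  -- the equation at `v_{p-a-2}` involves only the coefficient of `w_{p-a-1}`
  have h0 : zext (u ∘ Sum.inr) 0 = 0 := by
    have h1 := congr_fun hu (Sum.inl (⟨p - 2 - a, by omega⟩ : Fin (2 * p - a - 1)))
    change weylForm _ _ _ _ (p - 2 - a) + (if p ≤ p - 2 - a + a + 2 ∧ p - 2 - a + 2 ≤ p then
      X 0 ^ 2 * C (((p - 2 - a : ℕ) : k) + 1)⁻¹ *
        zext (u ∘ Sum.inr) (p - 2 - a + a + 2 - p) else 0) +
      (if p - 2 - a = p then _ else 0) = (0 : MvPolynomial (Fin 2) k) at h1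
    rw [if_pos (by omega), if_neg (by omega), add_zero, hV', zero_add,
      show p - 2 - a + a + 2 - p = 0 by omega] at h1
    refine (mul_eq_zero.1 h1).resolve_left (mul_ne_zero (pow_ne_zero _ (X_ne_zero 0)) ?_)
    rw [Ne, C_eq_zero, inv_eq_zero, ← Nat.cast_succ]
    exact natCast_ne_zero_of_lt p (by omega) (by omega)
  have hb : bb 0 = 0 := by
    have h1 := hbb 0 (Nat.zero_le a)
    rw [h0, Nat.zero_div, Nat.zero_mod, dualBlock] at h1
    refine (mul_eq_zero.1 h1.symm).resolve_right ?_
    simp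
  funext l
  rw [← zext_val (u ∘ Sum.inr) l, hbb l (by omega), Nat.div_eq_of_lt (by omega), hb, zero_mul]
  rfl

theorem nonempty_kerTheta_projCover_iso (ha : a + 1 < p) :
    Nonempty (kerTheta k p (ProjCover k p a ha) ≅
      O k (-(a : ℤ)) ⊞ O k ((a : ℤ) + 2 - 2 * p)) := by
  have hp := (Fact.out : p.Prime).pos
  have hn : 2 * p - a - 2 = 1 * p + (p - 2 - a) := by omega
  have hr : 1 = 0 ∨ p - 2 - a + 1 < p := Or.inr (by omega)
  let κ (i : Option (Fin 1)) : Fin (2 * p - a - 1) ⊕ Fin (a + 1) → MvPolynomial (Fin 2) k :=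
    Sum.elim (fun m ↦ weylKer p (X 0) (X 1) (2 * p - a - 2) (p - 2 - a) i m) 0
  have hκ (i : Option (Fin 1)) : ProjCover.thetaMat k p a (κ i) = 0 := by
    have h1 : zext (κ i ∘ Sum.inr) = 0 := funext zext_zero
    funext j
    rcases j with m | l
    · change weylForm _ _ _ (zext (κ i ∘ Sum.inl)) m +
        (if p ≤ m + a + 2 ∧ (m : ℕ) + 2 ≤ p then _ * _ * zext (κ i ∘ Sum.inr) _ else 0) +
        (if (m : ℕ) = p then _ * _ * zext (κ i ∘ Sum.inr) _ else 0) = 0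
      rw [h1, weylForm_weylKer hn (by omega) hr i (zext (κ i ∘ Sum.inl))
        (fun j hj ↦ zext_of_lt _ (by omega)) m (by omega)]
      simp
    · change -dualForm _ _ _ (zext (κ i ∘ Sum.inr)) _ = 0
      rw [h1]
      simp [dualForm]
  obtain ⟨α⟩ := (ProjCover.isThetaMatrix k p a ha).nonempty_kerTheta_iso_biprod
    (d := fun i ↦ i.elim (2 * p - a - 2) fun _ ↦ p - 2 - (p - 2 - a)) (κ := κ)
    (m₀ := (a : ℤ) + 2 - 2 * p) (m := fun _ ↦ -(a : ℤ))
    (by rw [Option.elim_none]; omega) (fun i ↦ by rw [Option.elim_some]; omega)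
    (fun i j ↦ by
      rcases j with m | l
      · exact isHomogeneous_weylKer (isHomogeneous_X k 0) (isHomogeneous_X k 1) hp i (by omega)
      · exact isHomogeneous_zero _ _ _)
    hκ
    (fun c hc ↦ weylKer_linearIndependent (T := X 1) (X_ne_zero 0) hn (by omega) hr c
      fun j hj ↦ by
        have h1 := congr_fun hc (Sum.inl (⟨j, by omega⟩ : Fin (2 * p - a - 1)))
        rwa [Finset.sum_apply] at h1)
    (fun u hu ↦ by
      have hW := ProjCover.comp_inr_eq_zero ha u hu
      obtain ⟨c, h1⟩ := exists_sum_weylKer_eq (X_ne_zero (R := k) (0 : Fin 2)) (X_ne_zero 1)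
        (X_dvd_of_dvd_X_mul (by decide)) hn (by omega) hr (zext (u ∘ Sum.inl)) fun j hj ↦ by
          have h1 := congr_fun hu (Sum.inl (⟨j, by omega⟩ : Fin (2 * p - a - 1)))
          change weylForm _ _ _ _ j +
            (if p ≤ j + a + 2 ∧ j + 2 ≤ p then _ * _ * zext (u ∘ Sum.inr) _ else 0) +
            (if j = p then _ * _ * zext (u ∘ Sum.inr) _ else 0) = 0 at h1
          rwa [hW, zext_zero, zext_zero, mul_zero, mul_zero, ite_self, ite_self, add_zero,
            add_zero] at h1
      refine ⟨c, funext fun j ↦ ?_⟩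
      rw [Finset.sum_apply]
      rcases j with m | l
      · exact (h1 m (by omega)).trans (zext_val (u ∘ Sum.inl) m)
      · rw [show u (Sum.inr l) = 0 from congr_fun hW l]
        exact Finset.sum_eq_zero fun i _ ↦ mul_zero _)
  exact ⟨α ≪≫ biprod.mapIso (Iso.refl _) (biproductUniqueIso _) ≪≫ biprod.braiding _ _⟩

end Kernel

end SlTwo

/-! ### The kernel bundles -/

theorem mainTheorem1 (k : Type u) [Field k] [IsAlgClosed k] (p : ℕ) [Fact p.Prime] [CharP k p]
    (lam r a : ℕ) (hlam : lam = r * p + a) (ha : a < p) :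
    IsIso (iota k p) ∧
    (p ≤ lam → ¬ p ∣ lam + 1 → ∀ ξ : Projectivization k (Fin 2 → k),
      Nonempty (kerTheta k p (Phi k lam p ξ) ≅ ⨁ fun _ : Fin r ↦ O k ((a : ℤ) + 2 - p))) ∧
    (lam < p ∨ ¬ p ∣ lam + 1 →
      Nonempty (kerTheta k p (Weyl k lam) ≅
        O k (-(lam : ℤ)) ⊞ ⨁ fun _ : Fin r ↦ O k ((a : ℤ) + 2 - p))) ∧
    (lam < p ∨ ¬ p ∣ lam + 1 →
      Nonempty (kerTheta k p (DualWeyl k lam) ≅ ⨁ fun _ : Fin (r + 1) ↦ O k (-(a : ℤ)))) ∧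
    (∀ ha' : a + 1 < p,
      Nonempty (kerTheta k p (ProjCover k p a ha') ≅
        O k (-(a : ℤ)) ⊞ O k ((a : ℤ) + 2 - 2 * p))) := by 
  have hr (h : lam < p ∨ ¬ p ∣ lam + 1) : r = 0 ∨ a + 1 < p := by
    rcases h with h | h
    · exact Or.inl (Nat.eq_zero_of_not_pos fun h0 ↦ by nlinarith)
    · refine Or.inr (lt_of_le_of_ne ha fun h1 ↦ h ⟨r + 1, ?_⟩)
      rw [hlam, mul_comm p, Nat.succ_mul, add_assoc, ← h1]
  refine ⟨inferInstance, fun h1 h2 ξ ↦ ?_, fun h ↦ nonempty_kerTheta_weyl_iso hlam ha (hr h),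
    fun _ ↦ nonempty_kerTheta_dualWeyl_iso hlam ha, nonempty_kerTheta_projCover_iso⟩
  refine nonempty_kerTheta_phi_iso hlam ((hr (Or.inr h2)).resolve_left ?_) ξ
  rintro rfl
  omega
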